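/- **Setting.** Let $N\ge 2$ and let $\mathcal G$ be a connected undirected graph on $\{1,\dots,N\}$. Let $W\in\mathbb R^{N\times N}$ be symmetric with row sums $1$, $W_{ij}>0$ for edges $ij$, $W_{ij}=0$ for $i\ne j$ not adjacent, and $W_{ii}>0$; let $1=\lambda_1>\lambda_2\ge\dots\ge\lambda_N$ be its eigenvalues, assume $\lambda_N>0$, and put $\gamma=\max\{|\lambda_2|,|\lambda_N|\}$. Let $0<\mu\le L$ and let $f_1,\dots,f_N:\mathbb R^d\to\mathbb R$ be differentiable with $\frac{\mu}{2}\|x-y\|^2\le f_i(x)-f_i(y)-\nabla f_i(y)^T(x-y)\le\frac L2\|x-y\|^2$ for all $x,y$. Let $x_*$ be the minimizer of $\frac1N\sum_i f_i$, let $x^*=(x_*,\dots,x_*)\in\mathbb R^{Nd}$, and let $\tilde\kappa=\frac{L+\mu}{\mu\lambda_N}$. **Algorithm (D-MASG).** Given a deterministic $x^{(0)}\in\mathbb R^{Nd}$, stepsizes $\alpha_t$ and stage lengths $k_t$ ($t\ge1$), put $x^{(0,k_0)}=x^{(0)}$, and in stage $t$ put $x^{(t,-1)}=x^{(t,0)}=x^{(t-1,k_{t-1})}$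 and, for $0\le m<k_t$, with $\beta_t=\frac{1-\sqrt{\mu\alpha_t}}{1+\sqrt{\mu\alpha_t}}$, $$y^{(t,m)}=(1+\beta_t)x^{(t,m)}-\beta_t x^{(t,m-1)},\qquad x_i^{(t,m+1)}=\sum_j W_{ij}\,y_j^{(t,m)}-\alpha_t\,\tilde\nabla f_i\big(y_i^{(t,m)},w_i^{(n)}\big),\quad n=L_{t-1}+m,$$ where $L_t=k_1+\dots+k_t$. Let $x^{(k)}=x^{(t,k-L_{t-1})}$ for $L_{t-1}<k\le L_t$, and $\bar x^{(k)}=\frac1N\sum_i x_i^{(k)}$. The samples $w_i^{(n)}$ are independent over all $i$ and $n$, and the gradient estimates used satisfy, for a constant $\sigma$, $$\mathbb E\big[\tilde\nabla f_i(y_i,w_i)\,\big|\,y_i\big]=\nabla f_i(y_i),\qquad \mathbb E\big[\|\tilde\nabla f_i(y_i,w_i)-\nabla f_i(y_i)\|^2\,\big|\,y_i\big]\le\sigma^2 .$$ For $p\ge7$ the parameters are $\alpha_1=\frac{\lambda_N}{L+\mu}$, and $k_t=2^t\lceil p\sqrt{\tilde\kappa}\log 2\rceil$, $\alpha_t=\frac{\lambda_N}{2^{2t}(L+\mu)}$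 for $t\ge2$; the length $k_1$ is specified below. **Claim.** There is an absolute constant $A>0$, and for all data $(N,d,\mathcal G,W,(f_i),\mu,L,\sigma,x^{(0)})$ a constant $C_0>0$ (depending on these data, but not on $k$, $p$, $C$, $k_1$ or the gradient estimates), such that the following holds with $K=A$ and $V=\frac{\sigma^2}{N\mu^2}$, and also with $K=A\max\{1,\mu^{-1/2}\}$ and $V=\frac{\sigma^2}{N\mu\sqrt\mu}$. (a) Let $p\ge 7$ be real and $k_1=\lceil(p-2)\log(6p\tilde\kappa)\sqrt{\tilde\kappa}\rceil$. For all $k\ge 2k_1$ and $1\le i\le N$, $$\mathbb E\|\bar x^{(k)}-x_*\|^2\le K\Big(\frac{1}{k^{p-2}}\frac{\|x^{(0)}-x^*\|^2}{N}+\frac{pV}{k}+\frac{p^4C_0L^2(1-\gamma)^{-2}}{N\mu^2k^4}\Big),$$ $$\mathbb E\|x_i^{(k)}-x_*\|^2\le K\Big(\frac{1}{k^{p-2}}\frac{\|x^{(0)}-x^*\|^2}{N}+\frac{pV}{k}+\Big(\frac{L^2}{N\mu^2}+1\Big)\frac{p^4C_0(1-\gamma)^{-2}}{k^4}\Big).$$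 (b) Let $C\ge2$ be real and let $k\ge2\sqrt{\tilde\kappa}$ be a given integer. If D-MASG is run with $p=7$ and $k_1=\lceil k/C\rceil$, then for $1\le i\le N$, $$\mathbb E\|\bar x^{(k)}-x_*\|^2\le K\Big(e^{-k/(C\sqrt{\tilde\kappa})}\frac{\|x^{(0)}-x^*\|^2}{N}+\frac{V}{k}+\frac{C_0L^2(1-\gamma)^{-2}}{N\mu^2k^4}\Big),$$ $$\mathbb E\|x_i^{(k)}-x_*\|^2\le K\Big(e^{-k/(C\sqrt{\tilde\kappa})}\frac{\|x^{(0)}-x^*\|^2}{N}+\frac{V}{k}+\Big(\frac{L^2}{N\mu^2}+1\Big)\frac{C_0(1-\gamma)^{-2}}{k^4}\Big).$$ -/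

import Mathlib

open MeasureTheory ProbabilityTheory
open scoped Gradient RealInnerProductSpace

namespace DistASG

/-- The decision space `ℝ^d` of one node. -/
abbrev E (d : ℕ) : Type := EuclideanSpace ℝ (Fin d)

/-- The class `S_{μ,L}(ℝ^d)` of `μ`-strongly convex and `L`-smooth functions. -/
def StronglyConvexSmooth {d : ℕ} (μ L : ℝ) (f : E d → ℝ) : Prop :=
  Differentiable ℝ f ∧ ∀ x y : E d,
    μ / 2 * ‖x - y‖ ^ 2 ≤ f x - f y - ⟪∇ f y, x - y⟫ ∧
    f x - f y - ⟪∇ f y, x - y⟫ ≤ L / 2 * ‖x - y‖ ^ 2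

/-- `W` is a symmetric doubly stochastic weight matrix of the graph `G`, with positive diagonal. -/
structure IsMixingMatrix {N : ℕ} (G : SimpleGraph (Fin N)) (W : Matrix (Fin N) (Fin N) ℝ) :
    Prop where
  symm : W.IsHermitian
  pos_of_adj : ∀ i j, G.Adj i j → 0 < W i j
  zero_of_not_adj : ∀ i j, i ≠ j → ¬ G.Adj i j → W i j = 0
  diag_pos : ∀ i, 0 < W i i
  row_sum : ∀ i, ∑ j, W i j = 1

/-- The `j`-th eigenvalue of `W` in decreasing order, counted from `0` and with multiplicity. -/
noncomputable def eig {N : ℕ} {W : Matrix (Fin N) (Fin N) ℝ} (hW : W.IsHermitian) (j : Fin N) : ℝ :=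
  hW.eigenvalues₀ (Fin.cast (Fintype.card_fin N).symm j)

/-- The smallest eigenvalue `λ_N` of `W`. -/
noncomputable def lamMin {N : ℕ} {W : Matrix (Fin N) (Fin N) ℝ} (hW : W.IsHermitian) (hN : 2 ≤ N) :
    ℝ :=
  eig hW ⟨N - 1, by omega⟩

/-- `γ = max {|λ_2|, |λ_N|}`. -/
noncomputable def gam {N : ℕ} {W : Matrix (Fin N) (Fin N) ℝ} (hW : W.IsHermitian) (hN : 2 ≤ N) :
    ℝ :=
  max |eig hW ⟨1, by omega⟩| |lamMin hW hN|

/-- The scaled condition number `κ̃ = (L + μ) / (μ λ_N)`. -/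
noncomputable def kappaTilde (lam μ L : ℝ) : ℝ := (L + μ) / (μ * lam)

/-- `(W ⊗ I_d) y`: node `i` averages the vectors of its neighbours. -/
noncomputable def mix {N d : ℕ} (W : Matrix (Fin N) (Fin N) ℝ) (y : Fin N → E d) : Fin N → E d :=
  fun i => ∑ j, W i j • y j

/-- The node average. -/
noncomputable def nodeAvg {N d : ℕ} (x : Fin N → E d) : E d := (N : ℝ)⁻¹ • ∑ i, x i

/-- The momentum parameter `β = (1 - √(μ α)) / (1 + √(μ α))`. -/
noncomputable def momentum (μ α : ℝ) : ℝ := (1 - √(μ * α)) / (1 + √(μ * α))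

/-- The extrapolated point `y = (1 + β) x - β x⁻` of a pair (current iterate, previous iterate). -/
noncomputable def extrapolate {N d : ℕ} (β : ℝ) (s : (Fin N → E d) × (Fin N → E d)) : Fin N → E d :=
  (1 + β) • s.1 - β • s.2

/-- The data of a multistage run. Stages are numbered from `1`; the values of `stepsize` and `len`
at `0` are irrelevant. `grad i y s` is the estimate of the gradient of the `i`-th objective at `y`
that node `i` computes from the random sample `s`. -/
structure Run (N d : ℕ) (S : Type*) where
  W : Matrix (Fin N) (Fin N) ℝ
  μ : ℝ
  stepsize : ℕ → ℝ
  len : ℕ → ℕ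
  init : Fin N → E d
  grad : Fin N → E d → S → E d

namespace Run

variable {N d : ℕ} {S : Type*} (R : Run N d S)

/-- `L_t = k_1 + ⋯ + k_t`, the number of iterations up to the end of stage `t`. -/
def total (t : ℕ) : ℕ := ∑ i ∈ Finset.Icc 1 t, R.len i

/-- The pair `(x^{(t,m)}, x^{(t,m-1)})` if stage `t ≥ 1` is started at `z`, that is, with
`x^{(t,0)} = x^{(t,-1)} = z`. The sample used by node `i` in the gradient evaluation number `n`
is `w i n`; inner iteration `m` of stage `t` is evaluation number `L_{t-1} + m`. -/
noncomputable def stageFrom (w : Fin N → ℕ → S) (t : ℕ) (z : Fin N → E d) :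
    ℕ → (Fin N → E d) × (Fin N → E d)
  | 0 => (z, z)
  | m + 1 =>
    let s := stageFrom w t z m
    let y := extrapolate (momentum R.μ (R.stepsize t)) s
    (fun i => mix R.W y i - R.stepsize t • R.grad i (y i) (w i (R.total (t - 1) + m)), s.1)

/-- The last iterate `x^{(t,k_t)}` of stage `t`, and the initial point for `t = 0`. -/
noncomputable def stageEnd (w : Fin N → ℕ → S) : ℕ → Fin N → E d
  | 0 => R.init
  | t + 1 => (R.stageFrom w (t + 1) (stageEnd w t) (R.len (t + 1))).1

/-- The pair `(x^{(t,m)}, x^{(t,m-1)})` for a stage `t ≥ 1` of the run. -/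
noncomputable def inner (w : Fin N → ℕ → S) (t m : ℕ) : (Fin N → E d) × (Fin N → E d) :=
  R.stageFrom w t (R.stageEnd w (t - 1)) m

/-- The point `y^{(t,m)}` at which the gradients are evaluated. -/
noncomputable def query (w : Fin N → ℕ → S) (t m : ℕ) : Fin N → E d :=
  extrapolate (momentum R.μ (R.stepsize t)) (R.inner w t m)

/-- For `k ≥ 1`, the pair `(t, m)` with `k = L_{t-1} + m` and `1 ≤ m ≤ k_t`. -/
def position : ℕ → ℕ × ℕ
  | 0 => (1, 0)
  | k + 1 =>
    let q := position k
    if q.2 < R.len q.1 then (q.1, q.2 + 1) else (q.1 + 1, 1)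

/-- The iterate `x^{(k)}` of the concatenated sequence: `x^{(k)} = x^{(t, k - L_{t-1})}` for
`L_{t-1} < k ≤ L_t`. -/
noncomputable def iterate (w : Fin N → ℕ → S) (k : ℕ) : Fin N → E d :=
  (R.inner w (R.position k).1 (R.position k).2).1

/-- `position k` is the place of the `k`-th iterate in the run. -/
theorem position_spec (hlen : ∀ t, 1 ≤ t → 1 ≤ R.len t) (k : ℕ) (hk : 1 ≤ k) :
    1 ≤ (R.position k).1 ∧ 1 ≤ (R.position k).2 ∧ (R.position k).2 ≤ R.len (R.position k).1 ∧
      R.total ((R.position k).1 - 1) + (R.position k).2 = k := by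
  induction k, hk using Nat.le_induction with
  | base =>
    have h1 := hlen 1 le_rfl
    have h0 : 0 < R.len 1 := h1
    simp [position, h0, total]
    omega
  | succ k hk ih =>
    obtain ⟨a, b, c, e⟩ := ih
    rw [position]
    by_cases h : (R.position k).2 < R.len (R.position k).1
    · simp only [h, if_true]
      refine ⟨a, ?_, ?_, ?_⟩ <;> omega
    · simp only [h, if_false]
      refine ⟨by omega, le_rfl, hlen _ (by omega), ?_⟩
      obtain ⟨t, ht⟩ : ∃ t, (R.position k).1 = t + 1 := ⟨_, (Nat.sub_add_cancel a).symm⟩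
      rw [ht] at c h e ⊢
      simp only [Nat.add_sub_cancel] at e ⊢
      have : R.total (t + 1) = R.total t + R.len (t + 1) := by
        simp [total, Finset.sum_Icc_succ_top]
      omega

variable {Ω : Type*} [MeasurableSpace Ω] [MeasurableSpace S]

/-- The gradient error of node `i` in inner iteration `m` of stage `t`. -/
noncomputable def noise (f : Fin N → E d → ℝ) (w : Fin N → ℕ → Ω → S) (t m : ℕ) (i : Fin N)
    (ω : Ω) : E d :=
  let y := R.query (fun j n => w j n ω) t m i
  R.grad i y (w i (R.total (t - 1) + m) ω) - ∇ (f i) y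

/-- The `σ`-algebra generated by the point at which node `i` evaluates its gradient in inner
iteration `m` of stage `t`. -/
noncomputable abbrev queryAlg (w : Fin N → ℕ → Ω → S) (t m : ℕ) (i : Fin N) : MeasurableSpace Ω :=
  MeasurableSpace.comap (fun ω => R.query (fun j n => w j n ω) t m i) inferInstance

/-- The assumption on the gradient estimates: the samples are independent over nodes and over
iterations and, conditionally on the point at which it is evaluated, each estimate that the run
uses is unbiased with variance at most `σ²`. -/
structure NoiseAssumption (f : Fin N → E d → ℝ) (σ : ℝ) (P : Measure Ω)
    (w : Fin N → ℕ → Ω → S) : Prop where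
  measurable_grad : ∀ i, Measurable (Function.uncurry (R.grad i))
  measurable_sample : ∀ i n, Measurable (w i n)
  indep : iIndepFun (fun q : Fin N × ℕ => w q.1 q.2) P
  memLp : ∀ t, 1 ≤ t → ∀ m < R.len t, ∀ i, MemLp (R.noise f w t m i) 2 P
  unbiased : ∀ t, 1 ≤ t → ∀ m < R.len t, ∀ i,
    P[R.noise f w t m i | R.queryAlg w t m i] =ᵐ[P] fun _ => 0
  variance_le : ∀ t, 1 ≤ t → ∀ m < R.len t, ∀ i,
    P[fun ω => ‖R.noise f w t m i ω‖ ^ 2 | R.queryAlg w t m i] ≤ᵐ[P] fun _ => σ ^ 2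

end Run

/-- The stage lengths `k_1` and `k_t = 2^t ⌈p √κ̃ log 2⌉` for `t ≥ 2`. -/
noncomputable def stageLength (kap p : ℝ) (k₁ : ℕ) (t : ℕ) : ℕ :=
  if t ≤ 1 then k₁ else 2 ^ t * ⌈p * √kap * Real.log 2⌉₊

/-- The stepsizes `α_1 = λ_N / (L + μ)` and `α_t = λ_N / (2^{2t} (L + μ))` for `t ≥ 2`. -/
noncomputable def stageStep (lam μ L : ℝ) (t : ℕ) : ℝ :=
  if t ≤ 1 then lam / (L + μ) else lam / (2 ^ (2 * t) * (L + μ))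

/-- The run of D-MASG with first stage length `k₁` and parameter `p`. -/
noncomputable def dmasg {N d : ℕ} {S : Type*} (W : Matrix (Fin N) (Fin N) ℝ) (lam μ L p : ℝ)
    (k₁ : ℕ) (x₀ : Fin N → E d) (grad : Fin N → E d → S → E d) : Run N d S where
  W := W
  μ := μ
  stepsize := stageStep lam μ L
  len := stageLength (kappaTilde lam μ L) p k₁
  init := x₀
  grad := grad

end DistASG

/-! The constant C₀ may depend on the starting point, so from the second stage on every remnant of
the initial error can be charged to it. The decay terms k^{-(p-2)} and exp(-k/(C√κ̃)) are therefore
only kept as nonnegative quantities. What has to be shown is that in each stage t ≥ 2 the expected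
squared error is O(√(μα_t)) σ²/(Nμ²) + O(α_t²), with an absolute first constant and a second one
that depends on the data but not on p, k₁ or the gradient estimates. Once 2k₁ ≤ k + 2, the stage
containing k satisfies √(μα_t) ≤ 5p/k (`exists_stage_position`), and the two terms become pV/k and
p⁴/k⁴.

Three Lyapunov functions are followed together.

(1) D-MASG is Nesterov's method with step α for the penalized objective ∑ f_i(x_i) + (1/2α)⟨x,
(I-W)x⟩, which is 1/α-smooth because L + (1-λ_N)/α ≤ 1/α. The usual energy estimate `asg_step`,
taken at the consensus point x^* rather than at the penalized minimizer, gives `penV_step`. Its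
expectation stays bounded over all stages (`expPen_bound`), and so do the second moments of the
gradient estimates.

(2) The deviations from the average follow d⁺ = W((1+β)d - βd⁻), perturbed by α times these
estimates. On an eigenvector of W with eigenvalue τ, the energy (1-τ)|d|² + τ|d-d⁻|² becomes
τ(1-τ)|d|² + β²τ²|d-d⁻|², which is at most τ times its old value (`energy_contract`). Hence the
disagreement energy is O(α_t²) (`expCons_bound`).

(3) The average iterate performs an accelerated step for the mean objective. Its gradient bias is
controlled by L times the disagreement, and its noise is averaged over independent nodes, whence
σ²/N (`avgV_step`, `expAvg_bound`).

The noise is assumed centred only conditionally on the node's own query point, whereas the energy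
estimates pair it with directions that depend on the whole past. Independence of the fresh sample
from the past closes this gap by Fubini (`integral_inner_noise_eq_zero`).

Between stages, a restart costs a factor 18 for (1), 1 for (2) and 2 for (3). Stages t ≥ 2 satisfy
k_t√(μα_t) ≥ 7 log 2, so (1) gains 2⁻⁷ and (3) gains 2⁻⁶ per stage, enough to follow the decrease of
α² by 16. The rate ρ of (2) is unrelated to κ̃. There k_t ≥ t is used, so that ρ-type powers
eventually beat any fixed factor (`exists_bound_of_contraction`). -/

namespace DistASG

/-! ### The accelerated step with inexact gradient, and the energy of disagreement. -/

section Step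

variable {H : Type*} [NormedAddCommGroup H] [InnerProductSpace ℝ H]

/-- One step of Nesterov's method with an inexact gradient `g + ε`, measured against an arbitrary
reference point `r`. -/
theorem asg_step {μ α q Fx Fy Fr Fp : ℝ} {x y z r g ε p : H} (hq : 0 < q) (hq1 : q ≤ 1)
    (hα : 0 < α) (hμ : 0 ≤ μ) (hqα : q ^ 2 = μ * α) (hy : (1 + q) • y = x + q • z)
    (hp : p = y - α • (g + ε))
    (hFp : Fp ≤ Fy + ⟪g, p - y⟫ + 1 / (2 * α) * ‖p - y‖ ^ 2)
    (hFx : Fy + ⟪g, x - y⟫ ≤ Fx)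
    (hFr : Fy + ⟪g, r - y⟫ + μ / 2 * ‖r - y‖ ^ 2 ≤ Fr) :
    Fp - Fr + μ / 2 * ‖x + q⁻¹ • (p - x) - r‖ ^ 2 ≤
      (1 - q) * (Fx - Fr + μ / 2 * ‖z - r‖ ^ 2)
        + ⟪ε, α • g - (y - (1 - q) • x - q • r)⟫ + α * ‖ε‖ ^ 2 := by
  obtain ⟨a, rfl⟩ : ∃ a, z = r + a := ⟨z - r, by abel⟩
  obtain ⟨b, rfl⟩ : ∃ b, y = r + b := ⟨y - r, by abel⟩
  have hx : x = r + ((1 + q) • b - q • a) := by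
    have : x = (1 + q) • (r + b) - q • (r + a) := by rw [hy]; abel
    rw [this]; module
  subst hx hp
  have e1 : r + ((1 + q) • b - q • a) + q⁻¹ • (r + b - α • (g + ε) - (r + ((1 + q) • b - q • a)))
      - r = ((1 - q) • a + q • b) - (α / q) • (g + ε) := by
    have : r + b - α • (g + ε) - (r + ((1 + q) • b - q • a)) = q • (a - b) - α • (g + ε) := by
      module
    rw [this, smul_sub, smul_smul, smul_smul, inv_mul_cancel₀ hq.ne', div_eq_inv_mul]
    module
  have e2 : r + b - (1 - q) • (r + ((1 + q) • b - q • a)) - q • r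
      = q • ((1 - q) • a + q • b) := by module
  have e3 : r + b - α • (g + ε) - (r + b) = - (α • (g + ε)) := by abel
  have e4 : r + ((1 + q) • b - q • a) - (r + b) = q • (b - a) := by module
  have e5 : r - (r + b) = - b := by abel
  have e6 : r + a - r = a := by abel
  rw [e1, e2, e6]
  rw [e3] at hFp
  rw [e4] at hFx
  rw [e5] at hFr
  set U := (1 - q) • a + q • b with hU
  have k1 : ‖U - (α / q) • (g + ε)‖ ^ 2
      = ‖U‖ ^ 2 - 2 * (α / q) * ⟪U, g + ε⟫ + (α / q) ^ 2 * ‖g + ε‖ ^ 2 := by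
    rw [norm_sub_sq_real, inner_smul_right, norm_smul, mul_pow, Real.norm_eq_abs, sq_abs]
    ring
  have k2 : ‖U‖ ^ 2 ≤ (1 - q) * ‖a‖ ^ 2 + q * ‖b‖ ^ 2 := by
    have h : ‖U‖ ^ 2 = (1 - q) * ‖a‖ ^ 2 + q * ‖b‖ ^ 2 - q * (1 - q) * ‖a - b‖ ^ 2 := by
      rw [hU, norm_add_sq_real, norm_sub_sq_real, inner_smul_left, inner_smul_right, norm_smul,
        norm_smul, mul_pow, mul_pow, Real.norm_eq_abs, Real.norm_eq_abs, sq_abs, sq_abs]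
      simp
      ring
    have : 0 ≤ q * (1 - q) * ‖a - b‖ ^ 2 := by
      have : 0 ≤ 1 - q := by linarith
      positivity
    linarith
  -- The choice q² = μα gives the cross term of the distance to `r` the weight q, and its quadratic
  -- term the weight α/2, the same as in the descent inequality.
  have k3 : μ / 2 * (2 * (α / q)) = q := by field_simp; linarith
  have k4 : μ / 2 * (α / q) ^ 2 = α / 2 := by
    field_simp
    nlinarith [hqα, sq_nonneg q]
  have k5 : ‖-(α • (g + ε))‖ ^ 2 = α ^ 2 * ‖g + ε‖ ^ 2 := by
    rw [norm_neg, norm_smul, mul_pow, Real.norm_eq_abs, sq_abs]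
  have k6 : 1 / (2 * α) * (α ^ 2 * ‖g + ε‖ ^ 2) = α / 2 * ‖g + ε‖ ^ 2 := by field_simp
  rw [k5, k6, inner_neg_right, inner_smul_right] at hFp
  rw [norm_neg, inner_neg_right] at hFr
  rw [k1]
  have k7 : ⟪g, g + ε⟫ = ‖g‖ ^ 2 + ⟪ε, g⟫ := by
    rw [inner_add_right, real_inner_self_eq_norm_sq, real_inner_comm]
  have k8 : ‖g + ε‖ ^ 2 = ‖g‖ ^ 2 + 2 * ⟪ε, g⟫ + ‖ε‖ ^ 2 := by
    rw [norm_add_sq_real, real_inner_comm]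
  have k9 : ⟪U, g + ε⟫ = ⟪g, U⟫ + ⟪ε, U⟫ := by
    rw [real_inner_comm, inner_add_left]
  have k10 : ⟪ε, α • g - q • U⟫ = α * ⟪ε, g⟫ - q * ⟪ε, U⟫ := by
    rw [inner_sub_right, inner_smul_right, inner_smul_right]
  have k11 : ⟪g, U⟫ = (1 - q) * ⟪g, a⟫ + q * ⟪g, b⟫ := by
    rw [hU, inner_add_right, inner_smul_right, inner_smul_right]
  have k12 : ⟪g, q • (b - a)⟫ = q * ⟪g, b⟫ - q * ⟪g, a⟫ := by
    rw [inner_smul_right, inner_sub_right]; ring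
  rw [k12] at hFx
  rw [k7, k8] at hFp
  rw [k9, k10, k8, k11]
  -- Convexity is used with weight 1 - q at `x` and strong convexity with weight q at `r`.
  have hx' := mul_le_mul_of_nonneg_left hFx (by linarith : 0 ≤ 1 - q)
  have hr' := mul_le_mul_of_nonneg_left hFr hq.le
  have hk2 := mul_le_mul_of_nonneg_left k2 (by linarith : 0 ≤ μ / 2)
  have e : μ / 2 * (‖U‖ ^ 2 - 2 * (α / q) * ((1 - q) * ⟪g, a⟫ + q * ⟪g, b⟫ + ⟪ε, U⟫)
      + (α / q) ^ 2 * (‖g‖ ^ 2 + 2 * ⟪ε, g⟫ + ‖ε‖ ^ 2))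
      = μ / 2 * ‖U‖ ^ 2 - q * ((1 - q) * ⟪g, a⟫ + q * ⟪g, b⟫ + ⟪ε, U⟫)
      + α / 2 * (‖g‖ ^ 2 + 2 * ⟪ε, g⟫ + ‖ε‖ ^ 2) := by
    linear_combination -((1 - q) * ⟪g, a⟫ + q * ⟪g, b⟫ + ⟪ε, U⟫) * k3
      + (‖g‖ ^ 2 + 2 * ⟪ε, g⟫ + ‖ε‖ ^ 2) * k4
  rw [e]
  linarith

/-- The averaged point `y` of the extrapolation is a convex combination. -/
theorem norm_sq_convex_comb_le {q : ℝ} {x y z r : H} (hq : 0 ≤ q)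
    (hy : (1 + q) • y = x + q • z) :
    (1 + q) * ‖y - r‖ ^ 2 ≤ ‖x - r‖ ^ 2 + q * ‖z - r‖ ^ 2 := by
  have h : (1 + q) • (y - r) = (x - r) + q • (z - r) := by rw [smul_sub, hy]; module
  have h1 : (1 + q) ^ 2 * ‖y - r‖ ^ 2 = ‖(x - r) + q • (z - r)‖ ^ 2 := by
    rw [← h, norm_smul, mul_pow, Real.norm_eq_abs, sq_abs]
  have h2 : ‖(x - r) + q • (z - r)‖ ^ 2
      = (1 + q) * (‖x - r‖ ^ 2 + q * ‖z - r‖ ^ 2) - q * ‖(x - r) - (z - r)‖ ^ 2 := by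
    rw [norm_add_sq_real, norm_sub_sq_real (x - r), inner_smul_right, norm_smul, mul_pow,
      Real.norm_eq_abs, sq_abs]
    ring
  have h3 : 0 ≤ q * ‖(x - r) - (z - r)‖ ^ 2 := by positivity
  have h4 : (1 + q) * ((1 + q) * ‖y - r‖ ^ 2) ≤ (1 + q) * (‖x - r‖ ^ 2 + q * ‖z - r‖ ^ 2) := by
    linarith
  exact le_of_mul_le_mul_left h4 (by linarith)

/-- With β = (1-q)/(1+q), the momentum form of the method turns into the three-point form with
auxiliary point x⁻ + q⁻¹(x - x⁻) that `asg_step` needs. -/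
theorem extrapolate_eq_comb {q : ℝ} (hq : 0 < q) (x xm : H) :
    (1 + q) • ((1 + (1 - q) / (1 + q)) • x - ((1 - q) / (1 + q)) • xm)
      = x + q • (xm + q⁻¹ • (x - xm)) := by
  have h : (1 + q) ≠ 0 := by linarith
  rw [smul_sub, smul_smul, smul_smul, smul_add, smul_smul, mul_inv_cancel₀ hq.ne',
    mul_add, mul_div_cancel₀ _ h]
  module

/-- The energy of the disagreement dynamics `d⁺ = T (d + β (d - d⁻))`. -/
noncomputable def energy (T : H →ₗ[ℝ] H) (d dm : H) : ℝ :=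
  ⟪d, d - T d⟫ + ⟪d - dm, T (d - dm)⟫

variable {T : H →ₗ[ℝ] H}

/-- Young's inequality for the nonnegative quadratic form `energy`: it is evaluated at (ηd - e,
ηd⁻), and the pair (e, 0) has energy exactly ‖e‖². -/
theorem energy_add_le (hT : ∀ x y, ⟪x, T y⟫ = ⟪T x, y⟫) (h0 : ∀ x, 0 ≤ ⟪x, T x⟫)
    (h1 : ∀ x, ⟪x, T x⟫ ≤ ‖x‖ ^ 2) {η : ℝ} (hη : 0 < η) (d dm e : H) :
    energy T (d + e) dm ≤ (1 + η) * energy T d dm + (1 + η⁻¹) * ‖e‖ ^ 2 := by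
  have key : 0 ≤ energy T (η • d - e) (η • dm) := by
    unfold energy
    have := h0 (η • d - e - η • dm)
    have := h1 (η • d - e)
    rw [inner_sub_right, real_inner_self_eq_norm_sq]
    linarith
  have c1 : ⟪e, T d⟫ = ⟪d, T e⟫ := by rw [hT, real_inner_comm]
  have c2 : ⟪e, T dm⟫ = ⟪dm, T e⟫ := by rw [hT, real_inner_comm]
  have c3 : ⟪e, d⟫ = ⟪d, e⟫ := real_inner_comm _ _
  have c4 : ⟪dm, T d⟫ = ⟪d, T dm⟫ := by rw [hT, real_inner_comm]
  have expand : energy T (η • d - e) (η • dm) = η * ((1 + η) * energy T d dm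
      + (1 + η⁻¹) * ‖e‖ ^ 2 - energy T (d + e) dm) := by
    rw [← real_inner_self_eq_norm_sq]
    unfold energy
    simp only [map_sub, map_add, map_smul, inner_sub_left, inner_sub_right, inner_add_left,
      inner_add_right, inner_smul_left, inner_smul_right, RCLike.conj_to_real, c1, c2, c3, c4]
    field_simp
    ring
  rw [expand] at key
  have := nonneg_of_mul_nonneg_right key hη
  linarith

/-- The mixed terms of the new energy cancel, leaving β²‖Tv‖² + ⟪Td, d - Td⟫ with v = d - d⁻. Each
summand is ρ-contracted separately. The spectral picture is replaced by operator inequalities, so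
only the quadratic form bounds on T are needed. -/
theorem energy_contract (hT : ∀ x y, ⟪x, T y⟫ = ⟪T x, y⟫) (h0 : ∀ x, 0 ≤ ⟪x, T x⟫)
    {K : Submodule ℝ H} (hK : ∀ x ∈ K, T x ∈ K) {ρ : ℝ} (hρ : 0 < ρ) (hρ1 : ρ < 1)
    (h1 : ∀ x ∈ K, ⟪x, T x⟫ ≤ ρ * ‖x‖ ^ 2) {β : ℝ} (hβ0 : 0 ≤ β) (hβ1 : β ≤ 1) {d dm : H}
    (hd : d ∈ K) (hdm : dm ∈ K) :
    energy T (T ((1 + β) • d - β • dm)) d ≤ ρ * energy T d dm := by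
  set v := d - dm with hv
  have hvK : v ∈ K := K.sub_mem hd hdm
  have hy : (1 + β) • d - β • dm = d + β • v := by rw [hv]; module
  rw [hy]
  have c1 : ⟪T v, T d⟫ = ⟪T d, T v⟫ := real_inner_comm _ _
  have a1 : energy T (T (d + β • v)) d = β ^ 2 * ‖T v‖ ^ 2 + ⟪T d, d - T d⟫ := by
    unfold energy
    rw [← real_inner_self_eq_norm_sq]
    have c2 : ⟪T v, T (T d)⟫ = ⟪T (T v), T d⟫ := hT _ _
    have c3 : ⟪T (T d), T v⟫ = ⟪T d, T (T v)⟫ := (hT _ _).symm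
    have c4 : ⟪d, T (T d)⟫ = ⟪T d, T d⟫ := hT _ _
    have c5 : ⟪d, T (T v)⟫ = ⟪T d, T v⟫ := hT _ _
    have c6 : ⟪T v, T (T d)⟫ = ⟪T d, T (T v)⟫ := by rw [c2, real_inner_comm]
    have c7 : ⟪T d, d⟫ = ⟪d, T d⟫ := real_inner_comm _ _
    simp only [map_sub, map_add, map_smul, inner_sub_left, inner_sub_right, inner_add_left,
      inner_add_right, inner_smul_left, inner_smul_right, RCLike.conj_to_real, c1, c4, c5, c6, c7]
    ring
  have a2 : ‖T v‖ ^ 2 ≤ ρ * ⟪v, T v⟫ := by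
    -- Positivity of T at v - ρ⁻¹Tv, together with ⟪Tv, TTv⟫ ≤ ρ‖Tv‖², gives T² ≤ ρT on the
    -- subspace.
    have h := h0 (v - ρ⁻¹ • T v)
    have h' := h1 _ (hK _ hvK)
    have c3 : ⟪v, T (T v)⟫ = ‖T v‖ ^ 2 := by rw [hT, real_inner_self_eq_norm_sq]
    simp only [map_sub, map_smul, inner_sub_left, inner_sub_right, inner_smul_left,
      inner_smul_right, RCLike.conj_to_real, c3, real_inner_self_eq_norm_sq] at h
    have h2 : ρ⁻¹ * (ρ⁻¹ * ⟪T v, T (T v)⟫) ≤ ρ⁻¹ * ‖T v‖ ^ 2 := by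
      refine mul_le_mul_of_nonneg_left ?_ (by positivity)
      rw [inv_mul_le_iff₀ hρ]
      exact h'
    have h3 : ρ⁻¹ * ‖T v‖ ^ 2 ≤ ⟪v, T v⟫ := by linarith
    rwa [inv_mul_le_iff₀ hρ] at h3
  have a3 : ⟪T d, d - T d⟫ ≤ ρ * ⟪d, d - T d⟫ := by
    have hA : ⟪T d, d - T d⟫ = ⟪d, d - T d⟫ - ‖d - T d‖ ^ 2 := by
      rw [← real_inner_self_eq_norm_sq (d - T d), inner_sub_left]; ring
    have h' := h1 _ hd
    have h2 : (1 - ρ) * ‖d‖ ^ 2 ≤ ⟪d, d - T d⟫ := by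
      rw [inner_sub_right, real_inner_self_eq_norm_sq]; linarith
    have h3 : ⟪d, d - T d⟫ ≤ ‖d‖ * ‖d - T d‖ := real_inner_le_norm _ _
    set s := ⟪d, d - T d⟫
    have hs : 0 ≤ s := le_trans (by have : 0 < 1 - ρ := by linarith
                                    positivity) h2
    -- Square Cauchy–Schwarz s ≤ ‖d‖‖d - Td‖, insert (1-ρ)‖d‖² ≤ s, and divide by s.
    have h5 : (1 - ρ) * s ≤ ‖d - T d‖ ^ 2 := by
      rcases hs.eq_or_lt with hs0 | hs0
      · rw [← hs0]; simp
      have h4 : s * s ≤ ‖d‖ ^ 2 * ‖d - T d‖ ^ 2 := by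
        rw [← mul_pow, ← sq]; exact pow_le_pow_left₀ hs h3 2
      have : s * ((1 - ρ) * s) ≤ s * ‖d - T d‖ ^ 2 := by
        have := mul_le_mul_of_nonneg_left h4 (by linarith : 0 ≤ 1 - ρ)
        have := mul_le_mul_of_nonneg_right h2 (sq_nonneg ‖d - T d‖)
        nlinarith
      exact le_of_mul_le_mul_left this hs0
    rw [hA]; linarith
  have a4 : β ^ 2 * ‖T v‖ ^ 2 ≤ 1 * ‖T v‖ ^ 2 :=
    mul_le_mul_of_nonneg_right (pow_le_one₀ hβ0 hβ1) (by positivity)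
  rw [a1]
  unfold energy
  rw [mul_add]
  linarith

end Step

/-! ### Regularity of one objective. -/

section Objective

variable {d : ℕ} {μ L : ℝ} {f : E d → ℝ}

/-- Cocoercivity argument: at the trial point x - L⁻¹δ, the upper model based at x is compared with
the lower model based at y. The decrease L⁻¹‖δ‖²/2 cannot exceed the gap L‖x - y‖²/2. -/
theorem StronglyConvexSmooth.norm_gradient_sub_le (hL : 0 < L) (hμ : 0 ≤ μ)
    (hf : StronglyConvexSmooth μ L f) (x y : E d) : ‖∇ f x - ∇ f y‖ ≤ L * ‖x - y‖ := by
  set δ := ∇ f x - ∇ f y with hδ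
  have h1 := (hf.2 (x - L⁻¹ • δ) x).2
  have h2 := (hf.2 (x - L⁻¹ • δ) y).1
  have h3 := (hf.2 x y).2
  have h4 : (0 : ℝ) ≤ μ / 2 * ‖x - L⁻¹ • δ - y‖ ^ 2 := by positivity
  have e1 : x - L⁻¹ • δ - x = - (L⁻¹ • δ) := by abel
  have e2 : x - L⁻¹ • δ - y = (x - y) - L⁻¹ • δ := by abel
  rw [e1, inner_neg_right, inner_smul_right, norm_neg, norm_smul, mul_pow, Real.norm_eq_abs,
    sq_abs] at h1
  rw [e2, inner_sub_right, inner_smul_right] at h2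
  rw [← e2] at h2
  have e3 : ⟪∇ f x, δ⟫ - ⟪∇ f y, δ⟫ = ‖δ‖ ^ 2 := by
    rw [← inner_sub_left, ← hδ, real_inner_self_eq_norm_sq]
  have e4 : L / 2 * (L⁻¹ ^ 2 * ‖δ‖ ^ 2) = L⁻¹ / 2 * ‖δ‖ ^ 2 := by field_simp
  rw [e4] at h1
  have h5 : L⁻¹ * ‖δ‖ ^ 2 ≤ L * ‖x - y‖ ^ 2 := by
    have : L⁻¹ * ⟪∇ f x, δ⟫ - L⁻¹ * ⟪∇ f y, δ⟫ = L⁻¹ * ‖δ‖ ^ 2 := by rw [← mul_sub, e3]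
    linarith
  rw [inv_mul_le_iff₀ hL] at h5
  refine abs_le_of_sq_le_sq' ?_ (by positivity) |>.2
  rw [mul_pow]; linarith

theorem StronglyConvexSmooth.continuous_gradient (hL : 0 < L) (hμ : 0 ≤ μ)
    (hf : StronglyConvexSmooth μ L f) : Continuous (∇ f) := by
  refine LipschitzWith.continuous (K := ⟨L, hL.le⟩) (LipschitzWith.of_dist_le_mul fun x y => ?_)
  rw [dist_eq_norm, dist_eq_norm]
  exact hf.norm_gradient_sub_le hL hμ x y

end Objective


/-! ### The deterministic setting and the mixing operator. -/

/-- The standing assumptions on the weights and the objectives, with the spectral information on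
the weight matrix in variational form. -/
structure Setting {N d : ℕ} (W : Matrix (Fin N) (Fin N) ℝ) (f : Fin N → E d → ℝ)
    (μ L lam ρ : ℝ) (xs : E d) : Prop where
  N_pos : 0 < N
  mu_pos : 0 < μ
  mu_le : μ ≤ L
  lam_pos : 0 < lam
  lam_le : lam ≤ 1
  rho_pos : 0 < ρ
  rho_lt : ρ < 1
  symm : ∀ i j, W i j = W j i
  row_sum : ∀ i, ∑ j, W i j = 1
  lower : ∀ x : Fin N → E d, lam * ∑ i, ‖x i‖ ^ 2 ≤ ∑ i, ⟪x i, mix W x i⟫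
  upper : ∀ x : Fin N → E d, ∑ i, ⟪x i, mix W x i⟫ ≤ ∑ i, ‖x i‖ ^ 2
  contract : ∀ x : Fin N → E d, ∑ i, x i = 0 →
    ∑ i, ⟪x i, mix W x i⟫ ≤ ρ * ∑ i, ‖x i‖ ^ 2
  reg : ∀ i, StronglyConvexSmooth μ L (f i)
  grad_sum : ∑ i, ∇ (f i) xs = 0

/-- The auxiliary point `x⁻ + q⁻¹ (x - x⁻)` of an accelerated method. -/
noncomputable def auxPt {H : Type*} [AddCommGroup H] [Module ℝ H] (q : ℝ) (x xm : H) : H :=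
  xm + q⁻¹ • (x - xm)

/-- The stacked decision space. -/
abbrev Stack (N d : ℕ) : Type := PiLp 2 (fun _ : Fin N => E d)

section Mix

variable {N d : ℕ} (W : Matrix (Fin N) (Fin N) ℝ)

theorem mix_add (x y : Fin N → E d) : mix W (x + y) = mix W x + mix W y := by
  funext i; simp [mix, Finset.sum_add_distrib]

theorem mix_smul (c : ℝ) (x : Fin N → E d) : mix W (c • x) = c • mix W x := by
  funext i; simp [mix, Finset.smul_sum, smul_comm c]

theorem mix_sub (x y : Fin N → E d) : mix W (x - y) = mix W x - mix W y := by
  funext i; simp [mix, Finset.sum_sub_distrib, smul_sub]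

/-- `mix` as a linear map of the stacked space. -/
noncomputable def mixL : Stack N d →ₗ[ℝ] Stack N d where
  toFun x := WithLp.toLp 2 (mix W x.ofLp)
  map_add' x y := by rw [WithLp.ofLp_add, mix_add]; rfl
  map_smul' c x := by rw [WithLp.ofLp_smul, mix_smul]; rfl

theorem mixL_toLp (x : Fin N → E d) :
    mixL W (WithLp.toLp 2 x) = WithLp.toLp 2 (mix W x) := rfl

theorem inner_toLp (x y : Fin N → E d) :
    ⟪(WithLp.toLp 2 x : Stack N d), WithLp.toLp 2 y⟫ = ∑ i, ⟪x i, y i⟫ := by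
  rw [PiLp.inner_apply]

theorem norm_sq_toLp (x : Fin N → E d) :
    ‖(WithLp.toLp 2 x : Stack N d)‖ ^ 2 = ∑ i, ‖x i‖ ^ 2 := by
  rw [PiLp.norm_sq_eq_of_L2]

/-- Exact second-order expansion of the penalty about y. Added to the quadratic bounds on the f_i,
it yields the corresponding bounds for the penalized objective. -/
theorem quad_expand {H : Type*} [NormedAddCommGroup H] [InnerProductSpace ℝ H] (T : H →ₗ[ℝ] H)
    (hT : ∀ x y, ⟪x, T y⟫ = ⟪T x, y⟫) (x y : H) :
    ⟪x, x - T x⟫ = ⟪y, y - T y⟫ + 2 * ⟪y - T y, x - y⟫ + ⟪x - y, x - y - T (x - y)⟫ := by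
  have h1 : ⟪T y, x⟫ = ⟪y, T x⟫ := (hT _ _).symm
  have h2 : ⟪x, T y⟫ = ⟪y, T x⟫ := by rw [hT, real_inner_comm, hT, real_inner_comm]
  have h3 : ⟪x, y⟫ = ⟪y, x⟫ := real_inner_comm _ _
  have h4 : ⟪T y, y⟫ = ⟪y, T y⟫ := real_inner_comm _ _
  simp only [map_sub, inner_sub_left, inner_sub_right, h1, h2, h3, h4]
  ring

end Mix

namespace Setting

variable {N d : ℕ} {W : Matrix (Fin N) (Fin N) ℝ} {f : Fin N → E d → ℝ} {μ L lam ρ : ℝ} {xs : E d}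

section Basic

theorem L_pos (h : Setting W f μ L lam ρ xs) : 0 < L := h.mu_pos.trans_le h.mu_le

theorem mixL_symm (h : Setting W f μ L lam ρ xs) (x y : Stack N d) :
    ⟪x, mixL W y⟫ = ⟪mixL W x, y⟫ := by
  rw [PiLp.inner_apply, PiLp.inner_apply]
  simp only [mixL, LinearMap.coe_mk, AddHom.coe_mk, mix, inner_sum, sum_inner, inner_smul_left,
    inner_smul_right, RCLike.conj_to_real]
  rw [Finset.sum_comm]
  simp only [h.symm]

theorem mixL_lower (h : Setting W f μ L lam ρ xs) (x : Stack N d) :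
    lam * ‖x‖ ^ 2 ≤ ⟪x, mixL W x⟫ := by
  rw [PiLp.inner_apply, PiLp.norm_sq_eq_of_L2]; exact h.lower x.ofLp

theorem mixL_nonneg (h : Setting W f μ L lam ρ xs) (x : Stack N d) : 0 ≤ ⟪x, mixL W x⟫ :=
  le_trans (by have := h.lam_pos; positivity) (h.mixL_lower x)

theorem mixL_upper (h : Setting W f μ L lam ρ xs) (x : Stack N d) :
    ⟪x, mixL W x⟫ ≤ ‖x‖ ^ 2 := by
  rw [PiLp.inner_apply, PiLp.norm_sq_eq_of_L2]; exact h.upper x.ofLp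

theorem mix_const (h : Setting W f μ L lam ρ xs) (c : E d) :
    mix W (fun _ => c) = fun _ => c := by
  funext i; simp [mix, ← Finset.sum_smul, h.row_sum]

theorem col_sum (h : Setting W f μ L lam ρ xs) (j : Fin N) : ∑ i, W i j = 1 := by
  rw [← h.row_sum j]; exact Finset.sum_congr rfl fun i _ => h.symm i j

theorem sum_mix (h : Setting W f μ L lam ρ xs) (x : Fin N → E d) :
    ∑ i, mix W x i = ∑ i, x i := by
  simp only [mix]
  rw [Finset.sum_comm]
  refine Finset.sum_congr rfl fun j _ => ?_
  rw [← Finset.sum_smul, h.col_sum, one_smul]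

theorem nodeAvg_mix (h : Setting W f μ L lam ρ xs) (x : Fin N → E d) :
    nodeAvg (mix W x) = nodeAvg x := by rw [nodeAvg, h.sum_mix, nodeAvg]

theorem norm_gradient_sub_le (h : Setting W f μ L lam ρ xs) (i : Fin N) (x y : E d) :
    ‖∇ (f i) x - ∇ (f i) y‖ ≤ L * ‖x - y‖ :=
  (h.reg i).norm_gradient_sub_le h.L_pos h.mu_pos.le x y

theorem continuous_gradient (h : Setting W f μ L lam ρ xs) (i : Fin N) : Continuous (∇ (f i)) :=
  (h.reg i).continuous_gradient h.L_pos h.mu_pos.le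

theorem norm_gradient_sq_le (h : Setting W f μ L lam ρ xs) (i : Fin N) (y : E d) :
    ‖∇ (f i) y‖ ^ 2 ≤ 2 * L ^ 2 * ‖y - xs‖ ^ 2 + 2 * ‖∇ (f i) xs‖ ^ 2 := by
  have h1 := h.norm_gradient_sub_le i y xs
  have h2 : ‖∇ (f i) y‖ ≤ L * ‖y - xs‖ + ‖∇ (f i) xs‖ := by
    have := norm_add_le (∇ (f i) y - ∇ (f i) xs) (∇ (f i) xs)
    rw [sub_add_cancel] at this
    linarith
  have h3 := pow_le_pow_left₀ (norm_nonneg _) h2 2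
  nlinarith [sq_nonneg (L * ‖y - xs‖ - ‖∇ (f i) xs‖)]

end Basic

end Setting

/-! ### The penalized problem. -/

/-- The Lyapunov function of the penalized problem, for the pair `(x, x⁻)`. -/
noncomputable def penV {N d : ℕ} (W : Matrix (Fin N) (Fin N) ℝ) (f : Fin N → E d → ℝ) (μ : ℝ)
    (xs : E d) (α : ℝ) (x xm : Fin N → E d) : ℝ :=
  ∑ i, (f i (x i) - f i xs) + 1 / (2 * α) * ∑ i, ⟪x i, x i - mix W x i⟫
    + μ / 2 * ∑ i, ‖auxPt (√(μ * α)) (x i) (xm i) - xs‖ ^ 2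

/-- The direction paired with the noise in one step for the penalized problem. -/
noncomputable def penDir {N d : ℕ} (W : Matrix (Fin N) (Fin N) ℝ) (f : Fin N → E d → ℝ) (μ : ℝ)
    (xs : E d) (α : ℝ) (x y : Fin N → E d) (i : Fin N) : E d :=
  α • ∇ (f i) (y i) + (y i - mix W y i)
    - (y i - (1 - √(μ * α)) • x i - √(μ * α) • xs)

/-- The constant offset that makes `penV` nonnegative. -/
noncomputable def penC {N d : ℕ} (f : Fin N → E d → ℝ) (μ : ℝ) (xs : E d) : ℝ :=
  ∑ i, ‖∇ (f i) xs‖ ^ 2 / μ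

namespace Setting

variable {N d : ℕ} {W : Matrix (Fin N) (Fin N) ℝ} {f : Fin N → E d → ℝ} {μ L lam ρ : ℝ} {xs : E d}

theorem rate_sq (h : Setting W f μ L lam ρ xs) {α : ℝ} (hα : 0 < α) : √(μ * α) ^ 2 = μ * α :=
  Real.sq_sqrt (mul_pos h.mu_pos hα).le

theorem rate_pos (h : Setting W f μ L lam ρ xs) {α : ℝ} (hα : 0 < α) : 0 < √(μ * α) :=
  Real.sqrt_pos.2 (mul_pos h.mu_pos hα)

theorem mul_alpha_le (h : Setting W f μ L lam ρ xs) {α : ℝ} (hα : 0 < α)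
    (hαL : α * (L + μ) ≤ lam) : α * L ≤ lam ∧ μ * α ≤ 1 := by
  have := mul_pos hα h.mu_pos
  have := mul_pos hα h.L_pos
  have := h.lam_le
  constructor <;> nlinarith

theorem rate_le_one (h : Setting W f μ L lam ρ xs) {α : ℝ} (hα : 0 < α)
    (hαL : α * (L + μ) ≤ lam) : √(μ * α) ≤ 1 :=
  Real.sqrt_le_one.2 (h.mul_alpha_le hα hαL).2

theorem extrapolate_comb (h : Setting W f μ L lam ρ xs) {α : ℝ} (hα : 0 < α)
    (x xm : Fin N → E d) (i : Fin N) :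
    (1 + √(μ * α)) • extrapolate (momentum μ α) (x, xm) i
      = x i + √(μ * α) • auxPt (√(μ * α)) (x i) (xm i) :=
  extrapolate_eq_comb (h.rate_pos hα) (x i) (xm i)

/-- Since Wy - α∇f(y) = y - α(∇f(y) + α⁻¹(I-W)y), the update is one gradient step for the penalized
objective, and `asg_step` applies in the stacked space. -/
theorem penV_step (h : Setting W f μ L lam ρ xs) {α : ℝ} (hα : 0 < α)
    (hαL : α * (L + μ) ≤ lam) (x xm ε : Fin N → E d) {y : Fin N → E d}
    (hy : y = extrapolate (momentum μ α) (x, xm)) :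
    penV W f μ xs α (fun i => mix W y i - α • (∇ (f i) (y i) + ε i)) x ≤
      (1 - √(μ * α)) * penV W f μ xs α x xm + ∑ i, ⟪ε i, penDir W f μ xs α x y i⟫
        + α * ∑ i, ‖ε i‖ ^ 2 := by
  have hcomb := h.extrapolate_comb hα x xm
  rw [← hy] at hcomb
  clear hy
  set q := √(μ * α) with hq
  set T := mixL (d := d) W with hT
  set X : Stack N d := WithLp.toLp 2 x with hX
  set Y : Stack N d := WithLp.toLp 2 y with hY
  set Z : Stack N d := WithLp.toLp 2 (fun i => auxPt q (x i) (xm i)) with hZ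
  set Rr : Stack N d := WithLp.toLp 2 (fun _ => xs) with hR
  set G₀ : Stack N d := WithLp.toLp 2 (fun i => ∇ (f i) (y i)) with hG₀
  set Ee : Stack N d := WithLp.toLp 2 ε with hE
  set p : Fin N → E d := fun i => mix W y i - α • (∇ (f i) (y i) + ε i) with hp
  set Pp : Stack N d := WithLp.toLp 2 p with hP
  set G : Stack N d := G₀ + α⁻¹ • (Y - T Y) with hG
  have hYc : (1 + q) • Y = X + q • Z := by
    ext1 i; exact hcomb i
  have hPe : Pp = Y - α • (G + Ee) := by
    have : α • G = α • G₀ + (Y - T Y) := by rw [hG, smul_add, smul_inv_smul₀ hα.ne']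
    rw [smul_add, this]
    have hP' : Pp = T Y - α • (G₀ + Ee) := by ext1 i; rfl
    rw [hP', smul_add]; abel
  have hTR : T Rr = Rr := by rw [hT, hR, mixL_toLp, h.mix_const]
  have s1 : ∀ u : Fin N → E d, ∑ i, (f i (u i)) ≤
      ∑ i, f i (y i) + ⟪G₀, WithLp.toLp 2 u - Y⟫ + L / 2 * ‖WithLp.toLp 2 u - Y‖ ^ 2 := by
    intro u
    rw [hG₀, hY, ← WithLp.toLp_sub, inner_toLp, norm_sq_toLp, Finset.mul_sum,
      ← Finset.sum_add_distrib, ← Finset.sum_add_distrib]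
    refine Finset.sum_le_sum fun i _ => ?_
    have := ((h.reg i).2 (u i) (y i)).2
    simp only [Pi.sub_apply]; linarith
  have s2 : ∀ u : Fin N → E d, ∑ i, f i (y i) + ⟪G₀, WithLp.toLp 2 u - Y⟫
      + μ / 2 * ‖WithLp.toLp 2 u - Y‖ ^ 2 ≤ ∑ i, (f i (u i)) := by
    intro u
    rw [hG₀, hY, ← WithLp.toLp_sub, inner_toLp, norm_sq_toLp, Finset.mul_sum,
      ← Finset.sum_add_distrib, ← Finset.sum_add_distrib]
    refine Finset.sum_le_sum fun i _ => ?_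
    have := ((h.reg i).2 (u i) (y i)).1
    simp only [Pi.sub_apply]; linarith
  have hGin : ∀ v : Stack N d, ⟪G, v⟫ = ⟪G₀, v⟫ + 1 / (2 * α) * (2 * ⟪Y - T Y, v⟫) := by
    intro v
    rw [hG, inner_add_left, inner_smul_left, RCLike.conj_to_real]
    field_simp
  have hc : 0 ≤ 1 / (2 * α) := by positivity
  have hquad : ∀ u : Stack N d, 0 ≤ ⟪u, u - T u⟫ := fun u => by
    rw [inner_sub_right, real_inner_self_eq_norm_sq]; linarith [h.mixL_upper u]
  have hexp := fun u => quad_expand T h.mixL_symm u Y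
  have key := asg_step (μ := μ) (α := α) (q := q) (x := X) (y := Y) (z := Z) (r := Rr) (g := G)
    (ε := Ee) (p := Pp)
    (Fx := ∑ i, f i (x i) + 1 / (2 * α) * ⟪X, X - T X⟫)
    (Fy := ∑ i, f i (y i) + 1 / (2 * α) * ⟪Y, Y - T Y⟫)
    (Fr := ∑ i, f i xs) (Fp := ∑ i, f i (p i) + 1 / (2 * α) * ⟪Pp, Pp - T Pp⟫)
    (h.rate_pos hα) (h.rate_le_one hα hαL) hα h.mu_pos.le (h.rate_sq hα) hYc hPe ?_ ?_ ?_
  · have e1 : X + q⁻¹ • (Pp - X) - Rr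
        = WithLp.toLp 2 (fun i => auxPt q (p i) (x i) - xs) := by ext1 i; rfl
    have e2 : Z - Rr = WithLp.toLp 2 (fun i => auxPt q (x i) (xm i) - xs) := by ext1 i; rfl
    have e3 : α • G - (Y - (1 - q) • X - q • Rr)
        = WithLp.toLp 2 (fun i => penDir W f μ xs α x y i) := by
      rw [hG, smul_add, smul_inv_smul₀ hα.ne']; ext1 i; rfl
    have e4 : ∀ u : Fin N → E d, (WithLp.toLp 2 u : Stack N d) - T (WithLp.toLp 2 u)
        = WithLp.toLp 2 (fun i => u i - mix W u i) := by intro u; ext1 i; rfl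
    rw [e1, e2, e3, hP, hX, e4, e4, hE] at key
    simp only [inner_toLp, norm_sq_toLp] at key
    unfold penV
    rw [← hq]
    simp only [Finset.sum_sub_distrib (f := fun i => f i (_ : E d))] at key ⊢
    linarith
  -- Descent inequality: the curvature is at most L + (1 - lam)/α, and this is at most 1/α because
  -- αL ≤ lam.
  · rw [hexp Pp, hGin]
    have := s1 p
    have h3 := h.mixL_lower (Pp - Y)
    have h4 : ⟪Pp - Y, Pp - Y - T (Pp - Y)⟫ ≤ (1 - lam) * ‖Pp - Y‖ ^ 2 := by
      rw [inner_sub_right, real_inner_self_eq_norm_sq]; linarith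
    have h5 : L / 2 * ‖Pp - Y‖ ^ 2 ≤ 1 / (2 * α) * (lam * ‖Pp - Y‖ ^ 2) := by
      rw [← mul_assoc]
      refine mul_le_mul_of_nonneg_right ?_ (by positivity)
      have := (h.mul_alpha_le hα hαL).1
      rw [div_mul_eq_mul_div, one_mul, div_le_div_iff₀ (by norm_num) (by positivity)]
      linarith
    have h6 := mul_le_mul_of_nonneg_left h4 hc
    rw [← hP] at this
    linarith
  · rw [hexp X, hGin]
    have := s2 x
    have h3 := mul_nonneg hc (hquad (X - Y))
    have : 0 ≤ μ / 2 * ‖X - Y‖ ^ 2 := by have := h.mu_pos; positivity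
    linarith
  -- The reference point is a consensus vector, so its penalty vanishes and only the strong
  -- convexity of the f_i remains.
  · rw [hGin]
    have := s2 (fun _ => xs)
    have h3 := mul_nonneg hc (hquad (Rr - Y))
    have h4 := hexp Rr
    rw [hTR, sub_self, inner_zero_right] at h4
    have h5 : 1 / (2 * α) * (⟪Y, Y - T Y⟫ + 2 * ⟪Y - T Y, Rr - Y⟫) ≤ 0 := by
      have : ⟪Y, Y - T Y⟫ + 2 * ⟪Y - T Y, Rr - Y⟫ ≤ 0 := by linarith [hquad (Rr - Y)]
      exact mul_nonpos_of_nonneg_of_nonpos hc this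
    rw [← hR] at this
    linarith

end Setting


theorem norm_add_sq_le_two {H : Type*} [NormedAddCommGroup H] [InnerProductSpace ℝ H] (a b : H) :
    ‖a + b‖ ^ 2 ≤ 2 * ‖a‖ ^ 2 + 2 * ‖b‖ ^ 2 := by
  have := parallelogram_law_with_norm ℝ a b
  nlinarith [sq_nonneg ‖a - b‖]

theorem norm_sum_sq_le_card {H : Type*} [NormedAddCommGroup H] {N : ℕ} (v : Fin N → H) :
    ‖∑ i, v i‖ ^ 2 ≤ N * ∑ i, ‖v i‖ ^ 2 := by
  have h1 := pow_le_pow_left₀ (norm_nonneg _) (norm_sum_le Finset.univ v) 2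
  have h2 := sq_sum_le_card_mul_sum_sq (s := Finset.univ) (f := fun i => ‖v i‖)
  rw [Finset.card_univ, Fintype.card_fin] at h2
  exact h1.trans h2

theorem auxPt_self {H : Type*} [AddCommGroup H] [Module ℝ H] (q : ℝ) (x : H) :
    auxPt q x x = x := by simp [auxPt]

/-! ### Deviation from the average and Lyapunov function of the average. -/

section Dev

variable {N d : ℕ}

/-- The deviation from the node average. -/
noncomputable def dev (x : Fin N → E d) : Fin N → E d := fun i => x i - nodeAvg x

theorem nodeAvg_add (x y : Fin N → E d) : nodeAvg (x + y) = nodeAvg x + nodeAvg y := by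
  simp [nodeAvg, Finset.sum_add_distrib]

theorem nodeAvg_sub (x y : Fin N → E d) : nodeAvg (x - y) = nodeAvg x - nodeAvg y := by
  simp [nodeAvg, Finset.sum_sub_distrib, smul_sub]

theorem nodeAvg_smul (c : ℝ) (x : Fin N → E d) : nodeAvg (c • x) = c • nodeAvg x := by
  simp only [nodeAvg, Pi.smul_apply, ← Finset.smul_sum, smul_comm c]

theorem dev_sub (x y : Fin N → E d) : dev (x - y) = dev x - dev y := by
  funext i; simp only [dev, nodeAvg_sub, Pi.sub_apply]; abel

theorem dev_smul (c : ℝ) (x : Fin N → E d) : dev (c • x) = c • dev x := by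
  funext i; simp only [dev, nodeAvg_smul, Pi.smul_apply, smul_sub]

theorem sum_dev (hN : 0 < N) (x : Fin N → E d) : ∑ i, dev x i = 0 := by
  have : (N : ℝ) ≠ 0 := by positivity
  simp only [dev, Finset.sum_sub_distrib, Finset.sum_const, Finset.card_univ, Fintype.card_fin,
    nodeAvg]
  rw [← Nat.cast_smul_eq_nsmul ℝ, smul_inv_smul₀ this, sub_self]

theorem sum_norm_dev_sq_le (hN : 0 < N) (x : Fin N → E d) :
    ∑ i, ‖dev x i‖ ^ 2 ≤ ∑ i, ‖x i‖ ^ 2 := by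
  have h : ∑ i, ‖x i‖ ^ 2 = ∑ i, ‖dev x i‖ ^ 2 + N * ‖nodeAvg x‖ ^ 2 := by
    have h1 : ∀ i, ‖x i‖ ^ 2 = ‖dev x i‖ ^ 2 + 2 * ⟪dev x i, nodeAvg x⟫ + ‖nodeAvg x‖ ^ 2 := by
      intro i; rw [← norm_add_sq_real]; simp [dev]
    simp only [h1, Finset.sum_add_distrib, ← Finset.mul_sum, ← sum_inner, sum_dev hN]
    simp
  rw [h]
  have : 0 ≤ (N : ℝ) * ‖nodeAvg x‖ ^ 2 := by positivity
  linarith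

/-- The consensus energy of the pair `(x, x⁻)`. -/
noncomputable def consE (W : Matrix (Fin N) (Fin N) ℝ) (x xm : Fin N → E d) : ℝ :=
  ∑ i, ⟪dev x i, dev x i - mix W (dev x) i⟫
    + ∑ i, ⟪dev x i - dev xm i, mix W (dev x - dev xm) i⟫

theorem consE_eq_energy (W : Matrix (Fin N) (Fin N) ℝ) (x xm : Fin N → E d) :
    consE W x xm = energy (mixL W) (WithLp.toLp 2 (dev x) : Stack N d) (WithLp.toLp 2 (dev xm)) := by
  unfold consE energy
  rw [mixL_toLp, ← WithLp.toLp_sub, ← WithLp.toLp_sub, mixL_toLp, inner_toLp, inner_toLp]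
  rfl

end Dev

/-- The Lyapunov function of the average iterate, for the pair `(x, x⁻)`. -/
noncomputable def avgV {N d : ℕ} (f : Fin N → E d → ℝ) (μ : ℝ) (xs : E d) (α : ℝ)
    (x xm : E d) : ℝ :=
  (N : ℝ)⁻¹ * ∑ i, f i x - (N : ℝ)⁻¹ * ∑ i, f i xs
    + μ / 2 * ‖auxPt (√(μ * α)) x xm - xs‖ ^ 2

/-- The gradient of the mean objective. -/
noncomputable def meanGrad {N d : ℕ} (f : Fin N → E d → ℝ) (x : E d) : E d :=
  (N : ℝ)⁻¹ • ∑ i, ∇ (f i) x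

/-- The error of the mean of the gradients at the points `y i` as an estimate of the gradient of
the mean objective at the mean point. -/
noncomputable def gradBias {N d : ℕ} (f : Fin N → E d → ℝ) (y : Fin N → E d) : E d :=
  (N : ℝ)⁻¹ • ∑ i, (∇ (f i) (y i) - ∇ (f i) (nodeAvg y))

/-- The direction paired with the mean noise in one step of the average iterate. -/
noncomputable def avgDir {N d : ℕ} (f : Fin N → E d → ℝ) (μ : ℝ) (xs : E d) (α : ℝ)
    (x y : Fin N → E d) : E d :=
  α • meanGrad f (nodeAvg y)
    - (nodeAvg y - (1 - √(μ * α)) • nodeAvg x - √(μ * α) • xs) + (2 * α) • gradBias f y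

namespace Setting

variable {N d : ℕ} {W : Matrix (Fin N) (Fin N) ℝ} {f : Fin N → E d → ℝ} {μ L lam ρ : ℝ} {xs : E d}

theorem penC_nonneg (h : Setting W f μ L lam ρ xs) : 0 ≤ penC f μ xs :=
  Finset.sum_nonneg fun _ _ => by have := h.mu_pos; positivity

/-- The single f_i are not minimal at x_*. Their linear terms are absorbed by Young's inequality
into half of the strong convexity, at the price `penC`. -/
theorem sum_objective_lower (h : Setting W f μ L lam ρ xs) (x : Fin N → E d) :
    μ / 4 * ∑ i, ‖x i - xs‖ ^ 2 ≤ ∑ i, (f i (x i) - f i xs) + penC f μ xs := by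
  rw [penC, Finset.mul_sum, ← Finset.sum_add_distrib]
  refine Finset.sum_le_sum fun i _ => ?_
  have hμ := h.mu_pos
  have h1 := ((h.reg i).2 (x i) xs).1
  have h2 : -(‖∇ (f i) xs‖ * ‖x i - xs‖) ≤ ⟪∇ (f i) xs, x i - xs⟫ :=
    neg_le_of_abs_le (abs_real_inner_le_norm _ _)
  set a := ‖∇ (f i) xs‖
  set b := ‖x i - xs‖
  have h3 : a * b ≤ a ^ 2 / μ + μ / 4 * b ^ 2 := by
    have : a ^ 2 / μ + μ / 4 * b ^ 2 - a * b = (a - μ / 2 * b) ^ 2 / μ := by field_simp; ring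
    have : 0 ≤ (a - μ / 2 * b) ^ 2 / μ := by positivity
    linarith
  linarith

theorem penalty_nonneg (h : Setting W f μ L lam ρ xs) (x : Fin N → E d) :
    0 ≤ ∑ i, ⟪x i, x i - mix W x i⟫ := by
  simp only [inner_sub_right, real_inner_self_eq_norm_sq, Finset.sum_sub_distrib]
  linarith [h.upper x]

theorem penV_lower (h : Setting W f μ L lam ρ xs) {α : ℝ} (hα : 0 < α) (x xm : Fin N → E d) :
    μ / 4 * ∑ i, ‖x i - xs‖ ^ 2 + μ / 2 * ∑ i, ‖auxPt (√(μ * α)) (x i) (xm i) - xs‖ ^ 2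
      ≤ penV W f μ xs α x xm + penC f μ xs := by
  have h1 := h.sum_objective_lower x
  have h2 : 0 ≤ 1 / (2 * α) * ∑ i, ⟪x i, x i - mix W x i⟫ :=
    mul_nonneg (by positivity) (h.penalty_nonneg x)
  unfold penV
  linarith

/-- The penalty weight grows at most 16 times. The auxiliary point collapses to x, and its squared
distance costs at most twice the shifted objective gap. Together 18 suffices. -/
theorem penV_restart (h : Setting W f μ L lam ρ xs) {α α' : ℝ} (hα' : 0 < α')
    (h16 : α ≤ 16 * α') (hα : 0 < α) (x xm : Fin N → E d) :
    penV W f μ xs α' x x ≤ 18 * (penV W f μ xs α x xm + penC f μ xs) := by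
  have hμ := h.mu_pos
  have h1 := h.sum_objective_lower x
  have h2 := h.penalty_nonneg x
  have h3 : 1 / (2 * α') ≤ 16 * (1 / (2 * α)) := by
    rw [mul_one_div, div_le_div_iff₀ (by positivity) (by positivity)]; linarith
  have h4 := mul_le_mul_of_nonneg_right h3 h2
  have h5 : 0 ≤ μ / 2 * ∑ i, ‖auxPt (√(μ * α)) (x i) (xm i) - xs‖ ^ 2 := by positivity
  have h6 : 0 ≤ 1 / (2 * α) * ∑ i, ⟪x i, x i - mix W x i⟫ := mul_nonneg (by positivity) h2
  have h7 : 0 ≤ μ / 4 * ∑ i, ‖x i - xs‖ ^ 2 := by positivity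
  have := h.penC_nonneg
  unfold penV
  simp only [auxPt_self]
  linarith

theorem norm_comb_sq_le {q : ℝ} {x y z : E d} (hq : 0 < q) (hq1 : q ≤ 1)
    (hy : (1 + q) • y = x + q • z) : ‖y - xs‖ ^ 2 ≤ ‖x - xs‖ ^ 2 + ‖z - xs‖ ^ 2 := by
  have h1 := norm_sq_convex_comb_le (r := xs) hq.le hy
  have : q * ‖z - xs‖ ^ 2 ≤ 1 * ‖z - xs‖ ^ 2 :=
    mul_le_mul_of_nonneg_right hq1 (by positivity)
  have : 0 ≤ q * ‖y - xs‖ ^ 2 := by positivity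
  linarith

/-- The query point is a convex combination of x and the auxiliary point, and `penV_lower` controls
the distance of both to x_*. This bounds the force that drives the disagreement. -/
theorem sum_gradient_sq_le (h : Setting W f μ L lam ρ xs) {α : ℝ} (hα : 0 < α)
    (hαL : α * (L + μ) ≤ lam) (x xm ε : Fin N → E d) {y : Fin N → E d}
    (hy : y = extrapolate (momentum μ α) (x, xm)) :
    ∑ i, ‖∇ (f i) (y i) + ε i‖ ^ 2 ≤ 16 * L ^ 2 / μ * (penV W f μ xs α x xm + penC f μ xs)
      + 4 * μ * penC f μ xs + 2 * ∑ i, ‖ε i‖ ^ 2 := by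
  have hμ := h.mu_pos
  have h1 : ∀ i, ‖∇ (f i) (y i) + ε i‖ ^ 2 ≤ 4 * L ^ 2 * (‖x i - xs‖ ^ 2
      + ‖auxPt (√(μ * α)) (x i) (xm i) - xs‖ ^ 2) + 4 * ‖∇ (f i) xs‖ ^ 2 + 2 * ‖ε i‖ ^ 2 := by
    intro i
    have hc := h.extrapolate_comb hα x xm i
    rw [← hy] at hc
    have a1 := norm_comb_sq_le (xs := xs) (h.rate_pos hα) (h.rate_le_one hα hαL) hc
    have a2 := norm_add_sq_le_two (∇ (f i) (y i)) (ε i)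
    have a3 := h.norm_gradient_sq_le i (y i)
    have a4 := mul_le_mul_of_nonneg_left a1 (by positivity : 0 ≤ 4 * L ^ 2)
    linarith
  have h2 := Finset.sum_le_sum fun i (_ : i ∈ Finset.univ) => h1 i
  simp only [Finset.sum_add_distrib, ← Finset.mul_sum] at h2
  have h3 := h.penV_lower hα x xm
  have h4 : 4 * μ * penC f μ xs = 4 * ∑ i, ‖∇ (f i) xs‖ ^ 2 := by
    rw [penC, ← Finset.sum_div]; field_simp
  set S := ∑ i, ‖x i - xs‖ ^ 2
  set Z := ∑ i, ‖auxPt (√(μ * α)) (x i) (xm i) - xs‖ ^ 2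
  have hZ : 0 ≤ Z := Finset.sum_nonneg fun _ _ => by positivity
  have h5 : 4 * L ^ 2 * (S + Z) ≤ 16 * L ^ 2 / μ * (penV W f μ xs α x xm + penC f μ xs) := by
    have e : 4 * L ^ 2 * (S + Z) = 16 * L ^ 2 / μ * (μ / 4 * (S + Z)) := by field_simp; ring
    rw [e]
    refine mul_le_mul_of_nonneg_left ?_ (by positivity)
    have : 0 ≤ μ / 4 * Z := by positivity
    linarith
  rw [h4]
  linarith

theorem momentum_mem (h : Setting W f μ L lam ρ xs) {α : ℝ} (hα : 0 < α)
    (hαL : α * (L + μ) ≤ lam) : 0 ≤ momentum μ α ∧ momentum μ α ≤ 1 := by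
  have h1 := h.rate_pos hα
  have h2 := h.rate_le_one hα hαL
  unfold momentum
  constructor
  · exact div_nonneg (by linarith) (by linarith)
  · rw [div_le_one (by linarith)]; linarith

/-- The stacked vectors with mean zero. -/
def meanZero (N d : ℕ) : Submodule ℝ (Stack N d) where
  carrier := {x | ∑ i, x i = 0}
  add_mem' {a b} ha hb := by
    simp only [Set.mem_ofPred_eq, PiLp.add_apply, Finset.sum_add_distrib] at *
    rw [ha, hb, add_zero]
  zero_mem' := by simp
  smul_mem' c x hx := by
    simp only [Set.mem_ofPred_eq, PiLp.smul_apply, ← Finset.smul_sum] at *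
    rw [hx, smul_zero]

theorem consE_step (h : Setting W f μ L lam ρ xs) {α : ℝ} (hα : 0 < α)
    (hαL : α * (L + μ) ≤ lam) (x xm G : Fin N → E d) {y : Fin N → E d}
    (hy : y = extrapolate (momentum μ α) (x, xm)) :
    consE W (fun i => mix W y i - α • G i) x ≤
      (1 + ρ) / 2 * consE W x xm + 2 / (1 - ρ) * α ^ 2 * ∑ i, ‖G i‖ ^ 2 := by
  have hρ := h.rho_pos
  have hρ1 : 0 < 1 - ρ := by linarith [h.rho_lt]
  obtain ⟨hβ0, hβ1⟩ := h.momentum_mem hα hαL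
  set β := momentum μ α
  have e1 : dev (fun i => mix W y i - α • G i) = mix W (dev y) - α • dev G := by
    have : (fun i => mix W y i - α • G i) = mix W y - α • G := rfl
    rw [this, dev_sub, dev_smul]
    congr 1
    funext i
    have : dev y = y - fun _ => nodeAvg y := rfl
    rw [dev, h.nodeAvg_mix, this, mix_sub, h.mix_const]; rfl
  have e2 : dev y = (1 + β) • dev x - β • dev xm := by
    rw [hy, extrapolate, dev_sub, dev_smul, dev_smul]
  set D : Stack N d := WithLp.toLp 2 (dev x)
  set Dm : Stack N d := WithLp.toLp 2 (dev xm)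
  have e3 : (WithLp.toLp 2 (dev (fun i => mix W y i - α • G i)) : Stack N d)
      = mixL W ((1 + β) • D - β • Dm) + WithLp.toLp 2 (-(α • dev G)) := by
    rw [e1, e2]; ext1 i; exact sub_eq_add_neg _ _
  -- This η makes (1 + η)ρ = (1 + ρ)/2, giving up half of the spectral gap to the perturbation.
  have hη : 0 < (1 - ρ) / (2 * ρ) := by positivity
  have k1 := energy_add_le (T := mixL (d := d) W) h.mixL_symm h.mixL_nonneg h.mixL_upper hη
    (mixL W ((1 + β) • D - β • Dm)) D (WithLp.toLp 2 (-(α • dev G)))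
  have k2 := energy_contract (T := mixL (d := d) W) (K := meanZero N d) h.mixL_symm h.mixL_nonneg
    (fun x hx => ?_) hρ h.rho_lt (fun x hx => ?_) hβ0 hβ1 (d := D) (dm := Dm)
    (sum_dev h.N_pos x) (sum_dev h.N_pos xm)
  · rw [consE_eq_energy, e3, consE_eq_energy]
    refine k1.trans ?_
    have k3 : ‖(WithLp.toLp 2 (-(α • dev G)) : Stack N d)‖ ^ 2 ≤ α ^ 2 * ∑ i, ‖G i‖ ^ 2 := by
      rw [norm_sq_toLp]
      simp only [Pi.neg_apply, Pi.smul_apply, norm_neg, norm_smul, mul_pow, Real.norm_eq_abs,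
        sq_abs, ← Finset.mul_sum]
      exact mul_le_mul_of_nonneg_left (sum_norm_dev_sq_le h.N_pos G) (by positivity)
    have k4 : 1 + ((1 - ρ) / (2 * ρ))⁻¹ ≤ 2 / (1 - ρ) := by
      rw [inv_div, le_div_iff₀ hρ1, add_mul, div_mul_cancel₀ _ hρ1.ne']
      linarith
    have k5 : (1 + (1 - ρ) / (2 * ρ)) * (ρ * energy (mixL W) D Dm)
        = (1 + ρ) / 2 * energy (mixL W) D Dm := by field_simp; ring
    rw [← k5]
    refine add_le_add (mul_le_mul_of_nonneg_left k2 (by positivity)) ?_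
    rw [mul_assoc]
    exact mul_le_mul k4 k3 (by positivity) (by positivity)
  · have : ∑ i, (mixL W x) i = ∑ i, x i := h.sum_mix x.ofLp
    exact this.trans hx
  · rw [PiLp.inner_apply, PiLp.norm_sq_eq_of_L2]; exact h.contract x.ofLp hx

theorem consE_lower (h : Setting W f μ L lam ρ xs) (x xm : Fin N → E d) :
    (1 - ρ) * ∑ i, ‖dev x i‖ ^ 2 + lam * ∑ i, ‖dev x i - dev xm i‖ ^ 2 ≤ consE W x xm := by
  have h1 := h.contract (dev x) (sum_dev h.N_pos x)
  have h2 := h.lower (dev x - dev xm)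
  simp only [Pi.sub_apply] at h2
  unfold consE
  simp only [inner_sub_right, real_inner_self_eq_norm_sq, Finset.sum_sub_distrib] at h2 ⊢
  linarith

theorem consE_nonneg (h : Setting W f μ L lam ρ xs) (x xm : Fin N → E d) : 0 ≤ consE W x xm := by
  refine le_trans ?_ (h.consE_lower x xm)
  have := h.lam_pos
  have : 0 < 1 - ρ := by linarith [h.rho_lt]
  positivity

theorem sum_dev_sq_le (h : Setting W f μ L lam ρ xs) (x xm : Fin N → E d) :
    ∑ i, ‖dev x i‖ ^ 2 ≤ (1 - ρ)⁻¹ * consE W x xm := by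
  have := h.lam_pos
  have h1 : 0 < 1 - ρ := by linarith [h.rho_lt]
  rw [le_inv_mul_iff₀ h1]
  refine le_trans ?_ (h.consE_lower x xm)
  have : 0 ≤ lam * ∑ i, ‖dev x i - dev xm i‖ ^ 2 := by positivity
  linarith

/-- A restart only removes the velocity term, which is nonnegative since W is positive. -/
theorem consE_restart (h : Setting W f μ L lam ρ xs) (x xm : Fin N → E d) :
    consE W x x ≤ consE W x xm := by
  have h2 := h.lower (dev x - dev xm)
  have h3 : 0 ≤ lam * ∑ i, ‖(dev x - dev xm) i‖ ^ 2 := by have := h.lam_pos; positivity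
  simp only [Pi.sub_apply] at h2 h3
  unfold consE
  simp only [sub_self, inner_zero_left, Finset.sum_const_zero]
  linarith

theorem sum_dev_extrapolate_sq_le (h : Setting W f μ L lam ρ xs) {α : ℝ} (hα : 0 < α)
    (hαL : α * (L + μ) ≤ lam) (x xm : Fin N → E d) {y : Fin N → E d}
    (hy : y = extrapolate (momentum μ α) (x, xm)) :
    ∑ i, ‖dev y i‖ ^ 2 ≤ 2 * ((1 - ρ)⁻¹ + lam⁻¹) * consE W x xm := by
  have hl := h.lam_pos
  have h1 : 0 < 1 - ρ := by linarith [h.rho_lt]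
  obtain ⟨hβ0, hβ1⟩ := h.momentum_mem hα hαL
  set β := momentum μ α
  have e2 : ∀ i, dev y i = dev x i + β • (dev x i - dev xm i) := by
    intro i
    rw [hy, extrapolate, dev_sub, dev_smul, dev_smul]
    simp only [Pi.sub_apply, Pi.smul_apply]
    module
  have e3 : ∀ i, ‖dev y i‖ ^ 2 ≤ 2 * ‖dev x i‖ ^ 2 + 2 * ‖dev x i - dev xm i‖ ^ 2 := by
    intro i
    rw [e2]
    refine (norm_add_sq_le_two _ _).trans ?_
    rw [norm_smul, mul_pow, Real.norm_eq_abs, sq_abs]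
    have : β ^ 2 * ‖dev x i - dev xm i‖ ^ 2 ≤ 1 * ‖dev x i - dev xm i‖ ^ 2 :=
      mul_le_mul_of_nonneg_right (pow_le_one₀ hβ0 hβ1) (by positivity)
    linarith
  refine (Finset.sum_le_sum fun i _ => e3 i).trans ?_
  rw [Finset.sum_add_distrib, ← Finset.mul_sum, ← Finset.mul_sum, mul_assoc, add_mul, mul_add]
  have k1 := h.sum_dev_sq_le x xm
  have k2 : ∑ i, ‖dev x i - dev xm i‖ ^ 2 ≤ lam⁻¹ * consE W x xm := by
    rw [le_inv_mul_iff₀ hl]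
    refine le_trans ?_ (h.consE_lower x xm)
    have : 0 ≤ (1 - ρ) * ∑ i, ‖dev x i‖ ^ 2 := by positivity
    linarith
  linarith

theorem mean_lower (h : Setting W f μ L lam ρ xs) (x y : E d) :
    (N : ℝ)⁻¹ * ∑ i, f i y + ⟪meanGrad f y, x - y⟫ + μ / 2 * ‖x - y‖ ^ 2
      ≤ (N : ℝ)⁻¹ * ∑ i, f i x := by
  have hN : (0 : ℝ) < N := by exact_mod_cast h.N_pos
  have h1 := Finset.sum_le_sum fun i (_ : i ∈ Finset.univ) => ((h.reg i).2 x y).1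
  simp only [Finset.sum_sub_distrib, ← sum_inner, Finset.sum_const, Finset.card_univ,
    Fintype.card_fin, nsmul_eq_mul] at h1
  have h2 := mul_le_mul_of_nonneg_left h1 (inv_nonneg.2 hN.le)
  rw [← mul_assoc, inv_mul_cancel₀ hN.ne'] at h2
  rw [meanGrad, inner_smul_left, RCLike.conj_to_real]
  linarith

theorem mean_upper (h : Setting W f μ L lam ρ xs) (x y : E d) :
    (N : ℝ)⁻¹ * ∑ i, f i x
      ≤ (N : ℝ)⁻¹ * ∑ i, f i y + ⟪meanGrad f y, x - y⟫ + L / 2 * ‖x - y‖ ^ 2 := by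
  have hN : (0 : ℝ) < N := by exact_mod_cast h.N_pos
  have h1 := Finset.sum_le_sum fun i (_ : i ∈ Finset.univ) => ((h.reg i).2 x y).2
  simp only [Finset.sum_sub_distrib, ← sum_inner, Finset.sum_const, Finset.card_univ,
    Fintype.card_fin, nsmul_eq_mul] at h1
  have h2 := mul_le_mul_of_nonneg_left h1 (inv_nonneg.2 hN.le)
  rw [← mul_assoc (N : ℝ)⁻¹ (N : ℝ), inv_mul_cancel₀ hN.ne'] at h2
  rw [meanGrad, inner_smul_left, RCLike.conj_to_real]
  linarith

theorem meanGrad_min (h : Setting W f μ L lam ρ xs) : meanGrad f xs = 0 := by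
  rw [meanGrad, h.grad_sum, smul_zero]

theorem mean_gap (h : Setting W f μ L lam ρ xs) (x : E d) :
    μ / 2 * ‖x - xs‖ ^ 2 ≤ (N : ℝ)⁻¹ * ∑ i, f i x - (N : ℝ)⁻¹ * ∑ i, f i xs := by
  have := h.mean_lower x xs
  rw [h.meanGrad_min, inner_zero_left] at this
  linarith

theorem avgV_lower (h : Setting W f μ L lam ρ xs) (α : ℝ) (x xm : E d) :
    μ / 2 * (‖x - xs‖ ^ 2 + ‖auxPt (√(μ * α)) x xm - xs‖ ^ 2) ≤ avgV f μ xs α x xm := by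
  have := h.mean_gap x
  unfold avgV
  linarith

theorem avgV_nonneg (h : Setting W f μ L lam ρ xs) (α : ℝ) (x xm : E d) :
    0 ≤ avgV f μ xs α x xm :=
  le_trans (by have := h.mu_pos; positivity) (h.avgV_lower α x xm)

theorem avgV_restart (h : Setting W f μ L lam ρ xs) (α α' : ℝ) (x xm : E d) :
    avgV f μ xs α' x x ≤ 2 * avgV f μ xs α x xm := by
  have h1 := h.mean_gap x
  have : 0 ≤ μ / 2 * ‖auxPt (√(μ * α)) x xm - xs‖ ^ 2 := by have := h.mu_pos; positivity
  unfold avgV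
  rw [auxPt_self]
  linarith

theorem norm_meanGrad_sq_le (h : Setting W f μ L lam ρ xs) (y : E d) :
    ‖meanGrad f y‖ ^ 2 ≤ L ^ 2 * ‖y - xs‖ ^ 2 := by
  have hN : (0 : ℝ) < N := by exact_mod_cast h.N_pos
  have h1 : meanGrad f y = (N : ℝ)⁻¹ • ∑ i, (∇ (f i) y - ∇ (f i) xs) := by
    rw [Finset.sum_sub_distrib, h.grad_sum, sub_zero, meanGrad]
  have h2 : ‖meanGrad f y‖ ≤ L * ‖y - xs‖ := by
    rw [h1, norm_smul, norm_inv, Real.norm_natCast, inv_mul_le_iff₀ hN]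
    refine (norm_sum_le _ _).trans ?_
    refine (Finset.sum_le_sum fun i _ => h.norm_gradient_sub_le i y xs).trans ?_
    simp
  rw [← mul_pow]
  exact pow_le_pow_left₀ (norm_nonneg _) h2 2

/-- The bias of the mean gradient is of the order of the disagreement. This is the only coupling
from the consensus dynamics into the average dynamics. -/
theorem norm_gradBias_sq_le (h : Setting W f μ L lam ρ xs) (y : Fin N → E d) :
    ‖gradBias f y‖ ^ 2 ≤ L ^ 2 / N * ∑ i, ‖dev y i‖ ^ 2 := by
  have hN : (0 : ℝ) < N := by exact_mod_cast h.N_pos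
  rw [gradBias, norm_smul, norm_inv, Real.norm_natCast, mul_pow]
  have h1 := norm_sum_sq_le_card fun i => ∇ (f i) (y i) - ∇ (f i) (nodeAvg y)
  have h2 : ∑ i, ‖∇ (f i) (y i) - ∇ (f i) (nodeAvg y)‖ ^ 2 ≤ ∑ i, L ^ 2 * ‖dev y i‖ ^ 2 := by
    refine Finset.sum_le_sum fun i _ => ?_
    rw [← mul_pow]
    exact pow_le_pow_left₀ (norm_nonneg _) (h.norm_gradient_sub_le i _ _) 2
  rw [← Finset.mul_sum] at h2
  have h3 := mul_le_mul_of_nonneg_left h2 hN.le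
  have h4 := mul_le_mul_of_nonneg_left (h1.trans h3) (by positivity : (0 : ℝ) ≤ (N : ℝ)⁻¹ ^ 2)
  refine h4.trans (le_of_eq ?_)
  field_simp

/-- W preserves averages, so the mean iterate takes an accelerated step for the mean objective with
error `gradBias` plus mean noise. The bias is absorbed by Young's inequality at the expense of q/8
of the rate q, which leaves 1 - 7q/8. -/
theorem avgV_step (h : Setting W f μ L lam ρ xs) {α : ℝ} (hα : 0 < α)
    (hαL : α * (L + μ) ≤ lam) (x xm ε : Fin N → E d) {y : Fin N → E d}
    (hy : y = extrapolate (momentum μ α) (x, xm)) :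
    avgV f μ xs α (nodeAvg fun i => mix W y i - α • (∇ (f i) (y i) + ε i)) (nodeAvg x) ≤
      (1 - 7 / 8 * √(μ * α)) * avgV f μ xs α (nodeAvg x) (nodeAvg xm)
        + √(μ * α) * ((9 / μ + 8 * L ^ 2 / μ ^ 3) * (L ^ 2 / N * (2 * ((1 - ρ)⁻¹ + lam⁻¹))))
          * consE W x xm
        + ⟪nodeAvg ε, avgDir f μ xs α x y⟫ + α * ‖nodeAvg ε‖ ^ 2 := by
  have hμ := h.mu_pos
  have hL := h.L_pos
  have hq := h.rate_pos hα
  have hq1 := h.rate_le_one hα hαL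
  have hqα := h.rate_sq hα
  have hcomb : (1 + √(μ * α)) • nodeAvg y
      = nodeAvg x + √(μ * α) • auxPt (√(μ * α)) (nodeAvg x) (nodeAvg xm) := by
    have : nodeAvg y = (1 + momentum μ α) • nodeAvg x - momentum μ α • nodeAvg xm := by
      rw [hy, extrapolate, nodeAvg_sub, nodeAvg_smul, nodeAvg_smul]
    rw [this]
    exact extrapolate_eq_comb hq _ _
  have hdev := h.sum_dev_extrapolate_sq_le hα hαL x xm hy
  have hbias := h.norm_gradBias_sq_le y
  clear hy
  set q := √(μ * α) with hqdef
  set e := gradBias f y with he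
  set g := meanGrad f (nodeAvg y) with hg
  set z := auxPt q (nodeAvg x) (nodeAvg xm) with hz
  set V := avgV f μ xs α (nodeAvg x) (nodeAvg xm) with hV
  have hp : (nodeAvg fun i => mix W y i - α • (∇ (f i) (y i) + ε i))
      = nodeAvg y - α • (g + (e + nodeAvg ε)) := by
    have e1 : (fun i => mix W y i - α • (∇ (f i) (y i) + ε i))
        = mix W y - α • ((fun i => ∇ (f i) (y i)) + ε) := rfl
    have e2 : nodeAvg (fun i => ∇ (f i) (y i)) = g + e := by
      rw [hg, he, gradBias, meanGrad, Finset.sum_sub_distrib, smul_sub, nodeAvg]; abel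
    rw [e1, nodeAvg_sub, nodeAvg_smul, nodeAvg_add, h.nodeAvg_mix, e2, add_assoc]
  set p := nodeAvg fun i => mix W y i - α • (∇ (f i) (y i) + ε i) with hpdef
  have key := asg_step (μ := μ) (α := α) (q := q) (x := nodeAvg x) (y := nodeAvg y) (z := z)
    (r := xs) (g := g) (ε := e + nodeAvg ε)
    (Fx := (N : ℝ)⁻¹ * ∑ i, f i (nodeAvg x)) (Fy := (N : ℝ)⁻¹ * ∑ i, f i (nodeAvg y))
    (Fr := (N : ℝ)⁻¹ * ∑ i, f i xs) (Fp := (N : ℝ)⁻¹ * ∑ i, f i p) hq hq1 hα hμ.le hqα hcomb hp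
    (by
      refine (h.mean_upper p (nodeAvg y)).trans ?_
      have : L / 2 ≤ 1 / (2 * α) := by
        rw [div_le_div_iff₀ (by norm_num) (by positivity)]
        linarith [(h.mul_alpha_le hα hαL).1, h.lam_le]
      have := mul_le_mul_of_nonneg_right this (sq_nonneg ‖p - nodeAvg y‖)
      linarith)
    (by
      have := h.mean_lower (nodeAvg x) (nodeAvg y)
      have : 0 ≤ μ / 2 * ‖nodeAvg x - nodeAvg y‖ ^ 2 := by positivity
      linarith)
    (h.mean_lower xs (nodeAvg y))
  set w := nodeAvg y - (1 - q) • nodeAvg x - q • xs with hw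
  have hVl := h.avgV_lower α (nodeAvg x) (nodeAvg xm)
  rw [← hqdef, ← hV, ← hz] at hVl
  set M := ‖nodeAvg x - xs‖ ^ 2 + ‖z - xs‖ ^ 2 with hM
  have hb : ‖nodeAvg y - xs‖ ^ 2 ≤ M := norm_comb_sq_le hq hq1 hcomb
  have ha : ‖z - xs‖ ^ 2 ≤ M := by rw [hM]; linarith [sq_nonneg ‖nodeAvg x - xs‖]
  obtain ⟨u, hu⟩ : ∃ u, u = (1 - q) • (z - xs) + q • (nodeAvg y - xs) := ⟨_, rfl⟩
  have hwu : w = q • u := by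
    have : nodeAvg x = (1 + q) • nodeAvg y - q • z := by rw [hcomb]; abel
    rw [hw, hu, this]; module
  have hun : ‖u‖ ^ 2 ≤ M := by
    have h1 : ‖u‖ ≤ (1 - q) * ‖z - xs‖ + q * ‖nodeAvg y - xs‖ := by
      rw [hu]
      refine (norm_add_le _ _).trans (le_of_eq ?_)
      rw [norm_smul, norm_smul, Real.norm_of_nonneg hq.le, Real.norm_of_nonneg (by linarith)]
    have h2 := pow_le_pow_left₀ (norm_nonneg _) h1 2
    have h3 : 0 ≤ q * (1 - q) * (‖z - xs‖ - ‖nodeAvg y - xs‖) ^ 2 := by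
      have : 0 ≤ 1 - q := by linarith
      positivity
    have h4 := mul_le_mul_of_nonneg_left hb hq.le
    have h5 := mul_le_mul_of_nonneg_left ha (by linarith : 0 ≤ 1 - q)
    nlinarith
  have hgn : ‖g‖ ^ 2 ≤ L ^ 2 * M :=
    (h.norm_meanGrad_sq_le _).trans (mul_le_mul_of_nonneg_left hb (by positivity))
  -- Two Young inequalities, each with weight μ/32. Since μM/2 ≤ V, each costs qV/16. The
  -- coefficient 9/μ collects 8/μ from here and 1/μ from α‖e‖².
  have y1 : -⟪e, u⟫ ≤ μ / 32 * M + 8 / μ * ‖e‖ ^ 2 := by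
    have h1 : -⟪e, u⟫ ≤ ‖e‖ * ‖u‖ :=
      (neg_le_abs _).trans (abs_real_inner_le_norm _ _)
    have h2 : μ / 32 * ‖u‖ ^ 2 + 8 / μ * ‖e‖ ^ 2 - ‖e‖ * ‖u‖
        = (μ / 32) * (‖u‖ - 16 / μ * ‖e‖) ^ 2 := by field_simp; ring
    have h3 : 0 ≤ (μ / 32) * (‖u‖ - 16 / μ * ‖e‖) ^ 2 := by positivity
    have h4 := mul_le_mul_of_nonneg_left hun (by positivity : 0 ≤ μ / 32)
    linarith
  have y2 : ⟪e, g⟫ / μ ≤ μ / 32 * M + 8 * L ^ 2 / μ ^ 3 * ‖e‖ ^ 2 := by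
    have h1 : ⟪e, g⟫ / μ ≤ ‖e‖ * ‖g‖ / μ :=
      div_le_div_of_nonneg_right (real_inner_le_norm _ _) hμ.le
    have h2 : μ / 32 * (‖g‖ ^ 2 / L ^ 2) + 8 * L ^ 2 / μ ^ 3 * ‖e‖ ^ 2 - ‖e‖ * ‖g‖ / μ
        = (μ / 32) * (‖g‖ / L - 16 * L / μ ^ 2 * ‖e‖) ^ 2 := by field_simp; ring
    have h3 : 0 ≤ (μ / 32) * (‖g‖ / L - 16 * L / μ ^ 2 * ‖e‖) ^ 2 := by positivity
    have h4 : ‖g‖ ^ 2 / L ^ 2 ≤ M := by rw [div_le_iff₀ (by positivity)]; linarith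
    have h5 := mul_le_mul_of_nonneg_left h4 (by positivity : 0 ≤ μ / 32)
    linarith
  have hαq : α = q * (q / μ) := by field_simp; linarith
  have y3 : α * ⟪e, g⟫ ≤ q * (μ / 32 * M + 8 * L ^ 2 / μ ^ 3 * ‖e‖ ^ 2) := by
    have hnn : 0 ≤ μ / 32 * M + 8 * L ^ 2 / μ ^ 3 * ‖e‖ ^ 2 := by positivity
    have h1 : α * ⟪e, g⟫ = q * (q * (⟪e, g⟫ / μ)) := by rw [hαq]; ring
    rw [h1]
    refine mul_le_mul_of_nonneg_left ?_ hq.le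
    have h2 := mul_le_mul_of_nonneg_left y2 hq.le
    have h3 := mul_le_mul_of_nonneg_right hq1 hnn
    linarith
  have y4 : α * ‖e‖ ^ 2 ≤ q * (1 / μ * ‖e‖ ^ 2) := by
    rw [hαq, mul_assoc]
    refine mul_le_mul_of_nonneg_left (mul_le_mul_of_nonneg_right ?_ (by positivity)) hq.le
    exact div_le_div_of_nonneg_right hq1 hμ.le
  have y5 : q * (μ / 32 * M) ≤ q * (V / 16) := mul_le_mul_of_nonneg_left (by linarith) hq.le
  have y6 : q * ((9 / μ + 8 * L ^ 2 / μ ^ 3) * ‖e‖ ^ 2)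
      ≤ q * ((9 / μ + 8 * L ^ 2 / μ ^ 3) * (L ^ 2 / N * (2 * ((1 - ρ)⁻¹ + lam⁻¹))))
          * consE W x xm := by
    rw [mul_assoc, mul_assoc]
    refine mul_le_mul_of_nonneg_left (mul_le_mul_of_nonneg_left ?_ (by positivity)) hq.le
    rw [mul_assoc]
    exact hbias.trans (mul_le_mul_of_nonneg_left hdev (by positivity))
  have y7 := mul_le_mul_of_nonneg_left y1 hq.le
  have z1 : ⟪e + nodeAvg ε, α • g - w⟫ = α * ⟪e, g⟫ - q * ⟪e, u⟫ + ⟪nodeAvg ε, α • g - w⟫ := by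
    rw [inner_add_left, inner_sub_right e, hwu, inner_smul_right, inner_smul_right]
  have z2 : ‖e + nodeAvg ε‖ ^ 2 = ‖e‖ ^ 2 + 2 * ⟪nodeAvg ε, e⟫ + ‖nodeAvg ε‖ ^ 2 := by
    rw [norm_add_sq_real, real_inner_comm]
  have z3 : ⟪nodeAvg ε, avgDir f μ xs α x y⟫
      = ⟪nodeAvg ε, α • g - w⟫ + 2 * α * ⟪nodeAvg ε, e⟫ := by
    rw [avgDir, inner_add_right, inner_smul_right (nodeAvg ε) (gradBias f y)]
  rw [z1, z2] at key
  rw [z3]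
  have hVdef : V = (N : ℝ)⁻¹ * ∑ i, f i (nodeAvg x) - (N : ℝ)⁻¹ * ∑ i, f i xs
      + μ / 2 * ‖z - xs‖ ^ 2 := rfl
  rw [← hVdef] at key
  have hL' : avgV f μ xs α p (nodeAvg x) ≤ _ := key
  refine hL'.trans ?_
  have t1 : q * (1 / μ * ‖e‖ ^ 2) + q * (8 / μ * ‖e‖ ^ 2) + q * (8 * L ^ 2 / μ ^ 3 * ‖e‖ ^ 2)
    = q * ((9 / μ + 8 * L ^ 2 / μ ^ 3) * ‖e‖ ^ 2) := by ring
  linarith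

end Setting


/-! ### Orthogonality of the noise to the past. -/

section Noise

variable {Ω S : Type*} {d : ℕ}

theorem integrable_inner_of_memLp {H : Type*} [NormedAddCommGroup H] [InnerProductSpace ℝ H]
    [MeasurableSpace Ω] {P : Measure Ω} {a b : Ω → H} (ha : MemLp a 2 P) (hb : MemLp b 2 P) :
    Integrable (fun ω => ⟪a ω, b ω⟫) P := by
  refine Integrable.mono' ((ha.integrable_norm_pow (by norm_num)).add
    (hb.integrable_norm_pow (by norm_num))) (ha.1.inner hb.1)
    (Filter.Eventually.of_forall fun ω => ?_)
  refine (norm_inner_le_norm (𝕜 := ℝ) _ _).trans ?_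
  simp only [Pi.add_apply]
  nlinarith [sq_nonneg (‖a ω‖ - ‖b ω‖), sq_nonneg ‖a ω‖, sq_nonneg ‖b ω‖]

/-- A gradient error that is conditionally centred given the query point, and is computed from a
sample independent of the history `F`, is orthogonal to every `F`-measurable vector. -/
theorem integral_inner_noise_eq_zero {F : MeasurableSpace Ω} [mΩ : MeasurableSpace Ω]
    [mS : MeasurableSpace S] {P : Measure Ω} [IsProbabilityMeasure P] (hF : F ≤ mΩ) {w : Ω → S}
    (hw : Measurable w) (hind : Indep F (mS.comap w) P) {y Z : Ω → E d}
    (hy : Measurable[F] y) (hZ : Measurable[F] Z) {g : E d → S → E d}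
    (hg : Measurable (Function.uncurry g)) (hε : MemLp (fun ω => g (y ω) (w ω)) 2 P)
    (hZ2 : MemLp Z 2 P)
    (hcond : P[fun ω => g (y ω) (w ω) | MeasurableSpace.comap y inferInstance] =ᵐ[P] fun _ => 0) :
    ∫ ω, ⟪g (y ω) (w ω), Z ω⟫ ∂P = 0 := by
  have hyΩ : Measurable y := hy.mono hF le_rfl
  have hZΩ : Measurable Z := hZ.mono hF le_rfl
  have hpair : Measurable[F] fun ω => (y ω, Z ω) := hy.prodMk hZ
  have hind2 : IndepFun (fun ω => (y ω, Z ω)) w P := by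
    rw [IndepFun_iff_Indep]
    exact indep_of_indep_of_le_left hind hpair.comap_le
  have hind1 : IndepFun y w P := by
    rw [IndepFun_iff_Indep]
    exact indep_of_indep_of_le_left hind hy.comap_le
  have hpairΩ : Measurable fun ω => (y ω, Z ω) := hyΩ.prodMk hZΩ
  have m1 := (indepFun_iff_map_prod_eq_prod_map_map hyΩ.aemeasurable hw.aemeasurable).1 hind1
  have m2 := (indepFun_iff_map_prod_eq_prod_map_map hpairΩ.aemeasurable hw.aemeasurable).1 hind2
  set ν := P.map w with hν
  have : IsProbabilityMeasure ν := Measure.isProbabilityMeasure_map hw.aemeasurable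
  have : IsProbabilityMeasure (P.map y) := Measure.isProbabilityMeasure_map hyΩ.aemeasurable
  have : IsProbabilityMeasure (P.map fun ω => (y ω, Z ω)) :=
    Measure.isProbabilityMeasure_map hpairΩ.aemeasurable
  have hεi : Integrable (fun ω => g (y ω) (w ω)) P := hε.integrable (by norm_num)
  have hyw : Measurable fun ω => (y ω, w ω) := hyΩ.prodMk hw
  have hgi : Integrable (Function.uncurry g) ((P.map y).prod ν) := by
    rw [← m1, integrable_map_measure hg.aestronglyMeasurable hyw.aemeasurable]
    exact hεi
  -- Mean error at a frozen query point. The conditional hypothesis says that G integrates to zero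
  -- over every set of query points, so it vanishes for almost every one. As the sample is
  -- independent of (y, Z), the sample may then be integrated first.
  set G : E d → E d := fun a => ∫ s, g a s ∂ν with hG
  have hGi : Integrable G (P.map y) := hgi.integral_prod_left
  have hG0 : G =ᵐ[P.map y] 0 := by
    refine hGi.ae_eq_zero_of_forall_setIntegral_eq_zero fun B hB _ => ?_
    have e1 : ∫ a in B, G a ∂(P.map y) = ∫ z in B ×ˢ Set.univ, Function.uncurry g z
        ∂((P.map y).prod ν) := by
      rw [setIntegral_prod _ hgi.integrableOn]
      simp [hG]
    rw [e1, ← m1, setIntegral_map (hB.prod MeasurableSet.univ) hg.aestronglyMeasurable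
      hyw.aemeasurable]
    have e2 : (fun ω => (y ω, w ω)) ⁻¹' (B ×ˢ Set.univ) = y ⁻¹' B := by ext; simp
    rw [e2]
    have e3 := setIntegral_condExp (m := MeasurableSpace.comap y inferInstance) hyΩ.comap_le hεi
      (s := y ⁻¹' B) ⟨B, hB, rfl⟩
    change ∫ ω in y ⁻¹' B, g (y ω) (w ω) ∂P = 0
    rw [← e3, setIntegral_congr_ae (g := fun _ => 0) (hyΩ hB) (hcond.mono fun ω h _ => h)]
    simp
  have hin : Integrable (fun ω => ⟪g (y ω) (w ω), Z ω⟫) P := integrable_inner_of_memLp hε hZ2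
  set Φ : (E d × E d) × S → ℝ := fun z => ⟪g z.1.1 z.2, z.1.2⟫ with hΦ
  have hg' : Measurable fun z : (E d × E d) × S => g z.1.1 z.2 :=
    hg.comp ((measurable_fst.comp measurable_fst).prodMk measurable_snd)
  have hΦm : Measurable Φ := hg'.inner (measurable_snd.comp measurable_fst)
  have hpw : Measurable fun ω => ((y ω, Z ω), w ω) := hpairΩ.prodMk hw
  have e1 : ∫ ω, ⟪g (y ω) (w ω), Z ω⟫ ∂P
      = ∫ z, Φ z ∂((P.map fun ω => (y ω, Z ω)).prod ν) := by
    rw [← m2, integral_map hpw.aemeasurable hΦm.aestronglyMeasurable]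
  have hΦi : Integrable Φ ((P.map fun ω => (y ω, Z ω)).prod ν) := by
    rw [← m2, integrable_map_measure hΦm.aestronglyMeasurable hpw.aemeasurable]
    exact hin
  rw [e1, integral_prod _ hΦi]
  have hmap : ∀ {p : E d → Prop}, (∀ᵐ a ∂(P.map y), p a) →
      ∀ᵐ z ∂(P.map fun ω => (y ω, Z ω)), p z.1 := by
    intro p hp
    have : P.map y = (P.map fun ω => (y ω, Z ω)).map Prod.fst := by
      rw [Measure.map_map measurable_fst hpairΩ]; rfl
    rw [this] at hp
    exact ae_of_ae_map measurable_fst.aemeasurable hp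
  have h1 := hmap hgi.prod_right_ae
  have h2 := hmap hG0
  refine integral_eq_zero_of_ae ?_
  filter_upwards [h1, h2] with z hz1 hz2
  have hz1' : Integrable (fun s => g z.1 s) ν := hz1
  have : ∫ s, ⟪z.2, g z.1 s⟫ ∂ν = ⟪z.2, ∫ s, g z.1 s ∂ν⟫ := integral_inner hz1' z.2
  have hz2' : ∫ s, g z.1 s ∂ν = 0 := hz2
  simp only [hΦ, Pi.zero_apply]
  rw [hz2', inner_zero_right] at this
  rw [← this]
  exact integral_congr_ae (Filter.Eventually.of_forall fun s => real_inner_comm _ _)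

end Noise

/-! ### Measurability with respect to the samples already drawn. -/

section History

variable {Ω S : Type*} {N d : ℕ}

section

variable {R : Run N d S}

theorem Run.inner_succ (w : Fin N → ℕ → S) (t m : ℕ) :
    R.inner w t (m + 1) = (fun i => mix R.W (R.query w t m) i
      - R.stepsize t • R.grad i (R.query w t m i) (w i (R.total (t - 1) + m)), (R.inner w t m).1) :=
  rfl

theorem Run.total_succ (t : ℕ) : R.total (t + 1) = R.total t + R.len (t + 1) := by
  simp [Run.total, Finset.sum_Icc_succ_top]

theorem measurable_mix (W : Matrix (Fin N) (Fin N) ℝ) :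
    Measurable (mix W : (Fin N → E d) → Fin N → E d) := by
  unfold mix; fun_prop

theorem measurable_extrapolate (β : ℝ) :
    Measurable (extrapolate β : (Fin N → E d) × (Fin N → E d) → Fin N → E d) := by
  unfold extrapolate; fun_prop

end

variable [mS : MeasurableSpace S]

/-- The `σ`-algebra generated by the samples with indices in `A`. -/
@[reducible]
def sampleAlg (w : Fin N → ℕ → Ω → S) (A : Set (Fin N × ℕ)) : MeasurableSpace Ω :=
  ⨆ q ∈ A, mS.comap (w q.1 q.2)

/-- The `σ`-algebra generated by the samples before evaluation number `n`. -/
abbrev hist (w : Fin N → ℕ → Ω → S) (n : ℕ) : MeasurableSpace Ω :=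
  sampleAlg w {q | q.2 < n}

theorem sampleAlg_mono (w : Fin N → ℕ → Ω → S) {A B : Set (Fin N × ℕ)} (h : A ⊆ B) :
    sampleAlg w A ≤ sampleAlg w B :=
  biSup_mono h

theorem measurable_sampleAlg (w : Fin N → ℕ → Ω → S) {A : Set (Fin N × ℕ)} {i : Fin N} {n : ℕ}
    (h : (i, n) ∈ A) : Measurable[sampleAlg w A] (w i n) := by
  refine Measurable.mono (comap_measurable _) ?_ le_rfl
  exact le_biSup (f := fun q : Fin N × ℕ => mS.comap (w q.1 q.2)) h

theorem sampleAlg_le [mΩ : MeasurableSpace Ω] {w : Fin N → ℕ → Ω → S}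
    (hw : ∀ i n, Measurable (w i n))
    (A : Set (Fin N × ℕ)) : sampleAlg w A ≤ mΩ :=
  iSup₂_le fun q _ => (hw q.1 q.2).comap_le

theorem indep_sampleAlg [mΩ : MeasurableSpace Ω] {P : Measure Ω} {w : Fin N → ℕ → Ω → S}
    (hw : ∀ i n, Measurable (w i n))
    (hind : iIndepFun (fun q : Fin N × ℕ => w q.1 q.2) P) {A : Set (Fin N × ℕ)} {i : Fin N} {n : ℕ}
    (h : (i, n) ∉ A) : Indep (sampleAlg w A) (mS.comap (w i n)) P := by
  have h1 := indep_iSup_of_disjoint (fun q : Fin N × ℕ => (hw q.1 q.2).comap_le) hind.iIndep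
    (S := A) (T := {(i, n)}) (by simpa using h)
  simpa [sampleAlg] using h1

variable {R : Run N d S}

theorem Run.measurable_inner_step (hg : ∀ i, Measurable (Function.uncurry (R.grad i)))
    (w : Fin N → ℕ → Ω → S) (t m : ℕ)
    (h : Measurable[hist w (R.total (t - 1) + m)] fun ω => R.inner (fun j n => w j n ω) t m) :
    Measurable[hist w (R.total (t - 1) + (m + 1))]
      fun ω => R.inner (fun j n => w j n ω) t (m + 1) := by
  have h' : Measurable[hist w (R.total (t - 1) + (m + 1))]
      fun ω => R.inner (fun j n => w j n ω) t m :=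
    h.mono (sampleAlg_mono w fun q hq => by
      simp only [Set.mem_ofPred_eq] at hq ⊢; omega) le_rfl
  have hq : Measurable[hist w (R.total (t - 1) + (m + 1))]
      fun ω => R.query (fun j n => w j n ω) t m :=
    (measurable_extrapolate _).comp h'
  have hs : ∀ i, Measurable[hist w (R.total (t - 1) + (m + 1))] (w i (R.total (t - 1) + m)) :=
    fun i => measurable_sampleAlg w (by simp)
  have hp : Measurable[hist w (R.total (t - 1) + (m + 1))] fun ω =>
      fun i => mix R.W (R.query (fun j n => w j n ω) t m) i - R.stepsize t •
        R.grad i (R.query (fun j n => w j n ω) t m i) (w i (R.total (t - 1) + m) ω) := by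
    refine (@measurable_pi_iff _ _ _ (hist w (R.total (t - 1) + (m + 1))) _ _).2 fun i => ?_
    have h1 : Measurable[hist w (R.total (t - 1) + (m + 1))]
        fun ω => mix R.W (R.query (fun j n => w j n ω) t m) i :=
      (measurable_pi_apply i).comp ((measurable_mix R.W).comp hq)
    have h2 : Measurable[hist w (R.total (t - 1) + (m + 1))]
        fun ω => R.grad i (R.query (fun j n => w j n ω) t m i) (w i (R.total (t - 1) + m) ω) :=
      (hg i).comp (((measurable_pi_apply i).comp hq).prodMk (hs i))
    exact h1.sub ((measurable_const_smul (R.stepsize t)).comp h2)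
  exact hp.prodMk (measurable_fst.comp h')

/-- Adaptedness: iterate m of stage t uses only samples numbered below L_{t-1} + m, so sample
L_{t-1} + m is fresh at the next step. The induction over m is nested in an induction over stages.
-/
theorem Run.measurable_inner (hg : ∀ i, Measurable (Function.uncurry (R.grad i)))
    (w : Fin N → ℕ → Ω → S) {t : ℕ} (ht : 1 ≤ t) (m : ℕ) :
    Measurable[hist w (R.total (t - 1) + m)] fun ω => R.inner (fun j n => w j n ω) t m := by
  obtain ⟨s, rfl⟩ := Nat.exists_eq_add_of_le' ht
  have aux : Measurable[hist w (R.total s)] (fun ω => R.stageEnd (fun j n => w j n ω) s) →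
      ∀ m, Measurable[hist w (R.total s + m)]
        fun ω => R.inner (fun j n => w j n ω) (s + 1) m := by
    intro h m
    induction m with
    | zero => exact h.prodMk h
    | succ m ih => exact Run.measurable_inner_step hg w (s + 1) m ih
  clear ht
  suffices h : ∀ s, Measurable[hist w (R.total s)] (fun ω => R.stageEnd (fun j n => w j n ω) s) from
    aux (h s) m
  intro s
  clear aux m
  induction s with
  | zero => exact measurable_const
  | succ s ih =>
    have aux : ∀ m, Measurable[hist w (R.total s + m)]
        fun ω => R.inner (fun j n => w j n ω) (s + 1) m := by
      intro m
      induction m with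
      | zero => exact ih.prodMk ih
      | succ m ih => exact Run.measurable_inner_step hg w (s + 1) m ih
    rw [Run.total_succ]
    exact measurable_fst.comp (aux (R.len (s + 1)))

theorem Run.measurable_query (hg : ∀ i, Measurable (Function.uncurry (R.grad i)))
    (w : Fin N → ℕ → Ω → S) {t : ℕ} (ht : 1 ≤ t) (m : ℕ) :
    Measurable[hist w (R.total (t - 1) + m)] fun ω => R.query (fun j n => w j n ω) t m :=
  (measurable_extrapolate _).comp (Run.measurable_inner hg w ht m)

end History

namespace Run.NoiseAssumption

variable {Ω S : Type*} [mΩ : MeasurableSpace Ω] [mS : MeasurableSpace S] {P : Measure Ω}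
  [IsProbabilityMeasure P] {N d : ℕ} {R : Run N d S} {f : Fin N → E d → ℝ} {σ : ℝ}
  {w : Fin N → ℕ → Ω → S}

theorem integral_inner_noise (hn : R.NoiseAssumption f σ P w)
    (hf : ∀ i, Measurable (∇ (f i))) {t m : ℕ} (ht : 1 ≤ t) (hm : m < R.len t) (i : Fin N)
    {A : Set (Fin N × ℕ)} (hA : {q : Fin N × ℕ | q.2 < R.total (t - 1) + m} ⊆ A)
    (hiA : (i, R.total (t - 1) + m) ∉ A) {Z : Ω → E d} (hZ : Measurable[sampleAlg w A] Z)
    (hZ2 : MemLp Z 2 P) : ∫ ω, ⟪R.noise f w t m i ω, Z ω⟫ ∂P = 0 := by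
  have hq : Measurable[sampleAlg w A] fun ω => R.query (fun j n => w j n ω) t m i :=
    (measurable_pi_apply i).comp ((Run.measurable_query hn.measurable_grad w ht m).mono
      (sampleAlg_mono w hA) le_rfl)
  exact integral_inner_noise_eq_zero (sampleAlg_le hn.measurable_sample A)
    (hn.measurable_sample i (R.total (t - 1) + m))
    (indep_sampleAlg hn.measurable_sample hn.indep hiA) hq hZ
    (g := fun y s => R.grad i y s - ∇ (f i) y)
    ((hn.measurable_grad i).sub ((hf i).comp measurable_fst))
    (hn.memLp t ht m hm i) hZ2 (hn.unbiased t ht m hm i)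

theorem integral_inner_noise_hist (hn : R.NoiseAssumption f σ P w)
    (hf : ∀ i, Measurable (∇ (f i))) {t m : ℕ} (ht : 1 ≤ t) (hm : m < R.len t) (i : Fin N)
    {Z : Ω → E d} (hZ : Measurable[hist w (R.total (t - 1) + m)] Z) (hZ2 : MemLp Z 2 P) :
    ∫ ω, ⟪R.noise f w t m i ω, Z ω⟫ ∂P = 0 :=
  hn.integral_inner_noise hf ht hm i subset_rfl (by simp) hZ hZ2

/-- The past is enlarged by the current sample of node j. It still omits that of node i, so the
noise of node j becomes an admissible test vector. -/
theorem integral_inner_noise_noise (hn : R.NoiseAssumption f σ P w)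
    (hf : ∀ i, Measurable (∇ (f i))) {t m : ℕ} (ht : 1 ≤ t) (hm : m < R.len t) {i j : Fin N}
    (hij : i ≠ j) : ∫ ω, ⟪R.noise f w t m i ω, R.noise f w t m j ω⟫ ∂P = 0 := by
  refine hn.integral_inner_noise hf ht hm i
    (A := {q | q.2 < R.total (t - 1) + m} ∪ {(j, R.total (t - 1) + m)}) Set.subset_union_left
    ?_ ?_ (hn.memLp t ht m hm j)
  · simp [hij]
  · have hq : Measurable[sampleAlg w ({q | q.2 < R.total (t - 1) + m}
        ∪ {(j, R.total (t - 1) + m)})] fun ω => R.query (fun j n => w j n ω) t m j :=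
      (measurable_pi_apply j).comp ((Run.measurable_query hn.measurable_grad w ht m).mono
        (sampleAlg_mono w Set.subset_union_left) le_rfl)
    have hs := measurable_sampleAlg w (A := {q | q.2 < R.total (t - 1) + m}
        ∪ {(j, R.total (t - 1) + m)}) (i := j) (n := R.total (t - 1) + m) (by simp)
    exact ((hn.measurable_grad j).comp (hq.prodMk hs)).sub ((hf j).comp hq)

theorem integral_norm_noise_sq_le (hn : R.NoiseAssumption f σ P w)
    {t m : ℕ} (ht : 1 ≤ t) (hm : m < R.len t) (i : Fin N) :
    ∫ ω, ‖R.noise f w t m i ω‖ ^ 2 ∂P ≤ σ ^ 2 := by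
  have hle : R.queryAlg w t m i ≤ mΩ :=
    ((measurable_pi_apply i).comp ((Run.measurable_query hn.measurable_grad w ht m).mono
      (sampleAlg_le hn.measurable_sample _) le_rfl)).comap_le
  rw [← integral_condExp hle]
  refine (integral_mono_ae integrable_condExp (integrable_const _)
    (hn.variance_le t ht m hm i)).trans ?_
  simp

end Run.NoiseAssumption


/-! ### Square integrability. -/

section NodeL2

variable {Ω : Type*} [MeasurableSpace Ω] {P : Measure Ω} {N d : ℕ}

/-- All node vectors are square integrable. -/
def NodeL2 (P : Measure Ω) (X : Ω → Fin N → E d) : Prop := ∀ i, MemLp (fun ω => X ω i) 2 P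

theorem memLp_smul {x : Ω → E d} (hx : MemLp x 2 P) (c : ℝ) : MemLp (fun ω => c • x ω) 2 P :=
  hx.const_smul c

theorem memLp_sub {x y : Ω → E d} (hx : MemLp x 2 P) (hy : MemLp y 2 P) :
    MemLp (fun ω => x ω - y ω) 2 P := hx.sub hy

theorem memLp_add {x y : Ω → E d} (hx : MemLp x 2 P) (hy : MemLp y 2 P) :
    MemLp (fun ω => x ω + y ω) 2 P := hx.add hy

/-- The integral of a function bounded by an affine combination of integrable functions. -/
theorem integral_le_affine [IsProbabilityMeasure P] {X A B C D : Ω → ℝ} {a b c e k : ℝ}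
    (hX : Integrable X P) (hA : Integrable A P) (hB : Integrable B P) (hC : Integrable C P)
    (hD : Integrable D P) (h : ∀ ω, X ω ≤ a * A ω + b * B ω + c * C ω + e * D ω + k) :
    ∫ ω, X ω ∂P ≤ a * ∫ ω, A ω ∂P + b * ∫ ω, B ω ∂P + c * ∫ ω, C ω ∂P + e * ∫ ω, D ω ∂P + k := by
  have h1 := hA.const_mul a
  have h2 := h1.add (hB.const_mul b)
  have h3 := h2.add (hC.const_mul c)
  have h4 := h3.add (hD.const_mul e)
  have h5 := h4.add (integrable_const k)
  refine (integral_mono hX h5 h).trans (le_of_eq ?_)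
  rw [integral_add' h4 (integrable_const k), integral_add' h3 (hD.const_mul e),
    integral_add' h2 (hC.const_mul c), integral_add' h1 (hB.const_mul b)]
  simp [integral_const_mul]

theorem NodeL2.mix {X : Ω → Fin N → E d} (h : NodeL2 P X) (W : Matrix (Fin N) (Fin N) ℝ) :
    NodeL2 P fun ω => mix W (X ω) := fun i =>
  memLp_finsetSum _ fun j _ => (h j).const_smul (W i j)

theorem NodeL2.nodeAvg {X : Ω → Fin N → E d} (h : NodeL2 P X) :
    MemLp (fun ω => nodeAvg (X ω)) 2 P :=
  (memLp_finsetSum _ fun j _ => h j).const_smul (N : ℝ)⁻¹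

theorem NodeL2.dev {X : Ω → Fin N → E d} (h : NodeL2 P X) : NodeL2 P fun ω => dev (X ω) :=
  fun i => (h i).sub h.nodeAvg

theorem NodeL2.sub {X Y : Ω → Fin N → E d} (h : NodeL2 P X) (h' : NodeL2 P Y) :
    NodeL2 P fun ω => X ω - Y ω := fun i => (h i).sub (h' i)

theorem memLp_auxPt {q : ℝ} {x xm : Ω → E d} (hx : MemLp x 2 P) (hxm : MemLp xm 2 P) :
    MemLp (fun ω => auxPt q (x ω) (xm ω)) 2 P :=
  hxm.add ((hx.sub hxm).const_smul q⁻¹)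

theorem integrable_norm_sq_of_memLp {H : Type*} [NormedAddCommGroup H] {x : Ω → H}
    (hx : MemLp x 2 P) : Integrable (fun ω => ‖x ω‖ ^ 2) P :=
  hx.integrable_norm_pow (by norm_num)

theorem NodeL2.integrable_consE {X Xm : Ω → Fin N → E d} (W : Matrix (Fin N) (Fin N) ℝ)
    (h : NodeL2 P X) (h' : NodeL2 P Xm) : Integrable (fun ω => consE W (X ω) (Xm ω)) P := by
  unfold consE
  refine (integrable_finsetSum _ fun i _ => ?_).add (integrable_finsetSum _ fun i _ => ?_)
  · exact integrable_inner_of_memLp (h.dev i) ((h.dev i).sub (h.dev.mix W i))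
  · exact integrable_inner_of_memLp ((h.dev i).sub (h'.dev i)) ((h.dev.sub h'.dev).mix W i)

variable [IsProbabilityMeasure P] {W : Matrix (Fin N) (Fin N) ℝ} {f : Fin N → E d → ℝ}
  {μ L lam ρ : ℝ} {xs : E d}

theorem Setting.memLp_gradient (h : Setting W f μ L lam ρ xs) (i : Fin N) {Y : Ω → E d}
    (hY : MemLp Y 2 P) : MemLp (fun ω => ∇ (f i) (Y ω)) 2 P := by
  have h1 : MemLp (fun ω => L * ‖Y ω - xs‖ + ‖∇ (f i) xs‖) 2 P :=
    ((hY.sub (memLp_const xs)).norm.const_mul L).add (memLp_const _)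
  refine h1.mono ((h.continuous_gradient i).comp_aestronglyMeasurable hY.1)
    (Filter.Eventually.of_forall fun ω => ?_)
  have h2 := norm_add_le (∇ (f i) (Y ω) - ∇ (f i) xs) (∇ (f i) xs)
  rw [sub_add_cancel] at h2
  have h3 := h.norm_gradient_sub_le i (Y ω) xs
  exact (by linarith : _ ≤ _).trans (le_abs_self _)

theorem Setting.integrable_objective (h : Setting W f μ L lam ρ xs) (i : Fin N) {Y : Ω → E d}
    (hY : MemLp Y 2 P) : Integrable (fun ω => f i (Y ω)) P := by
  have hs : MemLp (fun ω => Y ω - xs) 2 P := hY.sub (memLp_const xs)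
  have hc : MemLp (fun _ : Ω => ∇ (f i) xs) 2 P := memLp_const _
  have h1 : Integrable (fun ω => f i (Y ω) - f i xs - ⟪∇ (f i) xs, Y ω - xs⟫) P := by
    refine Integrable.mono' ((integrable_norm_sq_of_memLp hs).const_mul (L / 2)) ?_
      (Filter.Eventually.of_forall fun ω => ?_)
    · exact (((h.reg i).1.continuous.comp_aestronglyMeasurable hY.1).sub
        aestronglyMeasurable_const).sub (hc.1.inner hs.1)
    · rw [Real.norm_eq_abs, abs_of_nonneg]
      · exact ((h.reg i).2 (Y ω) xs).2
      · exact le_trans (by have := h.mu_pos; positivity) ((h.reg i).2 (Y ω) xs).1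
  have h2 := (h1.add (integrable_inner_of_memLp hc hs)).add (integrable_const (f i xs))
  refine h2.congr (Filter.Eventually.of_forall fun ω => ?_)
  simp only [Pi.add_apply]
  ring

theorem Setting.integrable_penV (h : Setting W f μ L lam ρ xs) (α : ℝ) {X Xm : Ω → Fin N → E d}
    (hX : NodeL2 P X) (hXm : NodeL2 P Xm) :
    Integrable (fun ω => penV W f μ xs α (X ω) (Xm ω)) P := by
  unfold penV
  refine ((integrable_finsetSum _ fun i _ => ?_).add
    ((integrable_finsetSum _ fun i _ => ?_).const_mul _)).add
    ((integrable_finsetSum _ fun i _ => ?_).const_mul _)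
  · exact (h.integrable_objective i (hX i)).sub (integrable_const _)
  · exact integrable_inner_of_memLp (hX i) ((hX i).sub (hX.mix W i))
  · exact integrable_norm_sq_of_memLp ((memLp_auxPt (hX i) (hXm i)).sub (memLp_const xs))

theorem Setting.integrable_avgV (h : Setting W f μ L lam ρ xs) (α : ℝ) {X Xm : Ω → E d}
    (hX : MemLp X 2 P) (hXm : MemLp Xm 2 P) :
    Integrable (fun ω => avgV f μ xs α (X ω) (Xm ω)) P := by
  unfold avgV
  refine (((integrable_finsetSum _ fun i _ => h.integrable_objective i hX).const_mul _).sub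
    (integrable_const _)).add (Integrable.const_mul ?_ _)
  exact integrable_norm_sq_of_memLp ((memLp_auxPt hX hXm).sub (memLp_const xs))

theorem Setting.measurable_penDir (h : Setting W f μ L lam ρ xs) (α : ℝ) (i : Fin N) :
    Measurable fun s : (Fin N → E d) × (Fin N → E d) => penDir W f μ xs α s.1 s.2 i := by
  have h1 := (h.continuous_gradient i).measurable
  have h2 : Measurable fun s : (Fin N → E d) × (Fin N → E d) => mix W s.2 i :=
    (measurable_pi_apply i).comp ((measurable_mix W).comp measurable_snd)
  unfold penDir
  fun_prop

theorem Setting.measurable_avgDir (h : Setting W f μ L lam ρ xs) (α : ℝ) :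
    Measurable fun s : (Fin N → E d) × (Fin N → E d) => avgDir f μ xs α s.1 s.2 := by
  have h1 := fun i => (h.continuous_gradient i).measurable
  unfold avgDir meanGrad gradBias nodeAvg
  fun_prop

theorem Setting.memLp_penDir (h : Setting W f μ L lam ρ xs) (α : ℝ) {X Y : Ω → Fin N → E d}
    (hX : NodeL2 P X) (hY : NodeL2 P Y) (i : Fin N) :
    MemLp (fun ω => penDir W f μ xs α (X ω) (Y ω) i) 2 P := by
  unfold penDir
  exact memLp_sub (memLp_add (memLp_smul (h.memLp_gradient i (hY i)) α)
    (memLp_sub (hY i) (hY.mix W i)))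
    (memLp_sub (memLp_sub (hY i) (memLp_smul (hX i) _)) (memLp_const _))

theorem Setting.memLp_avgDir (h : Setting W f μ L lam ρ xs) (α : ℝ) {X Y : Ω → Fin N → E d}
    (hX : NodeL2 P X) (hY : NodeL2 P Y) :
    MemLp (fun ω => avgDir f μ xs α (X ω) (Y ω)) 2 P := by
  have h1 : MemLp (fun ω => meanGrad f (nodeAvg (Y ω))) 2 P :=
    (memLp_finsetSum _ fun i _ => h.memLp_gradient i hY.nodeAvg).const_smul (N : ℝ)⁻¹
  have h2 : MemLp (fun ω => gradBias f (Y ω)) 2 P :=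
    (memLp_finsetSum _ fun i _ => (h.memLp_gradient i (hY i)).sub
      (h.memLp_gradient i hY.nodeAvg)).const_smul (N : ℝ)⁻¹
  unfold avgDir
  exact memLp_add (memLp_sub (memLp_smul h1 α) (memLp_sub (memLp_sub hY.nodeAvg
    (memLp_smul hX.nodeAvg _)) (memLp_const _))) (memLp_smul h2 (2 * α))

end NodeL2

/-! ### One-step recursions in expectation. -/

section Expected

variable {Ω S : Type*} [MeasurableSpace Ω] [MeasurableSpace S] {N d : ℕ}

/-- A run of the method in the standing setting, with admissible stepsizes and noise. -/
structure AdmissibleRun (R : Run N d S) (f : Fin N → E d → ℝ) (μ L lam ρ σ : ℝ) (xs : E d)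
    (P : Measure Ω) (w : Fin N → ℕ → Ω → S) : Prop where
  setting : Setting R.W f μ L lam ρ xs
  mu_eq : R.μ = μ
  noise : R.NoiseAssumption f σ P w
  step_pos : ∀ t, 0 < R.stepsize t
  step_le : ∀ t, R.stepsize t * (L + μ) ≤ lam

/-- The iterate `x^{(t,m)}` as a random variable. -/
noncomputable abbrev curPt (R : Run N d S) (w : Fin N → ℕ → Ω → S) (t m : ℕ) (ω : Ω) :
    Fin N → E d := (R.inner (fun j n => w j n ω) t m).1

/-- The iterate `x^{(t,m-1)}` as a random variable. -/
noncomputable abbrev prevPt (R : Run N d S) (w : Fin N → ℕ → Ω → S) (t m : ℕ) (ω : Ω) :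
    Fin N → E d := (R.inner (fun j n => w j n ω) t m).2

/-- The expected Lyapunov function of the penalized problem. -/
noncomputable def expPen (R : Run N d S) (f : Fin N → E d → ℝ) (xs : E d) (P : Measure Ω)
    (w : Fin N → ℕ → Ω → S) (t m : ℕ) : ℝ :=
  ∫ ω, penV R.W f R.μ xs (R.stepsize t) (curPt R w t m ω) (prevPt R w t m ω) ∂P

/-- The expected consensus energy. -/
noncomputable def expCons (R : Run N d S) (P : Measure Ω) (w : Fin N → ℕ → Ω → S) (t m : ℕ) : ℝ :=
  ∫ ω, consE R.W (curPt R w t m ω) (prevPt R w t m ω) ∂P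

/-- The expected Lyapunov function of the average iterate. -/
noncomputable def expAvg (R : Run N d S) (f : Fin N → E d → ℝ) (xs : E d) (P : Measure Ω)
    (w : Fin N → ℕ → Ω → S) (t m : ℕ) : ℝ :=
  ∫ ω, avgV f R.μ xs (R.stepsize t) (nodeAvg (curPt R w t m ω)) (nodeAvg (prevPt R w t m ω)) ∂P

namespace AdmissibleRun

variable {R : Run N d S} {f : Fin N → E d → ℝ} {μ L lam ρ σ : ℝ} {xs : E d} {P : Measure Ω}
  [IsProbabilityMeasure P] {w : Fin N → ℕ → Ω → S}

theorem curPt_succ (t m : ℕ) (ω : Ω) : curPt R w t (m + 1) ω = fun i =>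
    mix R.W (R.query (fun j n => w j n ω) t m) i - R.stepsize t •
      (∇ (f i) (R.query (fun j n => w j n ω) t m i) + R.noise f w t m i ω) := by
  simp only [curPt, Run.inner_succ, Run.noise, add_sub_cancel]

theorem query_eq (h : AdmissibleRun R f μ L lam ρ σ xs P w) (t m : ℕ) (ω : Ω) :
    R.query (fun j n => w j n ω) t m
      = extrapolate (momentum μ (R.stepsize t)) (curPt R w t m ω, prevPt R w t m ω) := by
  rw [Run.query, h.mu_eq]

theorem nodeL2_query (h : AdmissibleRun R f μ L lam ρ σ xs P w) {t m : ℕ}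
    (h1 : NodeL2 P (curPt R w t m)) (h2 : NodeL2 P (prevPt R w t m)) :
    NodeL2 P fun ω => R.query (fun j n => w j n ω) t m := by
  intro i
  simp only [h.query_eq]
  exact memLp_sub (memLp_smul (h1 i) _) (memLp_smul (h2 i) _)

theorem nodeL2_stage (h : AdmissibleRun R f μ L lam ρ σ xs P w) {t : ℕ} (ht : 1 ≤ t)
    (h0 : NodeL2 P fun ω => R.stageEnd (fun j n => w j n ω) (t - 1)) {m : ℕ} (hm : m ≤ R.len t) :
    NodeL2 P (curPt R w t m) ∧ NodeL2 P (prevPt R w t m) := by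
  induction m with
  | zero => exact ⟨h0, h0⟩
  | succ m ih =>
    obtain ⟨i1, i2⟩ := ih (by omega)
    have hq := h.nodeL2_query i1 i2
    refine ⟨fun i => ?_, i1⟩
    simp only [curPt_succ (f := f)]
    exact memLp_sub (hq.mix R.W i) (memLp_smul (memLp_add (h.setting.memLp_gradient i (hq i))
      (h.noise.memLp t ht m (by omega) i)) _)

theorem nodeL2_stageEnd (h : AdmissibleRun R f μ L lam ρ σ xs P w) (t : ℕ) :
    NodeL2 P fun ω => R.stageEnd (fun j n => w j n ω) t := by
  induction t with
  | zero => exact fun i => memLp_const (R.init i)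
  | succ t ih =>
    have := (h.nodeL2_stage (t := t + 1) (by omega) ih le_rfl).1
    exact this

theorem nodeL2 (h : AdmissibleRun R f μ L lam ρ σ xs P w) {t m : ℕ} (ht : 1 ≤ t)
    (hm : m ≤ R.len t) : NodeL2 P (curPt R w t m) ∧ NodeL2 P (prevPt R w t m) :=
  h.nodeL2_stage ht (h.nodeL2_stageEnd _) hm

theorem measurable_state (h : AdmissibleRun R f μ L lam ρ σ xs P w) {t : ℕ} (ht : 1 ≤ t) (m : ℕ) :
    Measurable[hist w (R.total (t - 1) + m)]
      fun ω => (curPt R w t m ω, R.query (fun j n => w j n ω) t m) :=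
  (measurable_fst.comp (Run.measurable_inner h.noise.measurable_grad w ht m)).prodMk
    (Run.measurable_query h.noise.measurable_grad w ht m)

theorem measurable_gradient (h : AdmissibleRun R f μ L lam ρ σ xs P w) (i : Fin N) :
    Measurable (∇ (f i)) := (h.setting.continuous_gradient i).measurable

theorem integral_sum_noise_sq_le (h : AdmissibleRun R f μ L lam ρ σ xs P w) {t m : ℕ} (ht : 1 ≤ t)
    (hm : m < R.len t) : ∫ ω, ∑ i, ‖R.noise f w t m i ω‖ ^ 2 ∂P ≤ N * σ ^ 2 := by
  rw [integral_finsetSum _ fun i _ => integrable_norm_sq_of_memLp (h.noise.memLp t ht m hm i)]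
  refine (Finset.sum_le_sum fun i _ => h.noise.integral_norm_noise_sq_le ht hm i).trans ?_
  simp

/-- The cross terms between different nodes vanish, which is the source of the factor 1/N in the
variance. -/
theorem integral_nodeAvg_noise_sq_le (h : AdmissibleRun R f μ L lam ρ σ xs P w) {t m : ℕ}
    (ht : 1 ≤ t) (hm : m < R.len t) :
    ∫ ω, ‖nodeAvg (fun i => R.noise f w t m i ω)‖ ^ 2 ∂P ≤ σ ^ 2 / N := by
  have hN : (0 : ℝ) < N := by exact_mod_cast h.setting.N_pos
  have hi : ∀ i j, Integrable (fun ω => ⟪R.noise f w t m i ω, R.noise f w t m j ω⟫) P :=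
    fun i j => integrable_inner_of_memLp (h.noise.memLp t ht m hm i) (h.noise.memLp t ht m hm j)
  have e1 : ∀ ω, ‖nodeAvg (fun i => R.noise f w t m i ω)‖ ^ 2
      = ((N : ℝ)⁻¹) ^ 2 * ∑ i, ∑ j, ⟪R.noise f w t m i ω, R.noise f w t m j ω⟫ := by
    intro ω
    rw [nodeAvg, norm_smul, mul_pow, Real.norm_eq_abs, sq_abs, ← real_inner_self_eq_norm_sq,
      sum_inner]
    simp only [inner_sum]
  simp only [e1]
  rw [integral_const_mul, integral_finsetSum _ fun i _ => integrable_finsetSum _ fun j _ => hi i j]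
  have e2 : ∀ i, ∫ ω, ∑ j, ⟪R.noise f w t m i ω, R.noise f w t m j ω⟫ ∂P ≤ σ ^ 2 := by
    intro i
    rw [integral_finsetSum _ fun j _ => hi i j, Finset.sum_eq_single i]
    · simp only [real_inner_self_eq_norm_sq]
      exact h.noise.integral_norm_noise_sq_le ht hm i
    · intro j _ hj
      exact h.noise.integral_inner_noise_noise h.measurable_gradient ht hm (Ne.symm hj)
    · simp
  refine (mul_le_mul_of_nonneg_left (Finset.sum_le_sum fun i _ => e2 i) (by positivity)).trans ?_
  simp only [Finset.sum_const, Finset.card_univ, Fintype.card_fin, nsmul_eq_mul]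
  refine le_of_eq ?_
  field_simp

theorem expPen_succ_le (h : AdmissibleRun R f μ L lam ρ σ xs P w) {t m : ℕ} (ht : 1 ≤ t)
    (hm : m < R.len t) :
    expPen R f xs P w t (m + 1) ≤ (1 - √(μ * R.stepsize t)) * expPen R f xs P w t m
      + R.stepsize t * (N * σ ^ 2) := by
  obtain ⟨hx, hxm⟩ := h.nodeL2 ht hm.le
  obtain ⟨hx', -⟩ := h.nodeL2 ht (m := m + 1) hm
  have hq := h.nodeL2_query hx hxm
  have hε := h.noise.memLp t ht m hm
  have hα := h.step_pos t
  unfold expPen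
  rw [h.mu_eq]
  have hD := fun i => h.setting.memLp_penDir (R.stepsize t) hx hq i
  have i1 : Integrable (fun ω => ∑ i, ⟪R.noise f w t m i ω,
      penDir R.W f μ xs (R.stepsize t) (curPt R w t m ω) (R.query (fun j n => w j n ω) t m) i⟫) P :=
    integrable_finsetSum _ fun i _ => integrable_inner_of_memLp (hε i) (hD i)
  have i2 : Integrable (fun ω => ∑ i, ‖R.noise f w t m i ω‖ ^ 2) P :=
    integrable_finsetSum _ fun i _ => integrable_norm_sq_of_memLp (hε i)
  have i3 := h.setting.integrable_penV (R.stepsize t) hx hxm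
  have z1 : ∫ ω, ∑ i, ⟪R.noise f w t m i ω, penDir R.W f μ xs (R.stepsize t) (curPt R w t m ω)
      (R.query (fun j n => w j n ω) t m) i⟫ ∂P = 0 := by
    rw [integral_finsetSum _ fun i _ => integrable_inner_of_memLp (hε i) (hD i)]
    refine Finset.sum_eq_zero fun i _ => ?_
    have hM : Measurable[hist w (R.total (t - 1) + m)] fun ω => penDir R.W f μ xs (R.stepsize t)
        (curPt R w t m ω) (R.query (fun j n => w j n ω) t m) i := by
      have := @Measurable.comp _ _ _ (hist w (R.total (t - 1) + m)) _ _ _ _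
        (h.setting.measurable_penDir (R.stepsize t) i) (h.measurable_state ht m)
      exact this
    exact h.noise.integral_inner_noise_hist h.measurable_gradient ht hm i hM (hD i)
  -- The fourth function is a filler with coefficient 0. The second one is the noise pairing, whose
  -- integral vanishes by `z1`.
  have key := integral_le_affine (a := 1 - √(μ * R.stepsize t)) (b := 1) (c := R.stepsize t)
    (e := 0) (k := 0) (h.setting.integrable_penV (R.stepsize t) hx' hx) i3 i1 i2 i2
    (fun ω => by
      have := h.setting.penV_step hα (h.step_le t) (curPt R w t m ω) (prevPt R w t m ω)
        (fun i => R.noise f w t m i ω) (h.query_eq t m ω)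
      rw [← curPt_succ] at this
      linarith)
  rw [z1] at key
  have := mul_le_mul_of_nonneg_left (h.integral_sum_noise_sq_le ht hm) hα.le
  refine key.trans ?_
  linarith

theorem expCons_succ_le (h : AdmissibleRun R f μ L lam ρ σ xs P w) {t m : ℕ} (ht : 1 ≤ t)
    (hm : m < R.len t) :
    expCons R P w t (m + 1) ≤ (1 + ρ) / 2 * expCons R P w t m + 2 / (1 - ρ) * R.stepsize t ^ 2 *
      (16 * L ^ 2 / μ * (expPen R f xs P w t m + penC f μ xs) + 4 * μ * penC f μ xs
        + 2 * (N * σ ^ 2)) := by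
  obtain ⟨hx, hxm⟩ := h.nodeL2 ht hm.le
  obtain ⟨hx', -⟩ := h.nodeL2 ht (m := m + 1) hm
  have hε := h.noise.memLp t ht m hm
  have hα := h.step_pos t
  have hρ : 0 < 1 - ρ := by linarith [h.setting.rho_lt]
  unfold expCons expPen
  rw [h.mu_eq]
  have i1 := hx.integrable_consE R.W hxm
  have i2 : Integrable (fun ω => ∑ i, ‖R.noise f w t m i ω‖ ^ 2) P :=
    integrable_finsetSum _ fun i _ => integrable_norm_sq_of_memLp (hε i)
  have i3 := h.setting.integrable_penV (R.stepsize t) hx hxm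
  set B := 2 / (1 - ρ) * R.stepsize t ^ 2 with hB
  have hB0 : 0 ≤ B := by positivity
  have key := integral_le_affine (a := (1 + ρ) / 2) (b := B * (16 * L ^ 2 / μ)) (c := B * 2)
    (e := 0) (k := B * (16 * L ^ 2 / μ * penC f μ xs + 4 * μ * penC f μ xs))
    (hx'.integrable_consE R.W hx) i1 i3 i2 i2
    (fun ω => by
      have h1 := h.setting.consE_step hα (h.step_le t) (curPt R w t m ω) (prevPt R w t m ω)
        (fun i => ∇ (f i) (R.query (fun j n => w j n ω) t m i) + R.noise f w t m i ω)
        (h.query_eq t m ω)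
      have h2 := h.setting.sum_gradient_sq_le hα (h.step_le t) (curPt R w t m ω)
        (prevPt R w t m ω) (fun i => R.noise f w t m i ω) (h.query_eq t m ω)
      rw [← curPt_succ (f := f), ← hB] at h1
      have h3 := mul_le_mul_of_nonneg_left h2 hB0
      linarith)
  have := mul_le_mul_of_nonneg_left (h.integral_sum_noise_sq_le ht hm) hB0
  refine key.trans ?_
  linarith

theorem expAvg_succ_le (h : AdmissibleRun R f μ L lam ρ σ xs P w) {t m : ℕ} (ht : 1 ≤ t)
    (hm : m < R.len t) :
    expAvg R f xs P w t (m + 1) ≤ (1 - 7 / 8 * √(μ * R.stepsize t)) * expAvg R f xs P w t m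
      + √(μ * R.stepsize t) * ((9 / μ + 8 * L ^ 2 / μ ^ 3) *
          (L ^ 2 / N * (2 * ((1 - ρ)⁻¹ + lam⁻¹)))) * expCons R P w t m
      + R.stepsize t * (σ ^ 2 / N) := by
  obtain ⟨hx, hxm⟩ := h.nodeL2 ht hm.le
  obtain ⟨hx', -⟩ := h.nodeL2 ht (m := m + 1) hm
  have hq := h.nodeL2_query hx hxm
  have hε := h.noise.memLp t ht m hm
  have hε' : NodeL2 P fun ω => fun i => R.noise f w t m i ω := hε
  have hα := h.step_pos t
  unfold expAvg expCons
  rw [h.mu_eq]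
  have hD := h.setting.memLp_avgDir (R.stepsize t) hx hq
  have i1 : Integrable (fun ω => ⟪nodeAvg (fun i => R.noise f w t m i ω),
      avgDir f μ xs (R.stepsize t) (curPt R w t m ω) (R.query (fun j n => w j n ω) t m)⟫) P :=
    integrable_inner_of_memLp hε'.nodeAvg hD
  have i2 := integrable_norm_sq_of_memLp hε'.nodeAvg
  have i3 := h.setting.integrable_avgV (R.stepsize t) hx.nodeAvg hxm.nodeAvg
  have i4 := hx.integrable_consE R.W hxm
  have z1 : ∫ ω, ⟪nodeAvg (fun i => R.noise f w t m i ω), avgDir f μ xs (R.stepsize t)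
      (curPt R w t m ω) (R.query (fun j n => w j n ω) t m)⟫ ∂P = 0 := by
    simp only [nodeAvg, inner_smul_left, RCLike.conj_to_real, sum_inner]
    rw [integral_const_mul, integral_finsetSum _ fun i _ => integrable_inner_of_memLp (hε i) hD]
    rw [Finset.sum_eq_zero, mul_zero]
    intro i _
    have hM : Measurable[hist w (R.total (t - 1) + m)] fun ω => avgDir f μ xs (R.stepsize t)
        (curPt R w t m ω) (R.query (fun j n => w j n ω) t m) := by
      have := @Measurable.comp _ _ _ (hist w (R.total (t - 1) + m)) _ _ _ _
        (h.setting.measurable_avgDir (R.stepsize t)) (h.measurable_state ht m)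
      exact this
    exact h.noise.integral_inner_noise_hist h.measurable_gradient ht hm i hM hD
  have key := integral_le_affine (a := 1 - 7 / 8 * √(μ * R.stepsize t))
    (b := √(μ * R.stepsize t) * ((9 / μ + 8 * L ^ 2 / μ ^ 3) *
      (L ^ 2 / N * (2 * ((1 - ρ)⁻¹ + lam⁻¹))))) (c := 1) (e := R.stepsize t) (k := 0)
    (h.setting.integrable_avgV (R.stepsize t) hx'.nodeAvg hx.nodeAvg) i3 i4 i1 i2
    (fun ω => by
      have := h.setting.avgV_step hα (h.step_le t) (curPt R w t m ω) (prevPt R w t m ω)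
        (fun i => R.noise f w t m i ω) (h.query_eq t m ω)
      rw [← curPt_succ] at this
      linarith)
  rw [z1] at key
  have := mul_le_mul_of_nonneg_left (h.integral_nodeAvg_noise_sq_le ht hm) hα.le
  refine key.trans ?_
  linarith

theorem expPen_restart (h : AdmissibleRun R f μ L lam ρ σ xs P w) (t : ℕ)
    (h16 : R.stepsize (t + 1) ≤ 16 * R.stepsize (t + 2)) :
    expPen R f xs P w (t + 2) 0
      ≤ 18 * (expPen R f xs P w (t + 1) (R.len (t + 1)) + penC f μ xs) := by
  obtain ⟨hx, hxm⟩ := h.nodeL2 (t := t + 1) (by omega) le_rfl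
  have i1 := h.setting.integrable_penV (R.stepsize (t + 1)) hx hxm
  have key := integral_mono (h.setting.integrable_penV (R.stepsize (t + 2)) hx hx)
    ((i1.add (integrable_const (penC f μ xs))).const_mul 18)
    (fun ω => h.setting.penV_restart (h.step_pos _) h16 (h.step_pos _) _ _)
  unfold expPen
  rw [h.mu_eq]
  refine key.trans (le_of_eq ?_)
  rw [integral_const_mul]
  simp only [Pi.add_apply]
  rw [integral_add i1 (integrable_const _)]
  simp

theorem expCons_restart (h : AdmissibleRun R f μ L lam ρ σ xs P w) (t : ℕ) :
    expCons R P w (t + 2) 0 ≤ expCons R P w (t + 1) (R.len (t + 1)) := by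
  obtain ⟨hx, hxm⟩ := h.nodeL2 (t := t + 1) (by omega) le_rfl
  exact integral_mono (hx.integrable_consE R.W hx) (hx.integrable_consE R.W hxm)
    fun ω => h.setting.consE_restart _ _

theorem expAvg_restart (h : AdmissibleRun R f μ L lam ρ σ xs P w) (t : ℕ) :
    expAvg R f xs P w (t + 2) 0 ≤ 2 * expAvg R f xs P w (t + 1) (R.len (t + 1)) := by
  obtain ⟨hx, hxm⟩ := h.nodeL2 (t := t + 1) (by omega) le_rfl
  have i1 := h.setting.integrable_avgV (R.stepsize (t + 1)) hx.nodeAvg hxm.nodeAvg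
  unfold expAvg
  rw [h.mu_eq, ← integral_const_mul]
  exact integral_mono (h.setting.integrable_avgV (R.stepsize (t + 2)) hx.nodeAvg hx.nodeAvg)
    (i1.const_mul 2) fun ω => h.setting.avgV_restart _ _ _ _

theorem expPen_first : expPen R f xs P w 1 0
    = penV R.W f R.μ xs (R.stepsize 1) R.init R.init := by
  have : ∀ ω, curPt R w 1 0 ω = R.init ∧ prevPt R w 1 0 ω = R.init := fun ω => ⟨rfl, rfl⟩
  simp [expPen, this]

theorem expCons_first : expCons R P w 1 0 = consE R.W R.init R.init := by
  have : ∀ ω, curPt R w 1 0 ω = R.init ∧ prevPt R w 1 0 ω = R.init := fun ω => ⟨rfl, rfl⟩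
  simp [expCons, this]

theorem expAvg_first : expAvg R f xs P w 1 0
    = avgV f R.μ xs (R.stepsize 1) (nodeAvg R.init) (nodeAvg R.init) := by
  have : ∀ ω, curPt R w 1 0 ω = R.init ∧ prevPt R w 1 0 ω = R.init := fun ω => ⟨rfl, rfl⟩
  simp [expAvg, this]

theorem expCons_nonneg (h : AdmissibleRun R f μ L lam ρ σ xs P w) (t m : ℕ) :
    0 ≤ expCons R P w t m :=
  integral_nonneg fun _ => h.setting.consE_nonneg _ _

theorem expAvg_nonneg (h : AdmissibleRun R f μ L lam ρ σ xs P w) (t m : ℕ) :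
    0 ≤ expAvg R f xs P w t m := by
  rw [expAvg, h.mu_eq]
  exact integral_nonneg fun _ => h.setting.avgV_nonneg _ _ _

theorem lintegral_nodeAvg_le (h : AdmissibleRun R f μ L lam ρ σ xs P w) {t m : ℕ} (ht : 1 ≤ t)
    (hm : m ≤ R.len t) :
    ∫⁻ ω, ‖nodeAvg (curPt R w t m ω) - xs‖ₑ ^ 2 ∂P
      ≤ ENNReal.ofReal (2 / μ * expAvg R f xs P w t m) := by
  obtain ⟨hx, hxm⟩ := h.nodeL2 ht hm
  have hμ := h.setting.mu_pos
  have i1 := h.setting.integrable_avgV (R.stepsize t) hx.nodeAvg hxm.nodeAvg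
  rw [expAvg, h.mu_eq, ← integral_const_mul, ofReal_integral_eq_lintegral_ofReal (i1.const_mul _)
    (Filter.Eventually.of_forall fun ω => mul_nonneg (by positivity) (h.setting.avgV_nonneg _ _ _))]
  refine lintegral_mono fun ω => ?_
  rw [← ofReal_norm, ← ENNReal.ofReal_pow (norm_nonneg _)]
  refine ENNReal.ofReal_le_ofReal ?_
  have := h.setting.avgV_lower (R.stepsize t) (nodeAvg (curPt R w t m ω))
    (nodeAvg (prevPt R w t m ω))
  rw [div_mul_eq_mul_div, le_div_iff₀ hμ]
  have : 0 ≤ μ / 2 * ‖auxPt (√(μ * R.stepsize t)) (nodeAvg (curPt R w t m ω))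
    (nodeAvg (prevPt R w t m ω)) - xs‖ ^ 2 := by positivity
  linarith

/-- A node error splits into its deviation, controlled by `consE`, and the error of the average,
controlled by `avgV`. Squaring the sum costs a factor 2. -/
theorem lintegral_node_le (h : AdmissibleRun R f μ L lam ρ σ xs P w) {t m : ℕ} (ht : 1 ≤ t)
    (hm : m ≤ R.len t) (i : Fin N) :
    ∫⁻ ω, ‖curPt R w t m ω i - xs‖ₑ ^ 2 ∂P
      ≤ ENNReal.ofReal (4 / μ * expAvg R f xs P w t m + 2 * (1 - ρ)⁻¹ * expCons R P w t m) := by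
  obtain ⟨hx, hxm⟩ := h.nodeL2 ht hm
  have hμ := h.setting.mu_pos
  have hρ : 0 < 1 - ρ := by linarith [h.setting.rho_lt]
  have i1 := h.setting.integrable_avgV (R.stepsize t) hx.nodeAvg hxm.nodeAvg
  have i2 := hx.integrable_consE R.W hxm
  have hn1 := fun ω => h.setting.avgV_nonneg (R.stepsize t) (nodeAvg (curPt R w t m ω))
    (nodeAvg (prevPt R w t m ω))
  have hn2 := fun ω => h.setting.consE_nonneg (curPt R w t m ω) (prevPt R w t m ω)
  rw [expAvg, expCons, h.mu_eq, ← integral_const_mul, ← integral_const_mul,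
    ← integral_add (i1.const_mul _) (i2.const_mul _)]
  erw [ofReal_integral_eq_lintegral_ofReal ((i1.const_mul _).add (i2.const_mul _))
    (Filter.Eventually.of_forall fun ω =>
      add_nonneg (mul_nonneg (by positivity : 0 ≤ 4 / μ) (hn1 ω))
        (mul_nonneg (by positivity : 0 ≤ 2 * (1 - ρ)⁻¹) (hn2 ω)))]
  refine lintegral_mono fun ω => ?_
  rw [← ofReal_norm, ← ENNReal.ofReal_pow (norm_nonneg _)]
  refine ENNReal.ofReal_le_ofReal ?_
  have a1 := h.setting.avgV_lower (R.stepsize t) (nodeAvg (curPt R w t m ω))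
    (nodeAvg (prevPt R w t m ω))
  have a2 : ‖nodeAvg (curPt R w t m ω) - xs‖ ^ 2
      ≤ 2 / μ * avgV f μ xs (R.stepsize t) (nodeAvg (curPt R w t m ω))
        (nodeAvg (prevPt R w t m ω)) := by
    rw [div_mul_eq_mul_div, le_div_iff₀ hμ]
    have : 0 ≤ μ / 2 * ‖auxPt (√(μ * R.stepsize t)) (nodeAvg (curPt R w t m ω))
      (nodeAvg (prevPt R w t m ω)) - xs‖ ^ 2 := by positivity
    linarith
  have a3 := h.setting.sum_dev_sq_le (curPt R w t m ω) (prevPt R w t m ω)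
  have a4 : ‖dev (curPt R w t m ω) i‖ ^ 2 ≤ ∑ j, ‖dev (curPt R w t m ω) j‖ ^ 2 :=
    Finset.single_le_sum (f := fun j => ‖dev (curPt R w t m ω) j‖ ^ 2)
      (fun j _ => by positivity) (Finset.mem_univ i)
  have a5 := norm_add_sq_le_two (dev (curPt R w t m ω) i) (nodeAvg (curPt R w t m ω) - xs)
  have a6 : dev (curPt R w t m ω) i + (nodeAvg (curPt R w t m ω) - xs)
      = curPt R w t m ω i - xs := by simp [dev]
  rw [a6] at a5
  simp only [Pi.add_apply]
  have a7 : 4 / μ = 2 * (2 / μ) := by ring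
  rw [a7]
  linarith

end AdmissibleRun

end Expected


/-! ### Scalar recursions. -/

theorem geom_recursion_bound {s : ℕ → ℝ} {n : ℕ} {r b : ℝ} (hr : 0 < r) (hr1 : r ≤ 1)
    (h : ∀ m < n, s (m + 1) ≤ (1 - r) * s m + b) {m : ℕ} (hm : m ≤ n) :
    s m ≤ (1 - r) ^ m * (s 0 - b / r) + b / r := by
  induction m with
  | zero => simp
  | succ m ih =>
    have h1 := mul_le_mul_of_nonneg_left (ih (by omega)) (by linarith : 0 ≤ 1 - r)
    have h2 := h m hm
    have h3 : (1 - r) * (b / r) + b = b / r := by field_simp; ring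
    rw [pow_succ]
    linarith

theorem geom_recursion_bound' {s : ℕ → ℝ} {n : ℕ} {r b : ℝ} (hr : 0 < r) (hr1 : r ≤ 1)
    (hb : 0 ≤ b) (h : ∀ m < n, s (m + 1) ≤ (1 - r) * s m + b) {m : ℕ} (hm : m ≤ n) :
    s m ≤ (1 - r) ^ m * s 0 + b / r := by
  have h1 := geom_recursion_bound hr hr1 h hm
  have h2 : 0 ≤ (1 - r) ^ m * (b / r) :=
    mul_nonneg (pow_nonneg (by linarith) _) (div_nonneg hb hr.le)
  linarith

theorem pow_one_sub_le_of_log {r : ℝ} {n j : ℕ} (hr1 : r ≤ 1) (h : j * Real.log 2 ≤ r * n) :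
    (1 - r) ^ n ≤ 1 / 2 ^ j := by
  have h1 : 1 - r ≤ Real.exp (-r) := by have := Real.add_one_le_exp (-r); linarith
  refine (pow_le_pow_left₀ (by linarith) h1 n).trans ?_
  rw [← Real.exp_nat_mul]
  refine (Real.exp_le_exp.2 (by linarith : (n : ℝ) * -r ≤ -(j * Real.log 2))).trans (le_of_eq ?_)
  rw [Real.exp_neg, Real.exp_nat_mul, Real.exp_log (by norm_num), one_div]

/-- The order of quantifiers is the point: Q is chosen before the sequence, hence independent of the
run. All sequences are dominated by the extremal one, Y, whose multiplier drops below 1/2 after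
finitely many indices. -/
theorem exists_bound_of_contraction {θ : ℝ} (h0 : 0 ≤ θ) (h1 : θ < 1) (B X₁ : ℝ) :
    ∃ Q : ℝ, 0 ≤ Q ∧ ∀ X : ℕ → ℝ, X 0 ≤ X₁ →
      (∀ t, X (t + 1) ≤ 256 * θ ^ (t + 2) * X t + B) → ∀ t, X t ≤ Q := by
  obtain ⟨Y, hY0, hY1⟩ : ∃ Y : ℕ → ℝ, Y 0 = max X₁ 0 ∧
      ∀ t, Y (t + 1) = 256 * θ ^ (t + 2) * Y t + max B 0 :=
    ⟨fun t => Nat.rec (max X₁ 0) (fun t y => 256 * θ ^ (t + 2) * y + max B 0) t, rfl, fun _ => rfl⟩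
  have hpos : ∀ t, 0 ≤ Y t := by
    intro t
    induction t with
    | zero => rw [hY0]; exact le_max_right _ _
    | succ t ih => rw [hY1]; exact add_nonneg (by positivity) (le_max_right _ _)
  obtain ⟨T, hT⟩ := exists_pow_lt_of_lt_one (by norm_num : (0 : ℝ) < 1 / 512) h1
  have hsum : ∀ t ≤ T, Y t ≤ ∑ s ∈ Finset.range (T + 1), Y s := fun t ht =>
    Finset.single_le_sum (fun s _ => hpos s) (Finset.mem_range.2 (by omega))
  set Q := ∑ s ∈ Finset.range (T + 1), Y s + 2 * max B 0 with hQ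
  have hB : 0 ≤ max B 0 := le_max_right _ _
  have hQ0 : 0 ≤ Q := add_nonneg (Finset.sum_nonneg fun s _ => hpos s) (by positivity)
  have hYQ : ∀ t, Y t ≤ Q := by
    intro t
    induction t with
    | zero => have := hsum 0 (Nat.zero_le _); linarith
    -- Up to T the partial sum dominates Y. Afterwards the factor is at most 1/2, and Q/2 + max B 0
    -- ≤ Q.
    | succ t ih =>
      by_cases ht : t + 1 ≤ T
      · have := hsum _ ht; linarith
      · have h2 : θ ^ (t + 2) ≤ θ ^ T := pow_le_pow_of_le_one h0 h1.le (by omega)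
        have h3 : 256 * θ ^ (t + 2) ≤ 1 / 2 := by linarith
        have h4 := mul_le_mul_of_nonneg_right h3 (hpos t)
        have h5 : 0 ≤ ∑ s ∈ Finset.range (T + 1), Y s := Finset.sum_nonneg fun s _ => hpos s
        rw [hY1]
        linarith
  refine ⟨Q, hQ0, fun X hX0 hX t => ?_⟩
  suffices X t ≤ Y t from this.trans (hYQ t)
  induction t with
  | zero => rw [hY0]; exact hX0.trans (le_max_left _ _)
  | succ t ih =>
    rw [hY1]
    have := mul_le_mul_of_nonneg_left ih (by positivity : 0 ≤ 256 * θ ^ (t + 2))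
    have := hX t
    have := le_max_left B 0
    linarith

/-- The properties of the stepsizes `α` and stage lengths `n` used in the error analysis. -/
structure Schedule (μ : ℝ) (α : ℕ → ℝ) (n : ℕ → ℕ) : Prop where
  ratio_le : ∀ t, α (t + 1) ≤ 16 * α (t + 2)
  ratio_eq : ∀ t, α (t + 2) = 4 * α (t + 3)
  le_len : ∀ t, t + 2 ≤ n (t + 2)
  log_le : ∀ t, 7 * Real.log 2 ≤ √(μ * α (t + 2)) * n (t + 2)

/-! ### Propagation through the stages. -/

namespace AdmissibleRun

variable {Ω S : Type*} [MeasurableSpace Ω] [MeasurableSpace S] {N d : ℕ}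
  {R : Run N d S} {f : Fin N → E d → ℝ} {μ L lam ρ σ : ℝ} {xs : E d} {P : Measure Ω}
  [IsProbabilityMeasure P] {w : Fin N → ℕ → Ω → S}

/-- Noise of size α per step against a contraction rate √(μα) leaves a floor proportional to √(μα),
and this is what becomes 1/k. -/
theorem step_div_rate (h : AdmissibleRun R f μ L lam ρ σ xs P w) (t : ℕ) (c : ℝ) :
    R.stepsize t * c / √(μ * R.stepsize t) = √(μ * R.stepsize t) * c / μ := by
  have h1 := h.setting.rate_pos (h.step_pos t)
  have h2 := h.setting.rate_sq (h.step_pos t)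
  have h3 := h.setting.mu_pos
  rw [div_eq_div_iff h1.ne' h3.ne']
  linear_combination -c * h2

theorem expPen_stage (h : AdmissibleRun R f μ L lam ρ σ xs P w) {t m : ℕ} (ht : 1 ≤ t)
    (hm : m ≤ R.len t) : expPen R f xs P w t m
      ≤ (1 - √(μ * R.stepsize t)) ^ m * expPen R f xs P w t 0 + N * σ ^ 2 / μ := by
  have h1 := h.setting.rate_pos (h.step_pos t)
  have h2 := h.setting.rate_le_one (h.step_pos t) (h.step_le t)
  have h3 := h.setting.mu_pos
  have h4 := h.step_pos t
  refine (geom_recursion_bound' h1 h2 (by positivity) (fun m hm => h.expPen_succ_le ht hm) hm).trans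
    (add_le_add le_rfl ?_)
  rw [h.step_div_rate]
  refine div_le_div_of_nonneg_right ?_ h3.le
  exact mul_le_of_le_one_left (by positivity) h2

/-- At stage ends I + 2c is invariant: the restart factor 18 times the stage contraction 2⁻⁷ is less
than 1/2. Inside a stage at most the factor 18 is lost. The bound does not involve the stage
lengths. -/
theorem expPen_bound (h : AdmissibleRun R f μ L lam ρ σ xs P w)
    (hs : Schedule μ R.stepsize R.len) {I c : ℝ} (hI : 0 ≤ I)
    (hI1 : penV R.W f μ xs (R.stepsize 1) R.init R.init ≤ I)
    (hc : c = penC f μ xs + N * σ ^ 2 / μ) (t : ℕ) {m : ℕ} (hm : m ≤ R.len (t + 1)) :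
    expPen R f xs P w (t + 1) m + penC f μ xs ≤ 18 * (I + 2 * c) + c := by
  have hμ := h.setting.mu_pos
  have hC := h.setting.penC_nonneg
  have hσ : 0 ≤ N * σ ^ 2 / μ := by positivity
  have hpow : ∀ t m, 0 ≤ (1 - √(μ * R.stepsize t)) ^ m ∧ (1 - √(μ * R.stepsize t)) ^ m ≤ 1 := by
    intro t m
    have h1 := h.setting.rate_pos (h.step_pos t)
    have h2 := h.setting.rate_le_one (h.step_pos t) (h.step_le t)
    exact ⟨pow_nonneg (by linarith) _, pow_le_one₀ (by linarith) (by linarith)⟩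
  have first : ∀ m ≤ R.len 1, expPen R f xs P w 1 m + penC f μ xs ≤ I + c := by
    intro m hm
    have h1 := h.expPen_stage le_rfl hm
    rw [expPen_first, h.mu_eq] at h1
    have h2 := mul_le_mul_of_nonneg_left hI1 (hpow 1 m).1
    have h3 := mul_le_of_le_one_left hI (hpow 1 m).2
    linarith
  have fin : ∀ t, expPen R f xs P w (t + 1) (R.len (t + 1)) + penC f μ xs ≤ I + 2 * c := by
    intro t
    induction t with
    | zero => have := first _ le_rfl; simp only [zero_add]; linarith
    | succ t ih =>
      have h1 := h.expPen_stage (t := t + 2) (by omega) le_rfl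
      have h2 := (h.expPen_restart t (hs.ratio_le t)).trans
        (mul_le_mul_of_nonneg_left ih (by norm_num))
      have h3 := pow_one_sub_le_of_log (r := √(μ * R.stepsize (t + 2))) (j := 7)
        (h.setting.rate_le_one (h.step_pos _) (h.step_le _)) (by exact_mod_cast hs.log_le t)
      have h4 := mul_le_mul_of_nonneg_left h2 (hpow (t + 2) (R.len (t + 2))).1
      have h5 := mul_le_mul_of_nonneg_right h3 (by linarith : 0 ≤ 18 * (I + 2 * c))
      norm_num at h5
      linarith
  rcases t with _ | t
  · have := first m hm; simp only [zero_add]; linarith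
  · have h1 := h.expPen_stage (t := t + 2) (by omega) hm
    have h2 := (h.expPen_restart t (hs.ratio_le t)).trans
      (mul_le_mul_of_nonneg_left (fin t) (by norm_num))
    have h4 := mul_le_mul_of_nonneg_left h2 (hpow (t + 2) m).1
    have h5 := mul_le_of_le_one_left (by linarith : 0 ≤ 18 * (I + 2 * c)) (hpow (t + 2) m).2
    change expPen R f xs P w (t + 2) m + _ ≤ _
    linarith

theorem expCons_stage (h : AdmissibleRun R f μ L lam ρ σ xs P w) {M : ℝ}
    (hM : ∀ t, ∀ m ≤ R.len (t + 1), expPen R f xs P w (t + 1) m + penC f μ xs ≤ M) {B : ℝ}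
    (hB : B = 2 / (1 - ρ) * (16 * L ^ 2 / μ * M + 4 * μ * penC f μ xs + 2 * (N * σ ^ 2)))
    (hM0 : 0 ≤ M) (t : ℕ) {m : ℕ} (hm : m ≤ R.len (t + 1)) :
    expCons R P w (t + 1) m ≤ ((1 + ρ) / 2) ^ m * expCons R P w (t + 1) 0
      + B * (2 / (1 - ρ)) * R.stepsize (t + 1) ^ 2 := by
  have hρ : 0 < 1 - ρ := by linarith [h.setting.rho_lt]
  have hρ0 := h.setting.rho_pos
  have hμ := h.setting.mu_pos
  have hC := h.setting.penC_nonneg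
  have hB0 : 0 ≤ B := by rw [hB]; positivity
  have key := geom_recursion_bound' (s := expCons R P w (t + 1)) (n := R.len (t + 1))
    (r := (1 - ρ) / 2) (b := B * R.stepsize (t + 1) ^ 2) (by linarith) (by linarith)
    (by positivity) (fun m hm => ?_) hm
  · have e1 : 1 - (1 - ρ) / 2 = (1 + ρ) / 2 := by ring
    rw [e1] at key
    refine key.trans (le_of_eq ?_)
    field_simp
  · have h1 := h.expCons_succ_le (t := t + 1) (by omega) hm
    have h2 := mul_le_mul_of_nonneg_left (hM t m hm.le) (by positivity : 0 ≤ 16 * L ^ 2 / μ)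
    have h3 : 2 / (1 - ρ) * R.stepsize (t + 1) ^ 2 *
        (16 * L ^ 2 / μ * (expPen R f xs P w (t + 1) m + penC f μ xs) + 4 * μ * penC f μ xs
        + 2 * (N * σ ^ 2)) ≤ B * R.stepsize (t + 1) ^ 2 := by
      have : B * R.stepsize (t + 1) ^ 2 = 2 / (1 - ρ) * R.stepsize (t + 1) ^ 2 *
        (16 * L ^ 2 / μ * M + 4 * μ * penC f μ xs + 2 * (N * σ ^ 2)) := by rw [hB]; ring
      rw [this]
      exact mul_le_mul_of_nonneg_left (by linarith) (by positivity)
    have e1 : 1 - (1 - ρ) / 2 = (1 + ρ) / 2 := by ring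
    rw [e1]
    linarith

theorem expAvg_stage (h : AdmissibleRun R f μ L lam ρ σ xs P w) {Q : ℝ} (hQ : 0 ≤ Q) (t : ℕ)
    (hcons : ∀ m ≤ R.len (t + 1), expCons R P w (t + 1) m ≤ Q * R.stepsize (t + 1) ^ 2) {Kc : ℝ}
    (hKc : Kc = (9 / μ + 8 * L ^ 2 / μ ^ 3) * (L ^ 2 / N * (2 * ((1 - ρ)⁻¹ + lam⁻¹))))
    {m : ℕ} (hm : m ≤ R.len (t + 1)) :
    expAvg R f xs P w (t + 1) m
      ≤ (1 - 7 / 8 * √(μ * R.stepsize (t + 1))) ^ m * expAvg R f xs P w (t + 1) 0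
        + 2 * (√(μ * R.stepsize (t + 1)) * (σ ^ 2 / N) / μ + Kc * Q * R.stepsize (t + 1) ^ 2) := by
  have h1 := h.setting.rate_pos (h.step_pos (t + 1))
  have h2 := h.setting.rate_le_one (h.step_pos (t + 1)) (h.step_le (t + 1))
  have hμ := h.setting.mu_pos
  have hl := h.setting.lam_pos
  have hρ : 0 < 1 - ρ := by linarith [h.setting.rho_lt]
  have hKc0 : 0 ≤ Kc := by rw [hKc]; positivity
  have hα := h.step_pos (t + 1)
  set q := √(μ * R.stepsize (t + 1)) with hq
  have e1 : R.stepsize (t + 1) * (σ ^ 2 / N) = q * (q * (σ ^ 2 / N) / μ) := by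
    rw [hq, ← h.step_div_rate, ← hq]; field_simp
  set v := q * (σ ^ 2 / N) / μ with hv
  have hv0 : 0 ≤ v := by positivity
  set e := Kc * Q * R.stepsize (t + 1) ^ 2 with he
  have he0 : 0 ≤ e := by positivity
  have key := geom_recursion_bound' (s := expAvg R f xs P w (t + 1)) (n := R.len (t + 1))
    (r := 7 / 8 * q) (b := q * (v + e)) (by linarith) (by linarith)
    (by positivity) (fun m hm => ?_) hm
  · refine key.trans (add_le_add le_rfl ?_)
    have : q * (v + e) / (7 / 8 * q) = 8 / 7 * (v + e) := by field_simp
    rw [this]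
    linarith
  · have k1 := h.expAvg_succ_le (t := t + 1) (by omega) hm
    rw [← hKc, e1] at k1
    have k2 := mul_le_mul_of_nonneg_left (hcons m hm.le) (by positivity : 0 ≤ q * Kc)
    have k3 : q * Kc * (Q * R.stepsize (t + 1) ^ 2) = q * e := by rw [he]; ring
    linarith

/-- The disagreement energy at stage ends is divided by α². Passing to the next stage multiplies
this ratio by at most 256 (the square of 16), against a contraction of θ^{k_t} ≤ θ^t with θ = (1 +
ρ)/2. -/
theorem expCons_bound (h : AdmissibleRun R f μ L lam ρ σ xs P w)
    (hs : Schedule μ R.stepsize R.len) {M : ℝ}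
    (hM : ∀ t, ∀ m ≤ R.len (t + 1), expPen R f xs P w (t + 1) m + penC f μ xs ≤ M) {B B' : ℝ}
    (hB : B = 2 / (1 - ρ) * (16 * L ^ 2 / μ * M + 4 * μ * penC f μ xs + 2 * (N * σ ^ 2)))
    (hB' : B' = B * (2 / (1 - ρ))) (hM0 : 0 ≤ M) {X₁ Q : ℝ}
    (hX₁ : X₁ = consE R.W R.init R.init / R.stepsize 1 ^ 2 + B') (hQ0 : 0 ≤ Q)
    (hQ : ∀ X : ℕ → ℝ, X 0 ≤ X₁ →
      (∀ t, X (t + 1) ≤ 256 * ((1 + ρ) / 2) ^ (t + 2) * X t + B') → ∀ t, X t ≤ Q) (t : ℕ) {m : ℕ}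
    (hm : m ≤ R.len (t + 1)) :
    expCons R P w (t + 1) m ≤ (256 * Q + B' + X₁) * R.stepsize (t + 1) ^ 2 := by
  have hρ : 0 < 1 - ρ := by linarith [h.setting.rho_lt]
  have hρ0 := h.setting.rho_pos
  have hμ := h.setting.mu_pos
  have hC := h.setting.penC_nonneg
  have hB0 : 0 ≤ B := by rw [hB]; positivity
  have hB'0 : 0 ≤ B' := by rw [hB']; positivity
  have hα := h.step_pos
  have hX₁0 : 0 ≤ X₁ := by
    rw [hX₁]; exact add_nonneg (div_nonneg (h.setting.consE_nonneg _ _) (by positivity)) hB'0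
  have hθ0 : 0 ≤ (1 + ρ) / 2 := by linarith
  have hθ1 : (1 + ρ) / 2 ≤ 1 := by linarith
  have st := fun t m (hm : m ≤ R.len (t + 1)) => h.expCons_stage hM hB hM0 t hm
  rw [← hB'] at st
  have sq : ∀ t, R.stepsize (t + 1) ^ 2 ≤ 256 * R.stepsize (t + 2) ^ 2 := by
    intro t
    have := pow_le_pow_left₀ (hα (t + 1)).le (hs.ratio_le t) 2
    rw [mul_pow] at this
    norm_num at this
    exact this
  have first : ∀ m ≤ R.len 1, expCons R P w 1 m ≤ X₁ * R.stepsize 1 ^ 2 := by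
    intro m hm
    have h1 := st 0 m hm
    simp only [zero_add] at h1
    have h2 := mul_le_of_le_one_left (h.expCons_nonneg 1 0) (pow_le_one₀ hθ0 hθ1 (n := m))
    have h3 : X₁ * R.stepsize 1 ^ 2 = expCons R P w 1 0 + B' * R.stepsize 1 ^ 2 := by
      rw [hX₁, expCons_first, add_mul, div_mul_cancel₀ _ (pow_ne_zero 2 (hα 1).ne')]
    linarith
  have fin : ∀ t, expCons R P w (t + 1) (R.len (t + 1)) ≤ Q * R.stepsize (t + 1) ^ 2 := by
    intro t
    have h1 := hQ (fun t => expCons R P w (t + 1) (R.len (t + 1)) / R.stepsize (t + 1) ^ 2) ?_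
      (fun t => ?_) t
    · rwa [div_le_iff₀ (pow_pos (hα _) 2)] at h1
    · simp only [zero_add]
      rw [div_le_iff₀ (pow_pos (hα _) 2)]
      exact first _ le_rfl
    · have k1 := st (t + 1) _ le_rfl
      have k2 := h.expCons_restart t
      have k3 := pow_le_pow_of_le_one hθ0 hθ1 (hs.le_len t)
      have k4 := h.expCons_nonneg (t + 1) (R.len (t + 1))
      have k5 : ((1 + ρ) / 2) ^ R.len (t + 2) * expCons R P w (t + 2) 0
          ≤ ((1 + ρ) / 2) ^ (t + 2) * expCons R P w (t + 1) (R.len (t + 1)) :=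
        mul_le_mul k3 k2 (h.expCons_nonneg _ _) (by positivity)
      rw [div_le_iff₀ (pow_pos (hα _) 2), add_mul]
      refine k1.trans (add_le_add (k5.trans ?_) le_rfl)
      set x := expCons R P w (t + 1) (R.len (t + 1))
      have k6 : x = x / R.stepsize (t + 1) ^ 2 * R.stepsize (t + 1) ^ 2 := by
        rw [div_mul_cancel₀ _ (pow_ne_zero 2 (hα _).ne')]
      have k7 : x ≤ x / R.stepsize (t + 1) ^ 2 * (256 * R.stepsize (t + 2) ^ 2) := by
        nth_rewrite 1 [k6]
        exact mul_le_mul_of_nonneg_left (sq t) (by positivity)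
      have k8 := mul_le_mul_of_nonneg_left k7 (by positivity : 0 ≤ ((1 + ρ) / 2) ^ (t + 2))
      refine k8.trans (le_of_eq (by ring))
  rcases t with _ | t
  · have h1 := first m hm
    have h2 : 0 ≤ (256 * Q + B') * R.stepsize 1 ^ 2 := by positivity
    simp only [zero_add]
    linarith
  · have h1 := st (t + 1) m hm
    have h2 := h.expCons_restart t
    have h3 := fin t
    have h4 := mul_le_mul_of_nonneg_left (sq t) hQ0
    have h5 := mul_le_of_le_one_left (h.expCons_nonneg (t + 2) 0) (pow_le_one₀ hθ0 hθ1 (n := m))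
    have h6 : 0 ≤ X₁ * R.stepsize (t + 2) ^ 2 := by positivity
    change expCons R P w (t + 2) m ≤ _ * R.stepsize (t + 2) ^ 2
    change expCons R P w (t + 2) m ≤ _ * expCons R P w (t + 2) 0 + _ * R.stepsize (t + 2) ^ 2 at h1
    linarith

/-- At stage ends the bound 4v + bα² reproduces itself. The factor 2 of the restart and the
contraction 1/64 give 1/32, while v shrinks by 2 and α² by 16 from one stage to the next. The whole
first stage enters only through b₀, which is absorbed in b. -/
theorem expAvg_bound (h : AdmissibleRun R f μ L lam ρ σ xs P w)
    (hs : Schedule μ R.stepsize R.len) {Q : ℝ} (hQ : 0 ≤ Q)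
    (hcons : ∀ t, ∀ m ≤ R.len (t + 1), expCons R P w (t + 1) m ≤ Q * R.stepsize (t + 1) ^ 2)
    {Kc : ℝ}
    (hKc : Kc = (9 / μ + 8 * L ^ 2 / μ ^ 3) * (L ^ 2 / N * (2 * ((1 - ρ)⁻¹ + lam⁻¹)))) {b₀ b : ℝ}
    (hb₀ : b₀ = avgV f μ xs (R.stepsize 1) (nodeAvg R.init) (nodeAvg R.init)
      + 2 * (√(μ * R.stepsize 1) * (σ ^ 2 / N) / μ + Kc * Q * R.stepsize 1 ^ 2))
    (hb : b = b₀ / R.stepsize 2 ^ 2 + 4 * (Kc * Q)) (t : ℕ) {m : ℕ} (hm : m ≤ R.len (t + 2)) :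
    expAvg R f xs P w (t + 2) m ≤ 18 * (√(μ * R.stepsize (t + 2)) * (σ ^ 2 / N) / μ)
      + 33 * b * R.stepsize (t + 2) ^ 2 := by
  have hμ := h.setting.mu_pos
  have hl := h.setting.lam_pos
  have hρ : 0 < 1 - ρ := by linarith [h.setting.rho_lt]
  have hKc0 : 0 ≤ Kc := by rw [hKc]; positivity
  have hα := h.step_pos
  have st := fun t m (hm : m ≤ R.len (t + 1)) => h.expAvg_stage hQ t (hcons t) hKc hm
  set v : ℕ → ℝ := fun t => √(μ * R.stepsize t) * (σ ^ 2 / N) / μ with hv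
  set e : ℕ → ℝ := fun t => Kc * Q * R.stepsize t ^ 2 with he
  have hv0 : ∀ t, 0 ≤ v t := fun t => by simp only [hv]; positivity
  have he0 : ∀ t, 0 ≤ e t := fun t => by simp only [he]; positivity
  have hb₀0 : 0 ≤ b₀ := by
    rw [hb₀]
    exact add_nonneg (h.setting.avgV_nonneg _ _ _) (by have := hv0 1; have := he0 1; positivity)
  have hbe : 4 * (Kc * Q) ≤ b := by
    rw [hb]; have : 0 ≤ b₀ / R.stepsize 2 ^ 2 := by positivity
    linarith
  have hb0 : 0 ≤ b := le_trans (by positivity) hbe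
  have heb : ∀ t, 4 * e t ≤ b * R.stepsize t ^ 2 := fun t => by
    have := mul_le_mul_of_nonneg_right hbe (sq_nonneg (R.stepsize t))
    simp only [he]; linarith
  have hv2 : ∀ t, v (t + 2) = 2 * v (t + 3) := by
    intro t
    simp only [hv]
    have : μ * R.stepsize (t + 2) = 2 ^ 2 * (μ * R.stepsize (t + 3)) := by
      rw [hs.ratio_eq t]; ring
    rw [this, Real.sqrt_mul (by norm_num), Real.sqrt_sq (by norm_num)]
    ring
  have hα2 : ∀ t, R.stepsize (t + 2) ^ 2 = 16 * R.stepsize (t + 3) ^ 2 := by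
    intro t; rw [hs.ratio_eq t]; ring
  have hpow : ∀ t m, 0 ≤ (1 - 7 / 8 * √(μ * R.stepsize t)) ^ m ∧
      (1 - 7 / 8 * √(μ * R.stepsize t)) ^ m ≤ 1 := by
    intro t m
    have h1 := h.setting.rate_pos (h.step_pos t)
    have h2 := h.setting.rate_le_one (h.step_pos t) (h.step_le t)
    exact ⟨pow_nonneg (by linarith) _, pow_le_one₀ (by linarith) (by linarith)⟩
  have hpow' : ∀ t, (1 - 7 / 8 * √(μ * R.stepsize (t + 2))) ^ R.len (t + 2) ≤ 1 / 64 := by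
    intro t
    have h1 := h.setting.rate_le_one (h.step_pos (t + 2)) (h.step_le (t + 2))
    have h2 := h.setting.rate_pos (h.step_pos (t + 2))
    have h3 := hs.log_le t
    have h4 : 0 < Real.log 2 := Real.log_pos (by norm_num)
    -- The reduced rate still gives 6 halvings, since 7 · 7/8 ≥ 6.
    have := pow_one_sub_le_of_log (r := 7 / 8 * √(μ * R.stepsize (t + 2))) (n := R.len (t + 2))
      (j := 6) (by linarith) (by push_cast; linarith)
    norm_num at this ⊢
    exact this
  have first : expAvg R f xs P w 1 (R.len 1) ≤ b₀ := by
    have h1 := st 0 _ le_rfl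
    simp only [zero_add] at h1
    have h2 := mul_le_of_le_one_left (h.expAvg_nonneg 1 0) (hpow 1 (R.len 1)).2
    have h3 : expAvg R f xs P w 1 0
      = avgV f μ xs (R.stepsize 1) (nodeAvg R.init) (nodeAvg R.init) := by
      rw [expAvg_first, h.mu_eq]
    rw [hb₀]
    linarith
  have hb₀b : b₀ + 4 * e 2 = b * R.stepsize 2 ^ 2 := by
    rw [hb, add_mul, div_mul_cancel₀ _ (pow_ne_zero 2 (hα 2).ne')]
    simp only [he]; ring
  have fin : ∀ t, expAvg R f xs P w (t + 2) (R.len (t + 2))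
      ≤ 4 * v (t + 2) + b * R.stepsize (t + 2) ^ 2 := by
    intro t
    have gen : ∀ t y, expAvg R f xs P w (t + 1) (R.len (t + 1)) ≤ y →
        expAvg R f xs P w (t + 2) (R.len (t + 2)) ≤ y / 32 + 2 * (v (t + 2) + e (t + 2)) := by
      intro t y hy
      have k1 := st (t + 1) _ le_rfl
      have k2 := (h.expAvg_restart t).trans (mul_le_mul_of_nonneg_left hy (by norm_num))
      have k3 := mul_le_mul (hpow' t) k2 (h.expAvg_nonneg _ _) (by norm_num)
      refine k1.trans (add_le_add (k3.trans (le_of_eq (by ring))) le_rfl)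
    induction t with
    | zero =>
      have k1 := gen 0 b₀ first
      have k2 := hv0 2
      have k3 := he0 2
      simp only [zero_add] at k1 ⊢
      linarith
    | succ t ih =>
      have k1 := gen (t + 1) _ ih
      rw [hv2, hα2] at k1
      have k2 := hv0 (t + 3)
      have k3 := heb (t + 3)
      change expAvg R f xs P w (t + 3) (R.len (t + 3)) ≤
        (4 * (2 * v (t + 3)) + b * (16 * R.stepsize (t + 3) ^ 2)) / 32
          + 2 * (v (t + 3) + e (t + 3)) at k1
      change expAvg R f xs P w (t + 3) (R.len (t + 3)) ≤ 4 * v (t + 3) + b * R.stepsize (t + 3) ^ 2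
      linarith
  have gen : ∀ t y m, m ≤ R.len (t + 2) → expAvg R f xs P w (t + 1) (R.len (t + 1)) ≤ y →
      expAvg R f xs P w (t + 2) m ≤ 2 * y + 2 * (v (t + 2) + e (t + 2)) := by
    intro t y m hm hy
    have k1 := st (t + 1) m hm
    have k2 := (h.expAvg_restart t).trans (mul_le_mul_of_nonneg_left hy (by norm_num))
    have k3 := mul_le_of_le_one_left (h.expAvg_nonneg (t + 2) 0) (hpow (t + 2) m).2
    exact k1.trans (add_le_add (k3.trans k2) le_rfl)
  rcases t with _ | t
  · have k1 := gen 0 b₀ m hm first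
    have k2 := hv0 2
    have k3 := he0 2
    have k4 : 0 ≤ b * R.stepsize 2 ^ 2 := by positivity
    simp only [zero_add] at k1 ⊢
    linarith
  -- Expressed in the present stage, the previous end value is 8v + 16bα². Doubling it and adding 2v
  -- + 2e gives 18v + 33bα², because 4e ≤ bα².
  · have k1 := gen (t + 1) _ m hm (fin t)
    rw [hv2, hα2] at k1
    have k3 := heb (t + 3)
    have k4 := he0 (t + 3)
    change expAvg R f xs P w (t + 3) m ≤
        2 * (4 * (2 * v (t + 3)) + b * (16 * R.stepsize (t + 3) ^ 2))
          + 2 * (v (t + 3) + e (t + 3)) at k1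
    change expAvg R f xs P w (t + 3) m ≤ 18 * v (t + 3) + 33 * b * R.stepsize (t + 3) ^ 2
    linarith

end AdmissibleRun

/-- Error bounds for all stages from the second on, with a constant that depends only on the data
of the problem. -/
theorem Setting.exists_stage_bound {N d : ℕ} {W : Matrix (Fin N) (Fin N) ℝ}
    {f : Fin N → E d → ℝ} {μ L lam ρ : ℝ} {xs : E d} (h : Setting W f μ L lam ρ xs) (σ : ℝ)
    (x₀ : Fin N → E d) (α : ℕ → ℝ) (hα : ∀ t, 0 < α t) :
    ∃ Cd : ℝ, 0 < Cd ∧ ∀ (S : Type*) [MeasurableSpace S] (Ω : Type*) [MeasurableSpace Ω]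
      (P : Measure Ω) [IsProbabilityMeasure P] (w : Fin N → ℕ → Ω → S) (R : Run N d S),
      AdmissibleRun R f μ L lam ρ σ xs P w → R.W = W → R.init = x₀ → R.stepsize = α →
      Schedule μ R.stepsize R.len → ∀ t m, m ≤ R.len (t + 2) →
      expAvg R f xs P w (t + 2) m ≤ 18 * (√(μ * α (t + 2)) * (σ ^ 2 / N) / μ)
        + Cd * α (t + 2) ^ 2 ∧ expCons R P w (t + 2) m ≤ Cd * α (t + 2) ^ 2 := by
  have hρ : 0 < 1 - ρ := by linarith [h.rho_lt]
  have hρ0 := h.rho_pos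
  have hμ := h.mu_pos
  have hl := h.lam_pos
  have hC := h.penC_nonneg
  -- All constants are fixed here from the data and the stepsizes alone, before the run, and with it
  -- p, the stage lengths and the estimates, is introduced.
  obtain ⟨I, hI⟩ : ∃ I, I = max 0 (penV W f μ xs (α 1) x₀ x₀) := ⟨_, rfl⟩
  have hI0 : 0 ≤ I := hI ▸ le_max_left _ _
  obtain ⟨c, hc⟩ : ∃ c, c = penC f μ xs + N * σ ^ 2 / μ := ⟨_, rfl⟩
  have hc0 : 0 ≤ c := by rw [hc]; positivity
  obtain ⟨M, hM⟩ : ∃ M, M = 18 * (I + 2 * c) + c := ⟨_, rfl⟩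
  have hM0 : 0 ≤ M := by rw [hM]; positivity
  obtain ⟨B, hB⟩ : ∃ B, B = 2 / (1 - ρ) * (16 * L ^ 2 / μ * M + 4 * μ * penC f μ xs
    + 2 * (N * σ ^ 2)) := ⟨_, rfl⟩
  have hB0 : 0 ≤ B := by rw [hB]; positivity
  obtain ⟨B', hB'⟩ : ∃ B', B' = B * (2 / (1 - ρ)) := ⟨_, rfl⟩
  have hB'0 : 0 ≤ B' := by rw [hB']; positivity
  obtain ⟨X₁, hX₁⟩ : ∃ X₁, X₁ = consE W x₀ x₀ / α 1 ^ 2 + B' := ⟨_, rfl⟩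
  have hX₁0 : 0 ≤ X₁ := by
    rw [hX₁]; exact add_nonneg (div_nonneg (h.consE_nonneg _ _) (by positivity)) hB'0
  obtain ⟨Q, hQ0, hQ⟩ := exists_bound_of_contraction (θ := (1 + ρ) / 2) (by linarith)
    (by linarith) B' X₁
  obtain ⟨Q', hQ'⟩ : ∃ Q', Q' = 256 * Q + B' + X₁ := ⟨_, rfl⟩
  have hQ'0 : 0 ≤ Q' := by rw [hQ']; positivity
  obtain ⟨Kc, hKc⟩ : ∃ Kc, Kc = (9 / μ + 8 * L ^ 2 / μ ^ 3) *
    (L ^ 2 / N * (2 * ((1 - ρ)⁻¹ + lam⁻¹))) := ⟨_, rfl⟩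
  have hKc0 : 0 ≤ Kc := by rw [hKc]; positivity
  obtain ⟨b₀, hb₀⟩ : ∃ b₀, b₀ = avgV f μ xs (α 1) (nodeAvg x₀) (nodeAvg x₀)
      + 2 * (√(μ * α 1) * (σ ^ 2 / N) / μ + Kc * Q' * α 1 ^ 2) := ⟨_, rfl⟩
  have hb₀0 : 0 ≤ b₀ := by
    rw [hb₀]; exact add_nonneg (h.avgV_nonneg _ _ _) (by positivity)
  obtain ⟨b, hb⟩ : ∃ b, b = b₀ / α 2 ^ 2 + 4 * (Kc * Q') := ⟨_, rfl⟩
  have hb0 : 0 ≤ b := by rw [hb]; positivity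
  refine ⟨33 * b + Q' + 1, by positivity, ?_⟩
  intro S _ Ω _ P _ w R hR hRW hRx hRα hs t m hm
  subst hRW hRx hRα
  have hpen := fun t m hm => hR.expPen_bound hs hI0 (hI ▸ le_max_right _ _) hc t (m := m) hm
  rw [← hM] at hpen
  have hcons := fun t m hm => hR.expCons_bound hs hpen hB hB' hM0 hX₁ hQ0 hQ t (m := m) hm
  rw [← hQ'] at hcons
  have havg := hR.expAvg_bound hs hQ'0 hcons hKc hb₀ hb t hm
  have hcons' := hcons (t + 1) m hm
  have k1 : 0 ≤ (Q' + 1) * R.stepsize (t + 2) ^ 2 := by positivity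
  have k2 : 0 ≤ (33 * b + 1) * R.stepsize (t + 2) ^ 2 := by positivity
  refine ⟨by linarith, ?_⟩
  change expCons R P w (t + 2) m ≤ Q' * R.stepsize (t + 2) ^ 2 at hcons'
  linarith


/-! ### Spectrum of the weight matrix. -/

section Spectral

variable {N : ℕ} {G : SimpleGraph (Fin N)} {W : Matrix (Fin N) (Fin N) ℝ}

theorem IsMixingMatrix.apply_comm (hW : IsMixingMatrix G W) (i j : Fin N) : W i j = W j i := by
  have := hW.symm.apply j i
  simpa using this

theorem IsMixingMatrix.nonneg (hW : IsMixingMatrix G W) (i j : Fin N) : 0 ≤ W i j := by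
  by_cases h : i = j
  · subst h; exact (hW.diag_pos i).le
  · by_cases h' : G.Adj i j
    · exact (hW.pos_of_adj i j h').le
    · exact (hW.zero_of_not_adj i j h h').ge

/-- Unit row and column sums turn the form of I - W into a weighted sum of squared differences. This
gives W ≤ I and, along walks of the graph, identifies the equality case. -/
theorem IsMixingMatrix.dirichlet (hW : IsMixingMatrix G W) {H : Type*} [NormedAddCommGroup H]
    [InnerProductSpace ℝ H] (x : Fin N → H) :
    ∑ i, ‖x i‖ ^ 2 - ∑ i, ⟪x i, ∑ j, W i j • x j⟫
      = 1 / 2 * ∑ i, ∑ j, W i j * ‖x i - x j‖ ^ 2 := by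
  have e1 : ∀ i j, W i j * ‖x i - x j‖ ^ 2
      = W i j * ‖x i‖ ^ 2 - 2 * (W i j * ⟪x i, x j⟫) + W i j * ‖x j‖ ^ 2 := by
    intro i j; rw [norm_sub_sq_real]; ring
  have e2 : ∑ i, ∑ j, W i j * ‖x i‖ ^ 2 = ∑ i, ‖x i‖ ^ 2 := by
    refine Finset.sum_congr rfl fun i _ => ?_
    rw [← Finset.sum_mul, hW.row_sum, one_mul]
  have e3 : ∑ i, ∑ j, W i j * ‖x j‖ ^ 2 = ∑ i, ‖x i‖ ^ 2 := by
    rw [Finset.sum_comm, ← e2]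
    exact Finset.sum_congr rfl fun i _ => Finset.sum_congr rfl fun j _ => by
      rw [hW.apply_comm]
  simp only [e1, Finset.sum_add_distrib, Finset.sum_sub_distrib, ← Finset.mul_sum, inner_sum,
    inner_smul_right] at e2 e3 ⊢
  rw [e2, e3]
  ring

theorem IsMixingMatrix.inner_le (hW : IsMixingMatrix G W) {H : Type*} [NormedAddCommGroup H]
    [InnerProductSpace ℝ H] (x : Fin N → H) :
    ∑ i, ⟪x i, ∑ j, W i j • x j⟫ ≤ ∑ i, ‖x i‖ ^ 2 := by
  have h1 := hW.dirichlet x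
  have h2 : 0 ≤ ∑ i, ∑ j, W i j * ‖x i - x j‖ ^ 2 :=
    Finset.sum_nonneg fun i _ => Finset.sum_nonneg fun j _ =>
      mul_nonneg (hW.nonneg i j) (sq_nonneg _)
  linarith

/-- On a connected graph the Dirichlet form vanishes only at constant vectors. -/
theorem IsMixingMatrix.eq_of_le_inner (hW : IsMixingMatrix G W) (hG : G.Connected) {H : Type*}
    [NormedAddCommGroup H] [InnerProductSpace ℝ H] {x : Fin N → H}
    (h : ∑ i, ‖x i‖ ^ 2 ≤ ∑ i, ⟪x i, ∑ j, W i j • x j⟫) (i j : Fin N) : x i = x j := by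
  have h1 := hW.dirichlet x
  have hnn : ∀ i, 0 ≤ ∑ j, W i j * ‖x i - x j‖ ^ 2 := fun i =>
    Finset.sum_nonneg fun j _ => mul_nonneg (hW.nonneg i j) (sq_nonneg _)
  have h2 : ∑ i, ∑ j, W i j * ‖x i - x j‖ ^ 2 = 0 :=
    le_antisymm (by linarith) (Finset.sum_nonneg fun i _ => hnn i)
  have hadj : ∀ i j, G.Adj i j → x i = x j := by
    intro i j hij
    have h3 := (Finset.sum_eq_zero_iff_of_nonneg fun i _ => hnn i).1 h2 i (Finset.mem_univ i)
    have h4 := (Finset.sum_eq_zero_iff_of_nonneg fun j _ =>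
      mul_nonneg (hW.nonneg i j) (sq_nonneg _)).1 h3 j (Finset.mem_univ j)
    rcases mul_eq_zero.1 h4 with h5 | h5
    · exact absurd h5 (hW.pos_of_adj i j hij).ne'
    · exact sub_eq_zero.1 (norm_eq_zero.1 (pow_eq_zero_iff two_ne_zero |>.1 h5))
  obtain ⟨p⟩ := hG.preconnected i j
  induction p with
  | nil => rfl
  | cons hadj' _ ih => exact (hadj _ _ hadj').trans ih

theorem eig_antitone (hW : W.IsHermitian) {i j : Fin N} (h : i ≤ j) : eig hW j ≤ eig hW i :=
  hW.eigenvalues₀_antitone (by simpa using h)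

theorem exists_eig_eq (hW : W.IsHermitian) (i : Fin N) : ∃ j, hW.eigenvalues i = eig hW j := by
  refine ⟨Fin.cast (Fintype.card_fin N)
    ((Fintype.equivOfCardEq (Fintype.card_fin (Fintype.card (Fin N)))).symm i), ?_⟩
  rfl

theorem exists_eigenvalues_eq (hW : W.IsHermitian) :
    ∃ e : Fin N ≃ Fin N, ∀ j, eig hW j = hW.eigenvalues (e j) := by
  refine ⟨(finCongr (Fintype.card_fin N).symm).trans
    (Fintype.equivOfCardEq (Fintype.card_fin (Fintype.card (Fin N)))), fun j => ?_⟩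
  simp [eig, Matrix.IsHermitian.eigenvalues]

theorem lamMin_le_eig (hW : W.IsHermitian) (hN : 2 ≤ N) (j : Fin N) : lamMin hW hN ≤ eig hW j :=
  eig_antitone hW (by rw [Fin.le_def]; have := j.2; simp only; omega)

theorem eigenvector_apply (hW : W.IsHermitian) (k i : Fin N) :
    ∑ j, W i j * hW.eigenvectorBasis k j = hW.eigenvalues k * hW.eigenvectorBasis k i := by
  have := congrFun (hW.mulVec_eigenvectorBasis k) i
  simpa [Matrix.mulVec, dotProduct] using this

/-- The variational lower bound of a symmetric matrix by its smallest eigenvalue. -/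
theorem lamMin_mul_le (hW : W.IsHermitian) (hN : 2 ≤ N) (u : Fin N → ℝ) :
    lamMin hW hN * ∑ i, u i ^ 2 ≤ ∑ i, u i * ∑ j, W i j * u j := by
  have hsymm : ∀ i j, W i j = W j i := fun i j => by simpa using hW.apply j i
  set b := hW.eigenvectorBasis
  set v : EuclideanSpace ℝ (Fin N) := WithLp.toLp 2 u with hv
  set Wv : EuclideanSpace ℝ (Fin N) := WithLp.toLp 2 (fun i => ∑ j, W i j * u j) with hWv
  have e1 : ∑ i, u i ^ 2 = ∑ k, ⟪v, b k⟫ * ⟪b k, v⟫ := by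
    rw [b.sum_inner_mul_inner, PiLp.inner_apply]
    simp [hv, sq]
  have e2 : ∑ i, u i * ∑ j, W i j * u j = ∑ k, ⟪v, b k⟫ * ⟪b k, Wv⟫ := by
    rw [b.sum_inner_mul_inner, PiLp.inner_apply]
    simp [hv, hWv, mul_comm]
  have e3 : ∀ k, ⟪b k, Wv⟫ = hW.eigenvalues k * ⟪b k, v⟫ := by
    intro k
    rw [PiLp.inner_apply, PiLp.inner_apply]
    simp only [hv, hWv, RCLike.inner_apply, conj_trivial]
    have : ∀ j, u j * (hW.eigenvalues k * b k j) = ∑ i, W i j * u j * b k i := by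
      intro j
      rw [← eigenvector_apply hW k j, Finset.mul_sum]
      exact Finset.sum_congr rfl fun i _ => by rw [hsymm j i]; ring
    calc ∑ i, (∑ j, W i j * u j) * b k i = ∑ i, ∑ j, W i j * u j * b k i := by
          simp only [Finset.sum_mul]
      _ = ∑ j, u j * (hW.eigenvalues k * b k j) := by rw [Finset.sum_comm]; simp only [this]
      _ = _ := by rw [Finset.mul_sum]; exact Finset.sum_congr rfl fun i _ => by ring
  rw [e1, e2, Finset.mul_sum]
  refine Finset.sum_le_sum fun k _ => ?_
  obtain ⟨j, hj⟩ := exists_eig_eq hW k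
  rw [e3, hj, real_inner_comm v (b k)]
  nlinarith [lamMin_le_eig hW hN j, mul_self_nonneg ⟪b k, v⟫]

theorem lamMin_mul_le_mix (hW : W.IsHermitian) (hN : 2 ≤ N) {d : ℕ} (x : Fin N → E d) :
    lamMin hW hN * ∑ i, ‖x i‖ ^ 2 ≤ ∑ i, ⟪x i, mix W x i⟫ := by
  have e1 : ∑ i, ‖x i‖ ^ 2 = ∑ c, ∑ i, x i c ^ 2 := by
    rw [Finset.sum_comm]
    exact Finset.sum_congr rfl fun i _ => EuclideanSpace.real_norm_sq_eq (x i)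
  have e2 : ∑ i, ⟪x i, mix W x i⟫ = ∑ c, ∑ i, x i c * ∑ j, W i j * x j c := by
    rw [Finset.sum_comm]
    refine Finset.sum_congr rfl fun i _ => ?_
    rw [PiLp.inner_apply]
    exact Finset.sum_congr rfl fun c _ => by simp [mix, mul_comm]
  rw [e1, e2, Finset.mul_sum]
  exact Finset.sum_le_sum fun c _ => lamMin_mul_le hW hN fun i => x i c

theorem IsMixingMatrix.lamMin_le_one (hW : IsMixingMatrix G W) (hN : 2 ≤ N) :
    lamMin hW.symm hN ≤ 1 := by
  have h := lamMin_mul_le hW.symm hN fun _ => 1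
  simp only [mul_one, hW.row_sum] at h
  have hN' : (0 : ℝ) < N := by exact_mod_cast (by omega : 0 < N)
  simp at h
  nlinarith

/-- Otherwise two orthonormal eigenvectors would have eigenvalues at least 1. Connectedness makes
both constant, and two nonzero constant vectors are not orthogonal. -/
theorem IsMixingMatrix.eig_one_lt (hW : IsMixingMatrix G W) (hG : G.Connected) (hN : 2 ≤ N) :
    eig hW.symm ⟨1, by omega⟩ < 1 := by
  by_contra! hlt
  obtain ⟨e, he⟩ := exists_eigenvalues_eq hW.symm
  set b := hW.symm.eigenvectorBasis
  have hconst : ∀ k, 1 ≤ hW.symm.eigenvalues k → ∀ i j, b k i = b k j := by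
    intro k hk
    refine hW.eq_of_le_inner hG ?_
    have e1 : ∀ i, ∑ j, W i j • b k j = hW.symm.eigenvalues k * b k i := fun i => by
      simpa using eigenvector_apply hW.symm k i
    simp only [e1]
    refine Finset.sum_le_sum fun i _ => ?_
    simp only [RCLike.inner_apply, conj_trivial, Real.norm_eq_abs, sq_abs]
    nlinarith [mul_self_nonneg (b k i)]
  have h0 : 1 ≤ hW.symm.eigenvalues (e ⟨0, by omega⟩) := by
    rw [← he]; exact hlt.trans (eig_antitone _ (by simp [Fin.le_def]))
  have h1 : 1 ≤ hW.symm.eigenvalues (e ⟨1, by omega⟩) := by rw [← he]; exact hlt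
  have c0 := hconst _ h0
  have c1 := hconst _ h1
  have hne : e ⟨0, by omega⟩ ≠ e ⟨1, by omega⟩ := by
    rw [Ne, e.injective.eq_iff]; simp
  have horth : ⟪b (e ⟨0, by omega⟩), b (e ⟨1, by omega⟩)⟫ = 0 := b.orthonormal.2 hne
  have hn0 : ⟪b (e ⟨0, by omega⟩), b (e ⟨0, by omega⟩)⟫ = 1 := by
    rw [real_inner_self_eq_norm_sq, b.orthonormal.1]; norm_num
  have hn1 : ⟪b (e ⟨1, by omega⟩), b (e ⟨1, by omega⟩)⟫ = 1 := by
    rw [real_inner_self_eq_norm_sq, b.orthonormal.1]; norm_num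
  set i₀ : Fin N := ⟨0, by omega⟩ with hi₀
  rw [PiLp.inner_apply] at horth hn0 hn1
  simp only [fun i => c0 i i₀, fun i => c1 i i₀, RCLike.inner_apply, conj_trivial,
    Finset.sum_const, Finset.card_univ, Fintype.card_fin, nsmul_eq_mul] at horth hn0 hn1
  have hN' : (N : ℝ) ≠ 0 := by
    have : (0 : ℝ) < N := by exact_mod_cast (by omega : 0 < N)
    exact this.ne'
  rcases mul_eq_zero.1 horth with h | h
  · exact hN' h
  · rcases mul_eq_zero.1 h with h | h
    · rw [h] at hn1; simp at hn1
    · rw [h] at hn0; simp at hn0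

theorem IsMixingMatrix.gam_lt_one (hW : IsMixingMatrix G W) (hG : G.Connected) (hN : 2 ≤ N)
    (hlam : 0 < lamMin hW.symm hN) : gam hW.symm hN < 1 := by
  have h1 := hW.eig_one_lt hG hN
  have h2 := lamMin_le_eig hW.symm hN ⟨1, by omega⟩
  rw [gam, abs_of_pos hlam, abs_of_pos (hlam.trans_le h2)]
  exact max_lt h1 (h2.trans_lt h1)

/-- The spectral gap on the vectors with mean zero. -/
theorem IsMixingMatrix.exists_contract (hW : IsMixingMatrix G W) (hG : G.Connected) (hN : 2 ≤ N)
    (d : ℕ) : ∃ ρ : ℝ, 0 < ρ ∧ ρ < 1 ∧ ∀ x : Fin N → E d, ∑ i, x i = 0 →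
      ∑ i, ⟪x i, mix W x i⟫ ≤ ρ * ∑ i, ‖x i‖ ^ 2 := by
  have hcont : Continuous fun x : Stack N d => ⟪x, mixL W x⟫ := by
    simp only [PiLp.inner_apply]
    exact continuous_finsetSum _ fun i _ => (PiLp.continuous_apply 2 _ i).inner
      (continuous_finsetSum _ fun j _ => (PiLp.continuous_apply 2 _ j).const_smul (W i j))
  have hclosed : IsClosed (Setting.meanZero N d : Set (Stack N d)) :=
    isClosed_eq (f := fun x : Stack N d => ∑ i, x i)
      (continuous_finsetSum _ fun i _ => PiLp.continuous_apply 2 _ i) continuous_const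
  have hK : IsCompact ((Setting.meanZero N d : Set (Stack N d)) ∩ Metric.sphere 0 1) :=
    (isCompact_sphere 0 1).inter_left hclosed
  have hN' : (0 : ℝ) < N := by exact_mod_cast (by omega : 0 < N)
  -- Equality forces consensus, and a consensus vector with mean zero vanishes. The gap ρ then comes
  -- from compactness. It need not be the second eigenvalue, because it enters only the
  -- data-dependent constant.
  have hstrict : ∀ x ∈ (Setting.meanZero N d : Set (Stack N d)) ∩ Metric.sphere 0 1,
      ⟪x, mixL W x⟫ < 1 := by
    rintro x ⟨hx0, hx1⟩
    have hx1' : ‖x‖ = 1 := by simpa using hx1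
    by_contra! hle
    have hc := hW.eq_of_le_inner hG (x := x.ofLp) (by
      rw [← PiLp.norm_sq_eq_of_L2, hx1', one_pow]
      rw [PiLp.inner_apply] at hle
      exact hle)
    have hsum : ∑ i, x i = 0 := hx0
    have hz : ∀ i, x i = 0 := by
      intro i
      have : ∑ j, x j = (N : ℝ) • x i := by
        rw [Finset.sum_congr rfl fun j _ => hc j i]
        simp [Nat.cast_smul_eq_nsmul]
      rw [hsum] at this
      exact (smul_eq_zero.1 this.symm).resolve_left hN'.ne'
    have : x = 0 := by ext1 i; exact hz i
    rw [this, norm_zero] at hx1'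
    exact zero_ne_one hx1'
  obtain ⟨ρ, hρ0, hρ1, hρ⟩ : ∃ ρ : ℝ, 0 < ρ ∧ ρ < 1 ∧
      ∀ x ∈ (Setting.meanZero N d : Set (Stack N d)) ∩ Metric.sphere 0 1, ⟪x, mixL W x⟫ ≤ ρ := by
    rcases Set.eq_empty_or_nonempty ((Setting.meanZero N d : Set (Stack N d)) ∩ Metric.sphere 0 1)
      with hE | hE
    -- The sphere of mean-zero vectors is empty when d = 0.
    · exact ⟨1 / 2, by norm_num, by norm_num, fun x hx => by rw [hE] at hx; exact hx.elim⟩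
    · obtain ⟨z, hz, hmax⟩ := hK.exists_isMaxOn hE hcont.continuousOn
      refine ⟨max ⟪z, mixL W z⟫ (1 / 2), lt_max_of_lt_right (by norm_num),
        max_lt (hstrict z hz) (by norm_num), fun x hx => le_max_of_le_left (hmax hx)⟩
  refine ⟨ρ, hρ0, hρ1, fun x hx => ?_⟩
  set X : Stack N d := WithLp.toLp 2 x with hX
  have goal : ⟪X, mixL W X⟫ ≤ ρ * ‖X‖ ^ 2 := by
    by_cases h0 : X = 0
    · rw [h0]; simp
    have hn : 0 < ‖X‖ := norm_pos_iff.2 h0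
    have h1 := hρ (‖X‖⁻¹ • X) ⟨(Setting.meanZero N d).smul_mem _ hx, by
      simp [norm_smul, hn.ne']⟩
    rw [map_smul, inner_smul_left, inner_smul_right, RCLike.conj_to_real] at h1
    have h2 : ⟪X, mixL W X⟫ = ‖X‖ ^ 2 * (‖X‖⁻¹ * (‖X‖⁻¹ * ⟪X, mixL W X⟫)) := by field_simp
    rw [h2, mul_comm ρ]
    exact mul_le_mul_of_nonneg_left h1 (by positivity)
  rwa [hX, mixL_toLp, inner_toLp, norm_sq_toLp] at goal

/-- A gradient step of length 1/(NL) from the minimizer would lower the sum by ‖g‖²/(2NL). -/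
theorem sum_gradient_eq_zero_of_isMinOn {d : ℕ} {f : Fin N → E d → ℝ} {μ L : ℝ} (hN : 0 < N)
    (hL : 0 < L) (hf : ∀ i, StronglyConvexSmooth μ L (f i)) {xs : E d}
    (hmin : IsMinOn (fun x => (N : ℝ)⁻¹ * ∑ i, f i x) Set.univ xs) : ∑ i, ∇ (f i) xs = 0 := by
  have hN' : (0 : ℝ) < N := by exact_mod_cast hN
  set g := ∑ i, ∇ (f i) xs with hg
  have hmin' : ∀ x, ∑ i, f i xs ≤ ∑ i, f i x := fun x =>
    le_of_mul_le_mul_left (hmin (Set.mem_univ x)) (inv_pos.2 hN')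
  have hup : ∀ x, ∑ i, f i x ≤ ∑ i, f i xs + ⟪g, x - xs⟫ + N * (L / 2 * ‖x - xs‖ ^ 2) := by
    intro x
    have := Finset.sum_le_sum fun i (_ : i ∈ Finset.univ) => ((hf i).2 x xs).2
    simp only [Finset.sum_sub_distrib, ← sum_inner, ← hg, Finset.sum_const, Finset.card_univ,
      Fintype.card_fin, nsmul_eq_mul] at this
    linarith
  have h1 := (hmin' (xs - (N * L)⁻¹ • g)).trans (hup _)
  have e1 : xs - ((N : ℝ) * L)⁻¹ • g - xs = -(((N : ℝ) * L)⁻¹ • g) := by abel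
  rw [e1, inner_neg_right, inner_smul_right, real_inner_self_eq_norm_sq, norm_neg, norm_smul,
    mul_pow, Real.norm_eq_abs, sq_abs] at h1
  have e2 : (N : ℝ) * (L / 2 * (((N : ℝ) * L)⁻¹ ^ 2 * ‖g‖ ^ 2))
      = ((N : ℝ) * L)⁻¹ * ‖g‖ ^ 2 / 2 := by field_simp
  rw [e2] at h1
  have h2 : ((N : ℝ) * L)⁻¹ * ‖g‖ ^ 2 ≤ 0 := by linarith
  have h3 : ‖g‖ ^ 2 ≤ 0 := by
    by_contra! h
    have : 0 < ((N : ℝ) * L)⁻¹ * ‖g‖ ^ 2 := by positivity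
    linarith
  exact norm_eq_zero.1 (pow_eq_zero_iff two_ne_zero |>.1 (le_antisymm h3 (sq_nonneg _)))

theorem IsMixingMatrix.exists_setting {d : ℕ} (hW : IsMixingMatrix G W) (hG : G.Connected)
    (hN : 2 ≤ N) (hlam : 0 < lamMin hW.symm hN) {f : Fin N → E d → ℝ} {μ L : ℝ} (hμ : 0 < μ)
    (hμL : μ ≤ L) (hf : ∀ i, StronglyConvexSmooth μ L (f i)) {xs : E d}
    (hmin : IsMinOn (fun x => (N : ℝ)⁻¹ * ∑ i, f i x) Set.univ xs) :
    ∃ ρ, Setting W f μ L (lamMin hW.symm hN) ρ xs := by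
  obtain ⟨ρ, h0, h1, h2⟩ := hW.exists_contract hG hN d
  exact ⟨ρ, {
    N_pos := by omega
    mu_pos := hμ
    mu_le := hμL
    lam_pos := hlam
    lam_le := hW.lamMin_le_one hN
    rho_pos := h0
    rho_lt := h1
    symm := hW.apply_comm
    row_sum := hW.row_sum
    lower := lamMin_mul_le_mix hW.symm hN
    upper := hW.inner_le
    contract := h2
    reg := hf
    grad_sum := sum_gradient_eq_zero_of_isMinOn (by omega) (hμ.trans_le hμL) hf hmin }⟩

end Spectral


/-! ### The stepsizes and stage lengths of D-MASG. -/

section StageSchedule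

variable {lam μ L : ℝ}

theorem stageStep_pos (hl : 0 < lam) (hμ : 0 < μ) (hL : 0 < L) (t : ℕ) :
    0 < stageStep lam μ L t := by
  unfold stageStep; split_ifs <;> positivity

theorem stageStep_mul_le (hl : 0 < lam) (hμ : 0 < μ) (hL : 0 < L) (t : ℕ) :
    stageStep lam μ L t * (L + μ) ≤ lam := by
  have h : 0 < L + μ := by positivity
  unfold stageStep
  split_ifs
  · rw [div_mul_cancel₀ _ h.ne']
  · rw [div_mul_eq_mul_div, mul_comm (2 ^ (2 * t) : ℝ), mul_comm lam,
      mul_div_mul_left _ _ h.ne']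
    exact div_le_self hl.le (one_le_pow₀ (by norm_num))

theorem stageStep_add_two (t : ℕ) :
    stageStep lam μ L (t + 2) = lam / (2 ^ (2 * (t + 2)) * (L + μ)) :=
  if_neg (by omega)

theorem stageStep_eq_four_mul (t : ℕ) :
    stageStep lam μ L (t + 2) = 4 * stageStep lam μ L (t + 3) := by
  rw [stageStep_add_two, stageStep_add_two (t + 1)]
  have : (2 : ℝ) ^ (2 * (t + 1 + 2)) = 4 * 2 ^ (2 * (t + 2)) := by ring
  rw [this, mul_assoc, ← mul_div_assoc, mul_div_mul_left _ _ (by norm_num)]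

theorem stageStep_le_mul (hl : 0 < lam) (hμ : 0 < μ) (hL : 0 < L) (t : ℕ) :
    stageStep lam μ L (t + 1) ≤ 16 * stageStep lam μ L (t + 2) := by
  rcases t with _ | t
  · rw [stageStep_add_two]
    refine le_of_eq ?_
    have : L + μ ≠ 0 := by positivity
    simp only [stageStep, zero_add, le_refl, if_true]
    field_simp
    norm_num
  · have h1 : stageStep lam μ L (t + 1 + 1) = _ := stageStep_eq_four_mul t
    have h2 := stageStep_pos hl hμ hL (t + 3)
    rw [h1]
    change _ ≤ 16 * stageStep lam μ L (t + 3)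
    linarith

theorem kappaTilde_ge_two (hl : 0 < lam) (hl1 : lam ≤ 1) (hμ : 0 < μ) (hμL : μ ≤ L) :
    2 ≤ kappaTilde lam μ L := by
  rw [kappaTilde, le_div_iff₀ (by positivity)]
  nlinarith

theorem one_le_sqrt_kappaTilde (hl : 0 < lam) (hl1 : lam ≤ 1) (hμ : 0 < μ) (hμL : μ ≤ L) :
    1 ≤ √(kappaTilde lam μ L) :=
  Real.one_le_sqrt.2 (by linarith [kappaTilde_ge_two hl hl1 hμ hμL])

theorem rate_stageStep (hl : 0 < lam) (hμ : 0 < μ) (hL : 0 < L) (t : ℕ) :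
    √(μ * stageStep lam μ L (t + 2)) = 1 / (2 ^ (t + 2) * √(kappaTilde lam μ L)) := by
  have h : L + μ ≠ 0 := by positivity
  have e : μ * stageStep lam μ L (t + 2) = 1 / ((2 ^ (t + 2)) ^ 2 * kappaTilde lam μ L) := by
    rw [stageStep_add_two, kappaTilde]
    field_simp
    ring
  rw [e, Real.sqrt_div (by norm_num), Real.sqrt_one, Real.sqrt_mul (by positivity),
    Real.sqrt_sq (by positivity)]

/-- The powers of two in k_t and √(μα_t) cancel, leaving ⌈p√κ̃ log 2⌉/√κ̃ ≥ 7 log 2. The power in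
k_t alone gives k_t ≥ t. -/
theorem schedule_dmasg (hl : 0 < lam) (hl1 : lam ≤ 1) (hμ : 0 < μ) (hμL : μ ≤ L) {p : ℝ}
    (hp : 7 ≤ p) (k₁ : ℕ) :
    Schedule μ (stageStep lam μ L) (stageLength (kappaTilde lam μ L) p k₁) := by
  have hL : 0 < L := hμ.trans_le hμL
  have hlog : 0 < Real.log 2 := Real.log_pos (by norm_num)
  have hκ := one_le_sqrt_kappaTilde hl hl1 hμ hμL
  set s := √(kappaTilde lam μ L) with hs
  have hlen : ∀ t, stageLength (kappaTilde lam μ L) p k₁ (t + 2)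
      = 2 ^ (t + 2) * ⌈p * s * Real.log 2⌉₊ := fun t => if_neg (by omega)
  refine ⟨stageStep_le_mul hl hμ hL, stageStep_eq_four_mul, fun t => ?_, fun t => ?_⟩
  · rw [hlen]
    have h1 : 1 ≤ ⌈p * s * Real.log 2⌉₊ := Nat.one_le_ceil_iff.2 (by positivity)
    have h2 : t + 2 < 2 ^ (t + 2) := Nat.lt_two_pow_self
    nlinarith
  · rw [hlen, rate_stageStep hl hμ hL, ← hs]
    push_cast
    have h1 := Nat.le_ceil (p * s * Real.log 2)
    have e : 1 / (2 ^ (t + 2) * s) * (2 ^ (t + 2) * (⌈p * s * Real.log 2⌉₊ : ℝ))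
        = ⌈p * s * Real.log 2⌉₊ / s := by field_simp
    rw [e, le_div_iff₀ (by linarith)]
    refine le_trans ?_ h1
    have : 0 < s * Real.log 2 := by positivity
    nlinarith

theorem ceil_stage_le {p s : ℝ} (hp : 7 ≤ p) (hs : 1 ≤ s) :
    (⌈p * s * Real.log 2⌉₊ : ℝ) ≤ p * s := by
  have hlog : 0 < Real.log 2 := Real.log_pos (by norm_num)
  have hps : 7 ≤ p * s := by nlinarith
  have h1 := (Nat.ceil_lt_add_one (by positivity : 0 ≤ p * s * Real.log 2)).le
  have h2 := Real.log_two_lt_d9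
  nlinarith

/-- A geometric sum. The term with 4 stands on the left to avoid truncated subtraction. -/
theorem Run.total_dmasg {N d : ℕ} {S : Type*} (W : Matrix (Fin N) (Fin N) ℝ) (p : ℝ) (k₁ : ℕ)
    (x₀ : Fin N → E d) (grad : Fin N → E d → S → E d) (t : ℕ) :
    (dmasg W lam μ L p k₁ x₀ grad).total (t + 1)
        + 4 * ⌈p * √(kappaTilde lam μ L) * Real.log 2⌉₊
      = k₁ + 2 ^ (t + 2) * ⌈p * √(kappaTilde lam μ L) * Real.log 2⌉₊ := by
  induction t with
  | zero => simp [Run.total, dmasg, stageLength]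
  | succ t ih =>
    rw [Run.total_succ]
    have : (dmasg W lam μ L p k₁ x₀ grad).len (t + 1 + 1)
        = 2 ^ (t + 2) * ⌈p * √(kappaTilde lam μ L) * Real.log 2⌉₊ := by
      change stageLength (kappaTilde lam μ L) p k₁ (t + 1 + 1) = _
      exact if_neg (by omega)
    rw [this]
    have : 2 ^ (t + 1 + 2) = 2 * 2 ^ (t + 2) := by ring
    rw [this]
    linarith

/-- Past twice the first stage, the rate `√(μ α_t)` of the current stage is at most `5 p / k`. -/
theorem exists_stage_position {N d : ℕ} {S : Type*} (W : Matrix (Fin N) (Fin N) ℝ)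
    (hl : 0 < lam) (hl1 : lam ≤ 1) (hμ : 0 < μ) (hμL : μ ≤ L) {p : ℝ} (hp : 7 ≤ p) {k₁ k : ℕ}
    (hk₁ : 1 ≤ k₁) (hk : k₁ < k) (hk2 : 2 * k₁ ≤ k + 2) (x₀ : Fin N → E d)
    (grad : Fin N → E d → S → E d) :
    ∃ t m, (dmasg W lam μ L p k₁ x₀ grad).position k = (t + 2, m) ∧
      m ≤ (dmasg W lam μ L p k₁ x₀ grad).len (t + 2) ∧
      √(μ * stageStep lam μ L (t + 2)) ≤ 5 * p / k := by
  have hL : 0 < L := hμ.trans_le hμL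
  have hκ := one_le_sqrt_kappaTilde hl hl1 hμ hμL
  have hlog : 0 < Real.log 2 := Real.log_pos (by norm_num)
  have hc := ceil_stage_le hp hκ
  set R := dmasg W lam μ L p k₁ x₀ grad with hR
  set s := √(kappaTilde lam μ L) with hs
  have hc1 : 1 ≤ ⌈p * s * Real.log 2⌉₊ := Nat.one_le_ceil_iff.2 (by positivity)
  have hlen : ∀ t, R.len (t + 2) = 2 ^ (t + 2) * ⌈p * s * Real.log 2⌉₊ :=
    fun t => by
      change stageLength (kappaTilde lam μ L) p k₁ (t + 2) = _
      exact if_neg (by omega)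
  have hlen1 : R.len 1 = k₁ := by
    change stageLength (kappaTilde lam μ L) p k₁ 1 = _
    exact if_pos le_rfl
  obtain ⟨h1, h2, h3, h4⟩ := R.position_spec (fun t ht => by
    obtain ⟨_ | t, rfl⟩ := Nat.exists_eq_add_of_le' ht
    · rw [zero_add, hlen1]; exact hk₁
    · rw [hlen t]; exact Nat.mul_pos (by positivity) hc1) k (by omega)
  obtain ⟨t, ht⟩ : ∃ t, (R.position k).1 = t + 2 := by
    refine ⟨(R.position k).1 - 2, ?_⟩
    by_contra hne
    have h5 : (R.position k).1 = 1 := by omega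
    rw [h5, hlen1] at h3
    rw [h5] at h4
    simp [Run.total] at h4
    omega
  refine ⟨t, (R.position k).2, by rw [← ht], by rw [← ht]; exact h3, ?_⟩
  rw [ht] at h3 h4
  rw [hlen] at h3
  have htot := Run.total_dmasg (lam := lam) (μ := μ) (L := L) W p k₁ x₀ grad t
  rw [← hR, ← hs] at htot
  simp only [Nat.add_succ_sub_one] at h4
  -- With c the rounded factor, k ≤ k₁ + (2^{t+3} - 4)c and 2k₁ ≤ k + 2. The -4c pays for the
  -- surplus 2 left by rounding k₁.
  have hkb : k ≤ 4 * (2 ^ (t + 2) * ⌈p * s * Real.log 2⌉₊) := by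
    have hX : 1 * 1 ≤ 2 ^ (t + 2) * ⌈p * s * Real.log 2⌉₊ :=
      Nat.mul_le_mul Nat.one_le_two_pow hc1
    omega
  have hkb' : (k : ℝ) ≤ 4 * (2 ^ (t + 2) * (p * s)) := by
    have h5 : (k : ℝ) ≤ 4 * (2 ^ (t + 2) * (⌈p * s * Real.log 2⌉₊ : ℝ)) := by exact_mod_cast hkb
    have h6 := mul_le_mul_of_nonneg_left hc (by positivity : (0 : ℝ) ≤ 2 ^ (t + 2))
    linarith
  have hk0 : (0 : ℝ) < k := by exact_mod_cast (by omega : 0 < k)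
  rw [rate_stageStep hl hμ hL, ← hs, div_le_div_iff₀ (by positivity) hk0]
  have : 0 < 2 ^ (t + 2) * (p * s) := by positivity
  linarith

end StageSchedule

/-! ### Assembly. -/

/-- The error bounds for the concatenated sequence, with a constant that depends only on the data
of the problem. -/
theorem Setting.exists_iterate_bound {N d : ℕ} {W : Matrix (Fin N) (Fin N) ℝ}
    {f : Fin N → E d → ℝ} {μ L lam ρ : ℝ} {xs : E d} (h : Setting W f μ L lam ρ xs) (σ : ℝ)
    (x₀ : Fin N → E d) :
    ∃ C₁ : ℝ, 0 < C₁ ∧ ∀ (S : Type*) [MeasurableSpace S] (Ω : Type*) [MeasurableSpace Ω]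
      (P : Measure Ω) [IsProbabilityMeasure P] (grad : Fin N → E d → S → E d)
      (w : Fin N → ℕ → Ω → S) (p : ℝ) (_ : 7 ≤ p) (k₁ : ℕ) (_ : 1 ≤ k₁) (R : Run N d S)
      (_ : R = dmasg W lam μ L p k₁ x₀ grad) (_ : R.NoiseAssumption f σ P w) (k : ℕ)
      (_ : k₁ < k) (_ : 2 * k₁ ≤ k + 2),
      ∫⁻ ω, ‖nodeAvg (R.iterate (fun j n => w j n ω) k) - xs‖ₑ ^ 2 ∂P ≤
        ENNReal.ofReal (180 * p * (σ ^ 2 / (N * μ ^ 2)) / k + C₁ * p ^ 4 / k ^ 4) ∧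
      ∀ i, ∫⁻ ω, ‖R.iterate (fun j n => w j n ω) k i - xs‖ₑ ^ 2 ∂P ≤
        ENNReal.ofReal (360 * p * (σ ^ 2 / (N * μ ^ 2)) / k + C₁ * p ^ 4 / k ^ 4) := by
  have hμ := h.mu_pos
  have hL := h.L_pos
  have hρ : 0 < 1 - ρ := by linarith [h.rho_lt]
  have hN : (0 : ℝ) < N := by exact_mod_cast h.N_pos
  obtain ⟨Cd, hCd, hb⟩ := h.exists_stage_bound σ x₀ (stageStep lam μ L)
    (stageStep_pos h.lam_pos hμ hL)
  -- The first factor collects the weights of both Lyapunov functions in a node error. The last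
  -- comes from α² = q⁴/μ² with q ≤ 5p/k.
  refine ⟨(4 / μ + 2 * (1 - ρ)⁻¹) * Cd * (625 / μ ^ 2), by positivity, ?_⟩
  intro S _ Ω _ P _ grad w p hp k₁ hk₁ R hR hn k hk hk2
  have hk0 : (0 : ℝ) < k := by exact_mod_cast (by omega : 0 < k)
  have hadm : AdmissibleRun R f μ L lam ρ σ xs P w :=
    { setting := by rw [hR]; exact h
      mu_eq := by rw [hR]; rfl
      noise := hn
      step_pos := by rw [hR]; exact stageStep_pos h.lam_pos hμ hL
      step_le := by rw [hR]; exact stageStep_mul_le h.lam_pos hμ hL }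
  obtain ⟨t, m, hpos, hm, hq⟩ := exists_stage_position W h.lam_pos h.lam_le hμ h.mu_le hp hk₁ hk hk2
    x₀ grad
  rw [← hR] at hpos hm
  obtain ⟨b1, b2⟩ := hb S Ω P w R hadm (by rw [hR]; rfl) (by rw [hR]; rfl) (by rw [hR]; rfl)
    (by rw [hR]; exact schedule_dmasg h.lam_pos h.lam_le hμ h.mu_le hp k₁) t m hm
  have hit : ∀ ω, R.iterate (fun j n => w j n ω) k = curPt R w (t + 2) m ω := fun ω => by
    rw [Run.iterate, hpos]
  simp only [hit]
  set q := √(μ * stageStep lam μ L (t + 2)) with hqdef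
  set V := σ ^ 2 / (N * μ ^ 2) with hV
  have hq0 : 0 ≤ q := Real.sqrt_nonneg _
  have hV0 : 0 ≤ V := by positivity
  have hα : stageStep lam μ L (t + 2) ^ 2 ≤ 625 / μ ^ 2 * (p ^ 4 / k ^ 4) := by
    have h1 : stageStep lam μ L (t + 2) = q ^ 2 / μ := by
      rw [hqdef, h.rate_sq (stageStep_pos h.lam_pos hμ hL _)]; field_simp
    have h2 := pow_le_pow_left₀ hq0 hq 4
    have h3 : 625 / μ ^ 2 * (p ^ 4 / k ^ 4) = (5 * p / k) ^ 4 / μ ^ 2 := by ring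
    have h4 : (q ^ 2 / μ) ^ 2 = q ^ 4 / μ ^ 2 := by ring
    rw [h1, h3, h4]
    exact div_le_div_of_nonneg_right h2 (by positivity)
  have hα0 : 0 ≤ stageStep lam μ L (t + 2) ^ 2 := sq_nonneg _
  have hqV : q * V ≤ 5 * p / k * V := mul_le_mul_of_nonneg_right hq hV0
  have hvar : q * (σ ^ 2 / N) / μ = μ * (q * V) := by rw [hV]; field_simp
  rw [hvar] at b1
  have hCα := mul_le_mul_of_nonneg_left hα hCd.le
  have hCα0 : 0 ≤ Cd * stageStep lam μ L (t + 2) ^ 2 := by positivity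
  have e1 : ∀ a : ℝ, a * (5 * p / k * V) = 5 * a * p * V / k := fun a => by ring
  have e2 : (4 / μ + 2 * (1 - ρ)⁻¹) * Cd * (625 / μ ^ 2) * p ^ 4 / k ^ 4
      = (4 / μ + 2 * (1 - ρ)⁻¹) * (Cd * (625 / μ ^ 2 * (p ^ 4 / k ^ 4))) := by ring
  have e3 : ∀ a : ℝ, a / μ * (18 * (μ * (q * V))) = 18 * a * (q * V) := fun a => by field_simp
  have c1 := mul_le_mul_of_nonneg_left hCα (by positivity : 0 ≤ 4 / μ + 2 * (1 - ρ)⁻¹)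
  rw [← e2, add_mul] at c1
  refine ⟨(hadm.lintegral_nodeAvg_le (by omega) hm).trans (ENNReal.ofReal_le_ofReal ?_),
    fun i => (hadm.lintegral_node_le (by omega) hm i).trans (ENNReal.ofReal_le_ofReal ?_)⟩
  · have h1 := mul_le_mul_of_nonneg_left b1 (by positivity : 0 ≤ 2 / μ)
    rw [mul_add, e3] at h1
    have h2 : 0 ≤ 2 * (1 - ρ)⁻¹ * (Cd * stageStep lam μ L (t + 2) ^ 2) := by positivity
    have h3 : 0 ≤ 2 / μ * (Cd * stageStep lam μ L (t + 2) ^ 2) := by positivity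
    have h4 : 4 / μ * (Cd * stageStep lam μ L (t + 2) ^ 2)
        = 2 * (2 / μ * (Cd * stageStep lam μ L (t + 2) ^ 2)) := by ring
    have h5 := e1 36
    linarith
  · have h1 := mul_le_mul_of_nonneg_left b1 (by positivity : 0 ≤ 4 / μ)
    rw [mul_add, e3] at h1
    have h2 := mul_le_mul_of_nonneg_left b2 (by positivity : 0 ≤ 2 * (1 - ρ)⁻¹)
    have h5 := e1 72
    linarith

/-- Matches the variance and α² terms with the claimed right-hand side. The term X, which is the
decay of the initial error, is used only through its sign. -/
theorem final_combination {K A V V₀ X Y c a k p : ℝ} (hA : 0 < A) (hKA : A ≤ K)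
    (hKV : A * V₀ ≤ K * V) (hX : 0 ≤ X) (hY : c ≤ A * Y) (hY0 : 0 ≤ Y) (hp : 0 ≤ p) (hk : 0 < k)
    (hV₀ : 0 ≤ V₀) (ha : a ≤ A) :
    a * p * V₀ / k + c ≤ K * (X + p * V / k + Y) := by
  have h1 : 0 ≤ K * X := mul_nonneg (hA.le.trans hKA) hX
  have h2 : A * Y ≤ K * Y := mul_le_mul_of_nonneg_right hKA hY0
  have h3 : a * V₀ ≤ K * V := (mul_le_mul_of_nonneg_right ha hV₀).trans hKV
  have h4 := mul_le_mul_of_nonneg_right h3 (div_nonneg hp hk.le)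
  have e1 : a * V₀ * (p / k) = a * p * V₀ / k := by ring
  have e2 : K * V * (p / k) = K * (p * V / k) := by ring
  rw [e1, e2] at h4
  rw [mul_add, mul_add]
  linarith


/-- Both normalizations of the variance term dominate `A σ² / (N μ²)`. -/
theorem scale_bounds {A K V μ σ N : ℝ} (hA : 0 < A) (hμ : 0 < μ) (hN : 0 < N)
    (h : (K = A ∧ V = σ ^ 2 / (N * μ ^ 2)) ∨
      (K = A * max 1 (1 / √μ) ∧ V = σ ^ 2 / (N * (μ * √μ)))) :
    A ≤ K ∧ A * (σ ^ 2 / (N * μ ^ 2)) ≤ K * V := by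
  rcases h with ⟨rfl, rfl⟩ | ⟨rfl, rfl⟩
  · exact ⟨le_rfl, le_rfl⟩
  · have hs : 0 < √μ := Real.sqrt_pos.2 hμ
    refine ⟨le_mul_of_one_le_right hA.le (le_max_left _ _), ?_⟩
    have e : σ ^ 2 / (N * μ ^ 2) = 1 / √μ * (σ ^ 2 / (N * (μ * √μ))) := by
      have h : μ * √μ * √μ = μ ^ 2 := by rw [mul_assoc, Real.mul_self_sqrt hμ.le, sq]
      rw [← h]
      field_simp
    rw [e, mul_assoc]
    exact mul_le_mul_of_nonneg_left
      (mul_le_mul_of_nonneg_right (le_max_right _ _) (by positivity)) hA.le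

end DistASG

theorem mainTheorem8 :
    ∃ A : ℝ, 0 < A ∧
    ∀ (N d : ℕ) (hN : 2 ≤ N) (G : SimpleGraph (Fin N)) (_ : G.Connected)
      (W : Matrix (Fin N) (Fin N) ℝ) (hW : DistASG.IsMixingMatrix G W)
      (_ : 0 < DistASG.lamMin hW.symm hN)
      (f : Fin N → DistASG.E d → ℝ) (μ L σ : ℝ) (_ : 0 < μ) (_ : μ ≤ L)
      (_ : ∀ i, DistASG.StronglyConvexSmooth μ L (f i))
      (xs : DistASG.E d) (_ : IsMinOn (fun x => (N : ℝ)⁻¹ * ∑ i, f i x) Set.univ xs)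
      (x₀ : Fin N → DistASG.E d),
    ∃ C₀ : ℝ, 0 < C₀ ∧
    ∀ (S : Type*) [MeasurableSpace S] (Ω : Type*) [MeasurableSpace Ω] (P : Measure Ω)
      [IsProbabilityMeasure P] (grad : Fin N → DistASG.E d → S → DistASG.E d)
      (w : Fin N → ℕ → Ω → S)
      (lam γ kap D : ℝ) (_ : lam = DistASG.lamMin hW.symm hN) (_ : γ = DistASG.gam hW.symm hN)
      (_ : kap = DistASG.kappaTilde lam μ L) (_ : D = ∑ i, ‖x₀ i - xs‖ ^ 2)
      (K V : ℝ)
      (_ : (K = A ∧ V = σ ^ 2 / (N * μ ^ 2)) ∨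
        (K = A * max 1 (1 / √μ) ∧ V = σ ^ 2 / (N * (μ * √μ)))),
    (∀ (p : ℝ) (_ : 7 ≤ p) (k₁ : ℕ) (_ : k₁ = ⌈(p - 2) * Real.log (6 * p * kap) * √kap⌉₊)
      (R : DistASG.Run N d S) (_ : R = DistASG.dmasg W lam μ L p k₁ x₀ grad)
      (_ : R.NoiseAssumption f σ P w) (k : ℕ) (_ : 2 * k₁ ≤ k),
      (∫⁻ ω, ‖DistASG.nodeAvg (R.iterate (fun j n => w j n ω) k) - xs‖ₑ ^ 2 ∂P ≤
        ENNReal.ofReal (K * (1 / (k : ℝ) ^ (p - 2) * (D / N) + p * V / k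
          + p ^ 4 * C₀ * L ^ 2 * ((1 - γ) ^ 2)⁻¹ / (N * μ ^ 2 * (k : ℝ) ^ 4)))) ∧
      ∀ i : Fin N,
        ∫⁻ ω, ‖R.iterate (fun j n => w j n ω) k i - xs‖ₑ ^ 2 ∂P ≤
          ENNReal.ofReal (K * (1 / (k : ℝ) ^ (p - 2) * (D / N) + p * V / k
            + (L ^ 2 / (N * μ ^ 2) + 1) * (p ^ 4 * C₀ * ((1 - γ) ^ 2)⁻¹ / (k : ℝ) ^ 4)))) ∧
    (∀ (C : ℝ) (_ : 2 ≤ C) (k : ℕ) (_ : 2 * √kap ≤ k) (k₁ : ℕ) (_ : k₁ = ⌈(k : ℝ) / C⌉₊)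
      (R : DistASG.Run N d S) (_ : R = DistASG.dmasg W lam μ L 7 k₁ x₀ grad)
      (_ : R.NoiseAssumption f σ P w),
      (∫⁻ ω, ‖DistASG.nodeAvg (R.iterate (fun j n => w j n ω) k) - xs‖ₑ ^ 2 ∂P ≤
        ENNReal.ofReal (K * (Real.exp (-(k : ℝ) / (C * √kap)) * (D / N) + V / k
          + C₀ * L ^ 2 * ((1 - γ) ^ 2)⁻¹ / (N * μ ^ 2 * (k : ℝ) ^ 4)))) ∧
      ∀ i : Fin N,
        ∫⁻ ω, ‖R.iterate (fun j n => w j n ω) k i - xs‖ₑ ^ 2 ∂P ≤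
          ENNReal.ofReal (K * (Real.exp (-(k : ℝ) / (C * √kap)) * (D / N) + V / k
            + (L ^ 2 / (N * μ ^ 2) + 1) * (C₀ * ((1 - γ) ^ 2)⁻¹ / (k : ℝ) ^ 4)))) := by
  -- The constant has to exceed 360 · 7 from the variance term and 7⁴ = 2401 from p⁴, both arising
  -- in part (b).
  refine ⟨10000, by norm_num, ?_⟩
  intro N d hN G hG W hW hlam f μ L σ hμ hμL hf xs hmin x₀
  obtain ⟨ρ, h⟩ := hW.exists_setting hG hN hlam hμ hμL hf hmin
  obtain ⟨C₁, hC₁, hb⟩ := h.exists_iterate_bound σ x₀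
  have hL : 0 < L := hμ.trans_le hμL
  have hN0 : (0 : ℝ) < N := by exact_mod_cast (by omega : 0 < N)
  have hγ : 0 < 1 - DistASG.gam hW.symm hN := sub_pos.2 (hW.gam_lt_one hG hN hlam)
  have hκ := DistASG.kappaTilde_ge_two hlam (hW.lamMin_le_one hN) hμ hμL
  have hsκ := DistASG.one_le_sqrt_kappaTilde hlam (hW.lamMin_le_one hN) hμ hμL
  -- C₀ is normalized so that C₀L²(1-γ)⁻²/(Nμ²) equals C₁. Here γ < 1 is needed, since the factor
  -- would otherwise degenerate.
  refine ⟨C₁ / (L ^ 2 * ((1 - DistASG.gam hW.symm hN) ^ 2)⁻¹ / (N * μ ^ 2)), by positivity, ?_⟩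
  intro S _ Ω _ P _ grad w lam γ kap D hlam' hγ' hkap hD K V hKV
  rw [← hlam'] at hlam h hκ hsκ hb
  rw [← hkap] at hκ hsκ
  rw [← hγ'] at hγ ⊢
  set g := L ^ 2 * ((1 - γ) ^ 2)⁻¹ / (N * μ ^ 2) with hg
  set C₀ := C₁ / g with hC₀
  have hg0 : 0 < g := by positivity
  have hC₀0 : 0 < C₀ := by positivity
  have hCg : C₀ * g = C₁ := div_mul_cancel₀ _ hg0.ne'
  have hD0 : 0 ≤ D := by rw [hD]; positivity
  have hV₀ : 0 ≤ σ ^ 2 / (N * μ ^ 2) := by positivity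
  obtain ⟨hK, hKV⟩ := DistASG.scale_bounds (by norm_num) hμ hN0 hKV
  have hnode : ∀ q k : ℝ, 0 ≤ q → 0 < k → q * (C₁ / k ^ 4) ≤
      (L ^ 2 / (N * μ ^ 2) + 1) * (q * C₀ * ((1 - γ) ^ 2)⁻¹ / k ^ 4) := fun q k hq hk => by
    have e : (L ^ 2 / (N * μ ^ 2) + 1) * (q * C₀ * ((1 - γ) ^ 2)⁻¹ / k ^ 4)
        = q * (C₀ * g / k ^ 4) + q * C₀ * ((1 - γ) ^ 2)⁻¹ / k ^ 4 := by rw [hg]; ring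
    rw [e, hCg]
    exact le_add_of_nonneg_right (by positivity)
  have havg : ∀ q k : ℝ, q * C₀ * L ^ 2 * ((1 - γ) ^ 2)⁻¹ / (N * μ ^ 2 * k ^ 4)
      = q * (C₁ / k ^ 4) := fun q k => by
    rw [← hCg, hg]; ring
  refine ⟨?_, ?_⟩
  · intro p hp k₁ hk₁ R hR hn k hk
    have hlog : 0 < Real.log (6 * p * kap) := Real.log_pos (by nlinarith)
    have hk₁1 : 1 ≤ k₁ := by
      have : 0 < p - 2 := by linarith
      rw [hk₁]
      exact Nat.one_le_ceil_iff.2 (by positivity)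
    have hk0 : (0 : ℝ) < k := by exact_mod_cast (by omega : 0 < k)
    obtain ⟨b1, b2⟩ := hb S Ω P grad w p hp k₁ hk₁1 R hR hn k (by omega) (by omega)
    have hX : 0 ≤ 1 / (k : ℝ) ^ (p - 2) * (D / N) := by positivity
    have e : C₁ * p ^ 4 / (k : ℝ) ^ 4 = p ^ 4 * (C₁ / k ^ 4) := by ring
    have hc : 0 ≤ p ^ 4 * (C₁ / (k : ℝ) ^ 4) := by positivity
    rw [e] at b1 b2
    refine ⟨b1.trans (ENNReal.ofReal_le_ofReal ?_),
      fun i => (b2 i).trans (ENNReal.ofReal_le_ofReal ?_)⟩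
    · rw [havg]
      exact DistASG.final_combination (by norm_num) hK hKV hX (by linarith) hc (by linarith) hk0 hV₀
        (by norm_num)
    · have hn' := hnode (p ^ 4) k (by positivity) hk0
      exact DistASG.final_combination (by norm_num) hK hKV hX (by linarith) (by linarith)
        (by linarith) hk0 hV₀ (by norm_num)
  · intro C hC k hk k₁ hk₁ R hR hn
    have hk2 : (2 : ℝ) ≤ k := by linarith
    have hk0 : (0 : ℝ) < k := by linarith
    have hk2' : 2 ≤ k := by exact_mod_cast hk2
    have hk₁1 : 1 ≤ k₁ := by
      rw [hk₁]
      exact Nat.one_le_ceil_iff.2 (by positivity)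
    -- As C ≥ 2, rounding k/C up exceeds k/2 by less than 1.
    have hk₁2 : 2 * k₁ < k + 2 := by
      have h1 := Nat.ceil_lt_add_one (by positivity : 0 ≤ (k : ℝ) / C)
      have h2 : (k : ℝ) / C ≤ k / 2 := div_le_div_of_nonneg_left hk0.le (by norm_num) hC
      rw [← hk₁] at h1
      have h3 : (2 * k₁ : ℝ) < k + 2 := by linarith
      exact_mod_cast h3
    have hk3 : k₁ < k := by
      rcases hk2'.eq_or_lt with rfl | h3
      · omega
      · omega
    obtain ⟨b1, b2⟩ := hb S Ω P grad w 7 le_rfl k₁ hk₁1 R hR hn k hk3 (by omega)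
    have hX : 0 ≤ Real.exp (-(k : ℝ) / (C * √kap)) * (D / N) := by positivity
    have e : C₁ * 7 ^ 4 / (k : ℝ) ^ 4 = 2401 * (1 * (C₁ / k ^ 4)) := by ring
    have ev : ∀ a : ℝ, a * 7 * (σ ^ 2 / (N * μ ^ 2)) / k = a * 7 * 1 * (σ ^ 2 / (N * μ ^ 2)) / k :=
      fun a => by ring
    have hc : 0 ≤ 1 * (C₁ / (k : ℝ) ^ 4) := by positivity
    rw [e, ev] at b1
    rw [e, ev] at b2
    rw [← one_mul V, ← one_mul C₀]
    refine ⟨b1.trans (ENNReal.ofReal_le_ofReal ?_),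
      fun i => (b2 i).trans (ENNReal.ofReal_le_ofReal ?_)⟩
    · rw [havg]
      exact DistASG.final_combination (by norm_num) hK hKV hX (by linarith) hc (by norm_num) hk0
        hV₀ (by norm_num)
    · have hn' := hnode 1 k (by positivity) hk0
      exact DistASG.final_combination (by norm_num) hK hKV hX (by linarith) (by linarith)
        (by norm_num) hk0 hV₀ (by norm_num)
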